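/- Let $\varepsilon>0$. There is a constant $C=C(\varepsilon)$ such that for every positive integer $q$ and every real $D\le\sqrt q$, $$\sum_{\chi \bmod q}^{*}|L(\tfrac12,\chi)|^2=\phi^*(q)\frac{\phi(q)}{q}\Big(\log\frac{q}{2\pi}+2\gamma+\frac{\Gamma'}{\Gamma}(\tfrac12)+2\sum_{p\mid q}\frac{\log p}{p-1}\Big)$$ $$\qquad+\,2\,\frac{\phi(q)}{q^{1/2}}\sum_{\substack{cd=q\\(c,d)=1}}\frac{\mu^2(c)}{\phi(c)}\,\frac{1}{\phi(\min\{c,d\})}\sum_{\psi \bmod \min\{c,d\}} i(\psi)\,\tau(\overline\psi)\big(\delta_{c<d}\,\overline\psi(-d)+\delta_{c>d}\,\overline\psi(c)\big)L_q(\tfrac12,\psi)^2+E,$$ where $$|E|\le C\Big(\frac1q\sum_{\substack{d\mid q\\ d\le D}}\phi(d)d^{3/2}+\sqrt q\sum_{\substack{d\mid q\\ d>D}}\frac{\phi(d)}{d^{3/2}}+q^{\varepsilon}+q^{\varepsilon-1}D^2\Big).$$ Here $\sum^*$ is the sum over the primitive Dirichlet characters modulo $q$ and $\phi^*(q)$ is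 their number; $\phi$ is Euler's function, $\mu$ the Möbius function, $\gamma$ Euler's constant, and $p$ runs over primes; the sum over $\psi$ runs over all Dirichlet characters modulo $\min\{c,d\}$; $i(\psi)=1$ if $\psi$ is even and $i(\psi)=-i$ if $\psi$ is odd; $\tau(\chi)=\sum_{a=1}^{m}\chi(a)e^{2\pi i a/m}$ is the Gauss sum of a character $\chi$ modulo $m$; $\delta_P$ is $1$ if $P$ is true and $0$ if $P$ is false; and $L_q(s,\psi)=L(s,\psi)\prod_{p\mid q}(1-\psi(p)p^{-s})$ is the analytic continuation of $\sum_{(n,q)=1}\psi(n)n^{-s}$. -/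

import Mathlib

open scoped Classical in
/-- `φ*(q)`, the number of primitive Dirichlet characters modulo `q`. -/
noncomputable def numPrimitive (q : ℕ) [NeZero q] : ℕ :=
  (Finset.univ.filter fun χ : DirichletCharacter ℂ q => χ.IsPrimitive).card

open scoped Classical in
/-- The sum of `|L(1/2, χ)|²` over all primitive Dirichlet characters `χ` modulo `q`. -/
noncomputable def primitiveMeanSquare (q : ℕ) [NeZero q] : ℝ :=
  ∑ χ ∈ Finset.univ.filter (fun χ : DirichletCharacter ℂ q => χ.IsPrimitive),
    ‖DirichletCharacter.LFunction χ (1 / 2)‖ ^ 2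

/-- `L_q(s, ψ)`: the (analytically continued) L-function of `ψ` with the Euler factors at the
primes dividing `q` removed, i.e. the continuation of the sum of `ψ(n) n⁻ˢ` over `n` prime
to `q`. -/
noncomputable def LCoprime (q : ℕ) {m : ℕ} [NeZero m] (s : ℂ) (ψ : DirichletCharacter ℂ m) : ℂ :=
  DirichletCharacter.LFunction ψ s * ∏ p ∈ q.primeFactors, (1 - ψ (p : ZMod m) * (p : ℂ) ^ (-s))

/-- If `m ∣ q`, then `LCoprime q s ψ` is the L-function of the character modulo `q` induced
by `ψ`. -/
lemma LCoprime_eq_changeLevel {q m : ℕ} [NeZero m] [NeZero q] (h : m ∣ q)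
    (ψ : DirichletCharacter ℂ m) {s : ℂ} (hs : ψ ≠ 1 ∨ s ≠ 1) :
    LCoprime q s ψ = DirichletCharacter.LFunction (DirichletCharacter.changeLevel h ψ) s :=
  (DirichletCharacter.LFunction_changeLevel h ψ hs).symm

open scoped Classical in
/-- `i(ψ)`, which is `-i` if `ψ` is odd and `1` if `ψ` is even. -/
noncomputable def parityFactor {m : ℕ} (ψ : DirichletCharacter ℂ m) : ℂ :=
  if ψ.Odd then -Complex.I else 1

/-- The Gauss sum `τ(χ) = ∑_{a mod m} χ(a) e(a/m)`. -/
noncomputable def gaussTau {m : ℕ} [NeZero m] (χ : DirichletCharacter ℂ m) : ℂ :=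
  gaussSum χ (ZMod.stdAddChar (N := m))

/-- The sum over all characters `ψ` modulo `m` of
`i(ψ) τ(ψ̄) (δ_{c<d} ψ̄(-d) + δ_{c>d} ψ̄(c)) L_q(1/2, ψ)²`. -/
noncomputable def characterSum (q c d m : ℕ) [NeZero m] : ℂ :=
  ∑ ψ : DirichletCharacter ℂ m,
    parityFactor ψ * gaussTau ψ⁻¹ *
      ((if c < d then ψ⁻¹ (-(d : ZMod m)) else 0) + (if d < c then ψ⁻¹ (c : ZMod m) else 0)) *
      LCoprime q (1 / 2) ψ ^ 2

/-- The secondary terms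
`2 φ(q)/√q ∑_{cd=q, (c,d)=1} μ²(c)/φ(c) · 1/φ(min(c,d)) ∑_{ψ mod min(c,d)} …`
(factors of `q ≠ 0` are positive, so the case distinction on `min c d ≠ 0` is vacuous there). -/
noncomputable def secondaryTerms (q : ℕ) : ℂ :=
  2 * ((Nat.totient q : ℂ) / ((Real.sqrt q : ℝ) : ℂ)) *
    ∑ x ∈ q.divisorsAntidiagonal.filter (fun x : ℕ × ℕ => Nat.Coprime x.1 x.2),
      ((ArithmeticFunction.moebius x.1 : ℂ) ^ 2 / (Nat.totient x.1 : ℂ)) *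
        (1 / (Nat.totient (min x.1 x.2) : ℂ)) *
        (if h : min x.1 x.2 ≠ 0 then
          haveI : NeZero (min x.1 x.2) := ⟨h⟩
          characterSum q x.1 x.2 (min x.1 x.2)
        else 0)

/-- The main term
`φ*(q) φ(q)/q (log (q/2π) + 2γ + Γ'/Γ(1/2) + 2 ∑_{p ∣ q} log p/(p-1))`. -/
noncomputable def mainTerm (q : ℕ) [NeZero q] : ℝ :=
  (numPrimitive q : ℝ) * ((Nat.totient q : ℝ) / q) *
    (Real.log (q / (2 * Real.pi)) + 2 * Real.eulerMascheroniConstant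
      + deriv Real.Gamma (1 / 2) / Real.Gamma (1 / 2)
      + 2 * ∑ p ∈ q.primeFactors, Real.log p / ((p : ℝ) - 1))

/-- The size of the error term,
`1/q ∑_{d ∣ q, d ≤ D} φ(d) d^{3/2} + √q ∑_{d ∣ q, d > D} φ(d)/d^{3/2} + q^ε + q^{ε-1} D²`. -/
noncomputable def errorSize (q : ℕ) (D ε : ℝ) : ℝ :=
  1 / (q : ℝ) * ∑ d ∈ q.divisors.filter (fun d : ℕ => (d : ℝ) ≤ D),
      (Nat.totient d : ℝ) * (d : ℝ) ^ (3 / 2 : ℝ)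
    + Real.sqrt q * ∑ d ∈ q.divisors.filter (fun d : ℕ => D < (d : ℝ)),
      (Nat.totient d : ℝ) / (d : ℝ) ^ (3 / 2 : ℝ)
    + (q : ℝ) ^ ε + (q : ℝ) ^ (ε - 1) * D ^ 2

/-! For every `q > 1` the error is in fact `O(q^ε)`; the remaining summands of `errorSize` are
nonnegative, so this suffices.

Write `ζ(x)` for the Hurwitz zeta function at `s = 1/2`, taken on `(0, 1]` and extended with period
1 (`periodicZeta`). It is real, behaves like `1/√x` at `0+`, and satisfies the distribution relation
`∑_{t<k} ζ(x + t/k) = √k ζ(kx)`. The functional equation at the central point says that it is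
self-dual under the discrete Hartley transform, whose kernel is `cas = cos + sin`
(`sum_periodicZeta_mul_casFun`). Since `L(1/2, χ) = q^{-1/2} ∑ χ(a) ζ(a/q)`, this yields for
primitive `χ` the identity `|L|² = q^{-1/2} (∑ χ̄(x) cas(2πx/q)) L²`. Möbius inversion over moduli,
orthogonality and a Ramanujan sum along a progression turn the mean square into a sum over coprime
factorisations `cd = q` of twisted second moments of `ζ` (`primitiveMeanSquare_eq`). The secondary
terms have the same shape, except that for `c < d` the modulus `d` is exchanged for `c` and the
twist changes accordingly (`secondaryTerms_eq`).

Removing the coprimality conditions by Möbius and applying self-duality again reduces every moment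
to correlations `corr j e f = j^{-1/2} ∑_{r mod j} ζ(er/j) ζ(fr/j)` (`momentTerm_eq`). The heart of
the proof is the reciprocity law `exists_abs_corr_sub_le`: for coprime `e, f`, `corr j e f` equals
`√(j/ef) (log(j/ef) + const) + corr e f (-j) + corr f e (-j)` up to `O(√(ef/j) (1 + log ef))`. To
prove it, sum `ζ(r/j + h/e) ζ(r/j + t/f)` over all `h mod e`, `t mod f`; the distribution relation
makes this a multiple of `corr j e f`. For `(h, t) ≠ (0, 0)` the two singularities are distinct, and
subtracting constants from the factors cancels each singularity against a zero of the other factor.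
The sum is then a Riemann sum of a function of controlled variation, so it may be compared with the
grid of mesh `1/(jef)`, where all correlations are explicit (`corr_mul`, `corr_of_dvd`). The
subtracted singular parts produce the two dual correlations. The diagonal term `∑ ζ(r/j)²` is
evaluated separately, its constant coming from `∫₀¹ (ζ(x)² - 1/x) dx = -log(8π)`, a consequence of
Stirling's formula.

It remains to sum with weights over three binary choices at each prime of `q`. The main terms factor
over primes and sum exactly to `mainTerm` (`mainTerm_eq_sum`). The weights are symmetric under
exchanging `e` and `f` (`sum_weight_corr_swap`), so the two dual correlations may be merged into
twice one of them, which is the secondary term when `c < d`. When `c > d`, the weight makes the main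
term and the dual correlations negligible, so the secondary term may keep the original correlation,
counted twice. Each choice contributes `O(1 + log q)` (`exists_weight_bracket_le`), and there are
`8^ω(q)` choices. -/

open Filter Topology

/-! ### The Hurwitz zeta function at 1/2 as a regularised series -/

/-- The general term of the series representing `ζ(s, x) + x ^ (1 - s) / (1 - s)` for `0 < re s`. -/
noncomputable def hurwitzTerm (x : ℝ) (k : ℕ) (s : ℂ) : ℂ :=
  ((k + x : ℝ) : ℂ) ^ (-s) -
    (((k + 1 + x : ℝ) : ℂ) ^ (1 - s) - ((k + x : ℝ) : ℂ) ^ (1 - s)) / (1 - s)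

lemma hasDerivAt_ofReal_cpow_neg {t : ℝ} (ht : 0 < t) (s : ℂ) :
    HasDerivAt (fun u : ℝ => (u : ℂ) ^ (-s)) (-s * (t : ℂ) ^ (-s - 1)) t := by
  have h := (hasDerivAt_id (t : ℂ)).cpow_const (c := -s) (Or.inl (by simpa using ht))
  simpa using h.comp_ofReal

lemma norm_ofReal_cpow_sub_le {a t : ℝ} (ha : 0 < a) (hat : a ≤ t) {s : ℂ} (hs : 0 ≤ s.re) :
    ‖(t : ℂ) ^ (-s) - (a : ℂ) ^ (-s)‖ ≤ ‖s‖ * a ^ (-s.re - 1) * (t - a) := by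
  have h := (convex_Icc a t).norm_image_sub_le_of_norm_hasDerivWithin_le
    (f := fun u : ℝ => (u : ℂ) ^ (-s)) (f' := fun u : ℝ => -s * (u : ℂ) ^ (-s - 1))
    (C := ‖s‖ * a ^ (-s.re - 1)) (x := a) (y := t)
    (fun u hu => (hasDerivAt_ofReal_cpow_neg (ha.trans_le hu.1) s).hasDerivWithinAt)
    (fun u hu => ?_) ⟨le_rfl, hat⟩ ⟨hat, le_rfl⟩
  · rwa [Real.norm_of_nonneg (sub_nonneg.2 hat)] at h
  · have hu0 := ha.trans_le hu.1
    rw [norm_mul, norm_neg, Complex.norm_cpow_eq_rpow_re_of_pos hu0]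
    gcongr
    simpa using Real.rpow_le_rpow_of_nonpos ha hu.1 (by linarith : -s.re - 1 ≤ 0)

/-- The term is minus the integral of `t^{-s} - a^{-s}` over `[a, a + 1]` with `a = k + x`.
Subtracting the integral thus gains one power of `a`, which moves convergence from `re s > 1` to `re
s > 0`. -/
lemma norm_hurwitzTerm_le {x : ℝ} {k : ℕ} (hk : 0 < k + x) {s : ℂ} (hs : 0 ≤ s.re) (hs1 : s ≠ 1) :
    ‖hurwitzTerm x k s‖ ≤ ‖s‖ * (k + x) ^ (-s.re - 1) := by
  set a := (k + x : ℝ) with ha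
  have hne : 1 - s ≠ 0 := sub_ne_zero.2 hs1.symm
  have hd : ∀ t : ℝ, 0 < t → HasDerivAt (fun u : ℝ => (u : ℂ) ^ (1 - s) / (1 - s) -
      u * (a : ℂ) ^ (-s)) ((t : ℂ) ^ (-s) - (a : ℂ) ^ (-s)) t := by
    intro t ht
    have h := ((hasDerivAt_id (t : ℂ)).cpow_const (c := 1 - s) (Or.inl (by simpa using ht)))
    have h2 := (h.comp_ofReal.div_const (1 - s)).sub
      ((hasDerivAt_id (t : ℂ)).comp_ofReal.mul_const ((a : ℂ) ^ (-s)))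
    have e : (1 - s) * (t : ℂ) ^ (1 - s - 1) * 1 / (1 - s) - 1 * (a : ℂ) ^ (-s)
        = (t : ℂ) ^ (-s) - (a : ℂ) ^ (-s) := by
      rw [show 1 - s - 1 = -s by ring]; field_simp
    exact h2.congr_deriv e
  have h := (convex_Icc a (a + 1)).norm_image_sub_le_of_norm_hasDerivWithin_le
    (C := ‖s‖ * a ^ (-s.re - 1)) (x := a) (y := a + 1)
    (fun u hu => (hd u (hk.trans_le hu.1)).hasDerivWithinAt)
    (fun u hu => ?_) ⟨le_rfl, by linarith⟩ ⟨by linarith, le_rfl⟩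
  · have e : hurwitzTerm x k s = -((((a + 1 : ℝ) : ℂ) ^ (1 - s) / (1 - s) -
        ((a + 1 : ℝ) : ℂ) * (a : ℂ) ^ (-s)) -
        ((a : ℂ) ^ (1 - s) / (1 - s) - a * (a : ℂ) ^ (-s))) := by
      rw [hurwitzTerm, show (k + 1 + x : ℝ) = a + 1 by rw [ha]; ring, ← ha]
      push_cast; ring
    rw [e, norm_neg]
    simpa using h
  · refine (norm_ofReal_cpow_sub_le hk hu.1 hs).trans ?_
    have : u - a ≤ 1 := by linarith [hu.2]
    exact mul_le_of_le_one_right (by positivity) this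

/-- A truncated vertical strip avoiding the pole of the Hurwitz zeta function. -/
def hurwitzDomain : Set ℂ := {s | 1 / 4 < s.re ∧ ‖s‖ < 3 ∧ s ≠ 1}

lemma isOpen_hurwitzDomain : IsOpen hurwitzDomain :=
  (isOpen_lt continuous_const Complex.continuous_re).inter
    ((isOpen_lt continuous_norm continuous_const).inter isOpen_ne)

/-- On the domain the exponent `-re s - 1` lies between `-4` and `-5/4`. The term `k = 0` is
separate because its base `x` may be smaller than 1. -/
lemma norm_hurwitzTerm_le_of_mem {x : ℝ} (hx : 0 < x) (k : ℕ) {s : ℂ} (hs : s ∈ hurwitzDomain) :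
    ‖hurwitzTerm x k s‖ ≤ if k = 0 then 3 * max 1 (x ^ (-4 : ℝ)) else 3 * (k : ℝ) ^ (-(5 / 4 : ℝ)) := by
  have hk : 0 < k + x := by positivity
  refine (norm_hurwitzTerm_le hk (by linarith [hs.1]) hs.2.2).trans ?_
  have hre : s.re < 3 := (Complex.re_le_norm s).trans_lt hs.2.1
  split_ifs with h
  · subst h
    refine mul_le_mul hs.2.1.le ?_ (by positivity) (by norm_num)
    simp only [Nat.cast_zero, zero_add]
    rcases le_total x 1 with h1 | h1
    · exact (Real.rpow_le_rpow_of_exponent_ge hx h1 (by linarith)).trans (le_max_right _ _)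
    · exact (Real.rpow_le_one_of_one_le_of_nonpos h1 (by linarith [hs.1])).trans (le_max_left _ _)
  · have hk1 : (1 : ℝ) ≤ k := by exact_mod_cast Nat.one_le_iff_ne_zero.2 h
    refine mul_le_mul hs.2.1.le ?_ (by positivity) (by norm_num)
    calc (k + x) ^ (-s.re - 1) ≤ (k : ℝ) ^ (-s.re - 1) :=
          Real.rpow_le_rpow_of_nonpos (by positivity) (by linarith) (by linarith [hs.1])
      _ ≤ _ := Real.rpow_le_rpow_of_exponent_le hk1 (by linarith [hs.1])

lemma summable_hurwitzBound (c : ℝ) :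
    Summable fun k : ℕ => if k = 0 then c else 3 * (k : ℝ) ^ (-(5 / 4 : ℝ)) := by
  have h : Summable fun k : ℕ => 3 * (k : ℝ) ^ (-(5 / 4 : ℝ)) :=
    (Real.summable_nat_rpow.2 (by norm_num)).mul_left _
  refine (summable_congr_cofinite ?_).1 h
  filter_upwards [(Set.finite_singleton 0).compl_mem_cofinite] with k hk
  have : k ≠ 0 := by simpa using hk
  simp [this]

lemma differentiableOn_tsum_hurwitzTerm {x : ℝ} (hx : 0 < x) :
    DifferentiableOn ℂ (fun s => ∑' k, hurwitzTerm x k s) hurwitzDomain := by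
  refine Complex.differentiableOn_tsum_of_summable_norm (summable_hurwitzBound _) (fun k s hs => ?_)
    isOpen_hurwitzDomain (fun k s hs => norm_hurwitzTerm_le_of_mem hx k hs)
  have hne : 1 - s ≠ 0 := sub_ne_zero.2 hs.2.2.symm
  have h1 : ((k + x : ℝ) : ℂ) ≠ 0 := Complex.ofReal_ne_zero.2 (by positivity)
  have h2 : ((k + 1 + x : ℝ) : ℂ) ≠ 0 := Complex.ofReal_ne_zero.2 (by positivity)
  have e1 : DifferentiableAt ℂ (fun s : ℂ => ((k + x : ℝ) : ℂ) ^ (-s)) s :=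
    differentiableAt_id.neg.const_cpow (Or.inl h1)
  have e2 : DifferentiableAt ℂ (fun s : ℂ => ((k + x : ℝ) : ℂ) ^ (1 - s)) s :=
    (differentiableAt_id.const_sub 1).const_cpow (Or.inl h1)
  have e3 : DifferentiableAt ℂ (fun s : ℂ => ((k + 1 + x : ℝ) : ℂ) ^ (1 - s)) s :=
    (differentiableAt_id.const_sub 1).const_cpow (Or.inl h2)
  exact (e1.sub ((e3.sub e2).div (differentiableAt_id.const_sub 1) hne)).differentiableWithinAt

lemma tendsto_sum_hurwitzTerm {x : ℝ} (hx : 0 < x) {s : ℂ} (hs : s ∈ hurwitzDomain) :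
    Tendsto (fun n => ∑ k ∈ Finset.range n, ((k + x : ℝ) : ℂ) ^ (-s) -
      (((n + x : ℝ) : ℂ) ^ (1 - s) - (x : ℂ) ^ (1 - s)) / (1 - s)) atTop
      (𝓝 (∑' k, hurwitzTerm x k s)) := by
  have hsum : Summable fun k => hurwitzTerm x k s :=
    Summable.of_norm_bounded (summable_hurwitzBound _) fun k => norm_hurwitzTerm_le_of_mem hx k hs
  refine hsum.hasSum.tendsto_sum_nat.congr fun n => ?_
  simp only [hurwitzTerm, Finset.sum_sub_distrib, ← Finset.sum_div]
  have := Finset.sum_range_sub (fun k : ℕ => ((k + x : ℝ) : ℂ) ^ (1 - s)) n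
  simp only [Nat.cast_add, Nat.cast_one, Nat.cast_zero, zero_add] at this
  rw [← Finset.sum_sub_distrib, this]

/-- In the half-plane of absolute convergence the boundary term `(n + x)^{1-s}` of the telescoped
sum tends to 0. -/
lemma tsum_hurwitzTerm_of_one_lt_re {x : ℝ} (hx : 0 < x) (hx1 : x ≤ 1) {s : ℂ}
    (hs : s ∈ hurwitzDomain) (h1 : 1 < s.re) :
    ∑' k, hurwitzTerm x k s = HurwitzZeta.hurwitzZeta x s + (x : ℂ) ^ (1 - s) / (1 - s) := by
  refine tendsto_nhds_unique (tendsto_sum_hurwitzTerm hx hs) ?_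
  have h := (HurwitzZeta.hasSum_hurwitzZeta_of_one_lt_re ⟨hx.le, hx1⟩ h1).tendsto_sum_nat
  have h2 : Tendsto (fun n : ℕ => ((n + x : ℝ) : ℂ) ^ (1 - s)) atTop (𝓝 0) := by
    rw [tendsto_zero_iff_norm_tendsto_zero]
    have : Tendsto (fun n : ℕ => (n + x : ℝ) ^ (-(s.re - 1))) atTop (𝓝 0) :=
      (tendsto_rpow_neg_atTop (by linarith)).comp
        (tendsto_atTop_add_const_right _ _ tendsto_natCast_atTop_atTop)
    refine this.congr fun n => ?_
    rw [Complex.norm_cpow_eq_rpow_re_of_pos (by positivity)]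
    simp
  have h3 := h.sub ((h2.sub_const ((x : ℂ) ^ (1 - s))).div_const (1 - s))
  have e : HurwitzZeta.hurwitzZeta x s - (0 - (x : ℂ) ^ (1 - s)) / (1 - s)
      = HurwitzZeta.hurwitzZeta x s + (x : ℂ) ^ (1 - s) / (1 - s) := by ring
  rw [e] at h3
  refine h3.congr fun n => ?_
  congr 1
  refine Finset.sum_congr rfl fun k _ => ?_
  rw [Complex.cpow_neg, one_div]
  push_cast; rfl

/-- Identity theorem on the convex set cut out of the domain by `im s > 0`, which avoids the pole at
1 and is visibly connected. The point `1/2` lies on its boundary and is reached by continuity along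
a vertical segment. -/
lemma tsum_hurwitzTerm_eq {x : ℝ} (hx : 0 < x) (hx1 : x ≤ 1) :
    ∑' k, hurwitzTerm x k (1 / 2) =
      HurwitzZeta.hurwitzZeta x (1 / 2) + (x : ℂ) ^ (1 - 1 / 2 : ℂ) / (1 - 1 / 2) := by
  set f : ℂ → ℂ := fun s => ∑' k, hurwitzTerm x k s
  set g : ℂ → ℂ := fun s => HurwitzZeta.hurwitzZeta x s + (x : ℂ) ^ (1 - s) / (1 - s)
  have hg : DifferentiableOn ℂ g hurwitzDomain := by
    intro s hs
    have hne : 1 - s ≠ 0 := sub_ne_zero.2 hs.2.2.symm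
    have h1 : (x : ℂ) ≠ 0 := Complex.ofReal_ne_zero.2 hx.ne'
    exact ((HurwitzZeta.differentiableAt_hurwitzZeta _ hs.2.2).add
      (((differentiableAt_id.const_sub 1).const_cpow (Or.inl h1)).div
        (differentiableAt_id.const_sub 1) hne)).differentiableWithinAt
  have hf : DifferentiableOn ℂ f hurwitzDomain := differentiableOn_tsum_hurwitzTerm hx
  set U : Set ℂ := {s | 1 / 4 < s.re} ∩ (Metric.ball 0 3 ∩ {s | 0 < s.im}) with hU
  have hUo : IsOpen U := (isOpen_lt continuous_const Complex.continuous_re).inter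
    (Metric.isOpen_ball.inter (isOpen_lt continuous_const Complex.continuous_im))
  have hUc : Convex ℝ U := (convex_halfSpace_re_gt _).inter
    ((convex_ball _ _).inter (convex_halfSpace_im_gt _))
  have hUD : U ⊆ hurwitzDomain := fun s hs => ⟨hs.1, by simpa using hs.2.1, by
    rintro rfl; simpa using hs.2.2⟩
  have hp : (2 + Complex.I / 2 : ℂ) ∈ U := by
    refine ⟨by simp; norm_num, ?_, by simp⟩
    rw [mem_ball_zero_iff]
    refine (norm_add_le _ _).trans_lt ?_
    simp; norm_num
  have heq : Set.EqOn f g U := by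
    refine AnalyticOnNhd.eqOn_of_preconnected_of_eventuallyEq
      ((hf.mono hUD).analyticOnNhd hUo) ((hg.mono hUD).analyticOnNhd hUo) hUc.isPreconnected hp ?_
    have : U ∩ {s | 1 < s.re} ∈ 𝓝 (2 + Complex.I / 2 : ℂ) :=
      (hUo.inter (isOpen_lt continuous_const Complex.continuous_re)).mem_nhds ⟨hp, by simp⟩
    filter_upwards [this] with s hs
    exact tsum_hurwitzTerm_of_one_lt_re hx hx1 (hUD hs.1) hs.2
  have hh : (1 / 2 : ℂ) ∈ hurwitzDomain := by
    refine ⟨by simp; norm_num, by simp; norm_num, by norm_num⟩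
  have hlim : Tendsto (fun t : ℝ => (1 / 2 : ℂ) + t * Complex.I) (𝓝[>] 0) (𝓝 (1 / 2)) := by
    have : Continuous fun t : ℝ => (1 / 2 : ℂ) + t * Complex.I := by fun_prop
    simpa using (this.tendsto 0).mono_left nhdsWithin_le_nhds
  have hcf := ((hf.differentiableAt (isOpen_hurwitzDomain.mem_nhds hh)).continuousAt.tendsto).comp hlim
  have hcg := ((hg.differentiableAt (isOpen_hurwitzDomain.mem_nhds hh)).continuousAt.tendsto).comp hlim
  refine tendsto_nhds_unique hcf (hcg.congr' ?_)
  filter_upwards [Ioo_mem_nhdsGT (zero_lt_one' ℝ)] with t ht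
  refine (heq ⟨by simp; norm_num, ?_, by simpa using ht.1⟩).symm
  rw [mem_ball_zero_iff]
  refine (norm_add_le _ _).trans_lt ?_
  have := abs_of_pos ht.1
  simp only [norm_div, norm_one, Complex.norm_two, norm_mul, Complex.norm_real, Real.norm_eq_abs,
    this, Complex.norm_I, mul_one]
  linarith [ht.2]

/-! ### Limit formulas and increments of ζ(1/2, x) -/

/-- The Hurwitz zeta function `ζ(1/2, x)` for real `x > 0`. -/
noncomputable def hurwitzHalf (x : ℝ) : ℝ := (∑' k, hurwitzTerm x k (1 / 2)).re - 2 * √x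

lemma ofReal_cpow_half {t : ℝ} (ht : 0 ≤ t) : (t : ℂ) ^ (1 - 1 / 2 : ℂ) = (√t : ℝ) := by
  rw [Real.sqrt_eq_rpow, Complex.ofReal_cpow ht]; norm_num

lemma ofReal_cpow_neg_half {t : ℝ} (ht : 0 ≤ t) : (t : ℂ) ^ (-(1 / 2) : ℂ) = ((√t)⁻¹ : ℝ) := by
  rw [Complex.cpow_neg, Real.sqrt_eq_rpow, Complex.ofReal_inv, Complex.ofReal_cpow ht]; norm_num

lemma half_mem_hurwitzDomain : (1 / 2 : ℂ) ∈ hurwitzDomain :=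
  ⟨by simp; norm_num, by simp; norm_num, by norm_num⟩

lemma tendsto_sum_hurwitzTerm_half {x : ℝ} (hx : 0 < x) :
    Tendsto (fun n : ℕ => ((∑ k ∈ Finset.range n, (√(k + x))⁻¹ - 2 * (√(n + x) - √x) : ℝ) : ℂ))
      atTop (𝓝 (∑' k, hurwitzTerm x k (1 / 2))) := by
  refine (tendsto_sum_hurwitzTerm hx half_mem_hurwitzDomain).congr fun n => ?_
  rw [ofReal_cpow_half (by positivity), ofReal_cpow_half hx.le]
  have e : ∀ k ∈ Finset.range n, ((k + x : ℝ) : ℂ) ^ (-(1 / 2) : ℂ) = ((√(k + x))⁻¹ : ℝ) :=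
    fun k _ => ofReal_cpow_neg_half (by positivity)
  rw [Finset.sum_congr rfl e]
  push_cast
  ring

lemma tendsto_hurwitzHalf {x : ℝ} (hx : 0 < x) :
    Tendsto (fun n : ℕ => ∑ k ∈ Finset.range n, (√(k + x))⁻¹ - 2 * √(n + x)) atTop
      (𝓝 (hurwitzHalf x)) := by
  have h2 := ((Complex.continuous_re.tendsto _).comp
    (tendsto_sum_hurwitzTerm_half hx)).sub_const (2 * √x)
  refine h2.congr fun n => ?_
  simp only [Function.comp, Complex.ofReal_re]
  ring

lemma hurwitzZeta_half {x : ℝ} (hx : 0 < x) (hx1 : x ≤ 1) :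
    HurwitzZeta.hurwitzZeta x (1 / 2) = hurwitzHalf x := by
  have him : (∑' k, hurwitzTerm x k (1 / 2)).im = 0 := by
    refine tendsto_nhds_unique ((Complex.continuous_im.tendsto _).comp
      (tendsto_sum_hurwitzTerm_half hx)) ?_
    simp [Function.comp_def]
  have h := tsum_hurwitzTerm_eq hx hx1
  rw [ofReal_cpow_half hx.le] at h
  have e : HurwitzZeta.hurwitzZeta x (1 / 2) = ∑' k, hurwitzTerm x k (1 / 2) - 2 * (√x : ℝ) := by
    rw [h]; ring
  rw [e, hurwitzHalf]
  apply Complex.ext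
  · simp
  · rw [Complex.sub_im, him]; simp

/-- With the counterterm independent of `x`, values at two points can be compared term by term. -/
lemma tendsto_hurwitzHalf' {x : ℝ} (hx : 0 < x) :
    Tendsto (fun n : ℕ => ∑ k ∈ Finset.range n, (√(k + x))⁻¹ - 2 * √n) atTop
      (𝓝 (hurwitzHalf x)) := by
  have h0 : Tendsto (fun n : ℕ => 2 * (√(n + x) - √n)) atTop (𝓝 0) := by
    have h1 : Tendsto (fun n : ℕ => 2 * x * (√n)⁻¹) atTop (𝓝 (2 * x * 0)) :=
      ((tendsto_inv_atTop_zero.comp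
        (Real.tendsto_sqrt_atTop.comp tendsto_natCast_atTop_atTop))).const_mul _
    rw [mul_zero] at h1
    refine squeeze_zero' (Eventually.of_forall fun n => ?_) ?_ h1
    · have := Real.sqrt_le_sqrt (show (n : ℝ) ≤ n + x by linarith)
      linarith
    · filter_upwards [eventually_gt_atTop 0] with n hn
      have hn' : (0 : ℝ) < n := by exact_mod_cast hn
      have hs : 0 < √(n : ℝ) := Real.sqrt_pos.2 hn'
      have hs2 : 0 < √(n + x) := Real.sqrt_pos.2 (by linarith)
      have e1 := Real.sq_sqrt hn'.le
      have e2 := Real.sq_sqrt (show 0 ≤ n + x by linarith)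
      rw [← div_eq_mul_inv, le_div_iff₀ hs]
      have hle := Real.sqrt_le_sqrt (show (n : ℝ) ≤ n + x by linarith)
      nlinarith
  have := (tendsto_hurwitzHalf hx).add h0
  rw [add_zero] at this
  exact this.congr fun n => by ring

lemma hurwitzHalf_add_one {x : ℝ} (hx : 0 < x) : hurwitzHalf x = (√x)⁻¹ + hurwitzHalf (x + 1) := by
  have h1 := (tendsto_hurwitzHalf hx).comp (tendsto_add_atTop_nat 1)
  have h2 := (tendsto_hurwitzHalf (by linarith : 0 < x + 1)).const_add (√x)⁻¹
  refine tendsto_nhds_unique h1 (h2.congr fun n => ?_)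
  simp only [Function.comp, Finset.sum_range_succ']
  push_cast
  rw [zero_add, add_assoc (n : ℝ) 1 x, add_comm 1 x]
  have : ∀ k ∈ Finset.range n, (√((k : ℝ) + (x + 1)))⁻¹ = (√((k : ℝ) + 1 + x))⁻¹ := by
    intro k _; ring_nf
  rw [Finset.sum_congr rfl this]
  ring

lemma summable_inv_mul_sqrt : Summable fun k : ℕ => ((k + 1 : ℝ) * √(k + 1))⁻¹ := by
  have h := (summable_nat_add_iff 1).2 (Real.summable_nat_rpow_inv.2 (by norm_num : (1 : ℝ) < 3 / 2))
  refine h.congr fun k => ?_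
  push_cast
  rw [Real.sqrt_eq_rpow, show (3 / 2 : ℝ) = 1 + 1 / 2 by norm_num,
    Real.rpow_add (by positivity), Real.rpow_one]

/-- A Lipschitz constant on `(0, ∞)` for `ζ(1/2, x) - 1 / √x`. -/
noncomputable def hurwitzLip : ℝ := ∑' k : ℕ, ((k + 1 : ℝ) * √(k + 1))⁻¹

lemma hurwitzLip_nonneg : 0 ≤ hurwitzLip := tsum_nonneg fun k => by positivity

lemma inv_sqrt_anti {x y : ℝ} (hx : 0 < x) (hxy : x ≤ y) : (√y)⁻¹ ≤ (√x)⁻¹ :=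
  inv_anti₀ (Real.sqrt_pos.2 hx) (Real.sqrt_le_sqrt hxy)

lemma inv_sqrt_sub_inv_sqrt_le {k x y : ℝ} (hk : 0 < k) (hx : 0 < x) (hxy : x ≤ y) :
    (√(k + x))⁻¹ - (√(k + y))⁻¹ ≤ (k * √k)⁻¹ * (y - x) := by
  have hk0 := Real.sqrt_pos.2 hk
  have ha := Real.sqrt_pos.2 (show 0 < k + x by linarith)
  have hb := Real.sqrt_pos.2 (show 0 < k + y by linarith)
  have hak := Real.sqrt_le_sqrt (show k ≤ k + x by linarith)
  have hbk := Real.sqrt_le_sqrt (show k ≤ k + y by linarith)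
  have hab := Real.sqrt_le_sqrt (show k + x ≤ k + y by linarith)
  have ea := Real.sq_sqrt (show 0 ≤ k + x by linarith)
  have eb := Real.sq_sqrt (show 0 ≤ k + y by linarith)
  have ek := Real.sq_sqrt hk.le
  set a := √(k + x)
  set b := √(k + y)
  set c := √k
  have e : a⁻¹ - b⁻¹ = (b - a) / (a * b) := by field_simp
  have e2 : y - x = (b - a) * (b + a) := by linear_combination ea - eb
  have hk' : k * c = c * c * c := by rw [← ek]; ring
  rw [e, e2, hk', inv_mul_eq_div, div_le_div_iff₀ (by positivity) (by positivity)]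
  have h1 := mul_le_mul hak hbk hk0.le ha.le
  have h2 := mul_le_mul h1 (show c ≤ b + a by linarith) hk0.le (by positivity)
  have h3 := mul_le_mul_of_nonneg_left h2 (sub_nonneg.2 hab)
  linarith

lemma sum_inv_sqrt_sub_le {x y : ℝ} (hx : 0 < x) (hxy : x ≤ y) (n : ℕ) :
    ∑ k ∈ Finset.range n, (√(k + 1 + x))⁻¹ - ∑ k ∈ Finset.range n, (√(k + 1 + y))⁻¹
      ≤ hurwitzLip * (y - x) := by
  rw [← Finset.sum_sub_distrib]
  calc _ ≤ ∑ k ∈ Finset.range n, ((k + 1 : ℝ) * √(k + 1))⁻¹ * (y - x) :=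
        Finset.sum_le_sum fun k _ => inv_sqrt_sub_inv_sqrt_le (by positivity) hx hxy
    _ ≤ _ := by
        rw [← Finset.sum_mul]
        exact mul_le_mul_of_nonneg_right
          (summable_inv_mul_sqrt.sum_le_tsum _ fun k _ => by positivity) (by linarith)

/-- The term `k = 0` is kept exactly because it carries the singularity; the terms `k ≥ 1` are
Lipschitz with summable constants of size `k^{-3/2}`. With the lower bound `le_hurwitzHalf_sub` this
is all that is used about increments. -/
lemma hurwitzHalf_sub_le {x y : ℝ} (hx : 0 < x) (hxy : x ≤ y) :
    hurwitzHalf x - hurwitzHalf y ≤ (√x)⁻¹ - (√y)⁻¹ + hurwitzLip * (y - x) := by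
  have h1 := (tendsto_hurwitzHalf' hx).comp (tendsto_add_atTop_nat 1)
  have h2 := (tendsto_hurwitzHalf' (hx.trans_le hxy)).comp (tendsto_add_atTop_nat 1)
  refine le_of_tendsto (h1.sub h2) (Eventually.of_forall fun n => ?_)
  have := sum_inv_sqrt_sub_le hx hxy n
  simp only [Function.comp, Finset.sum_range_succ']
  push_cast
  simp only [zero_add]
  linarith

lemma le_hurwitzHalf_sub {x y : ℝ} (hx : 0 < x) (hxy : x ≤ y) :
    (√x)⁻¹ - (√y)⁻¹ ≤ hurwitzHalf x - hurwitzHalf y := by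
  have h1 := (tendsto_hurwitzHalf' hx).comp (tendsto_add_atTop_nat 1)
  have h2 := (tendsto_hurwitzHalf' (hx.trans_le hxy)).comp (tendsto_add_atTop_nat 1)
  refine ge_of_tendsto (h1.sub h2) (Eventually.of_forall fun n => ?_)
  have : ∑ k ∈ Finset.range n, (√((k : ℝ) + 1 + y))⁻¹ ≤ ∑ k ∈ Finset.range n, (√((k : ℝ) + 1 + x))⁻¹ :=
    Finset.sum_le_sum fun k _ => inv_sqrt_anti (by positivity) (by linarith)
  simp only [Function.comp, Finset.sum_range_succ']
  push_cast
  simp only [zero_add]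
  linarith

lemma hurwitzHalf_anti {x y : ℝ} (hx : 0 < x) (hxy : x ≤ y) : hurwitzHalf y ≤ hurwitzHalf x := by
  linarith [le_hurwitzHalf_sub hx hxy, inv_sqrt_anti hx hxy]

/-- A constant `C` with `|ζ(1/2, x)| ≤ C / √x` on `(0, 1]`. -/
noncomputable def hurwitzBd : ℝ := |hurwitzHalf 1| + hurwitzLip + 1

lemma one_le_inv_sqrt {x : ℝ} (hx : 0 < x) (hx1 : x ≤ 1) : 1 ≤ (√x)⁻¹ := by
  have := inv_sqrt_anti hx hx1
  simpa using this

/-! ### The distribution relation and the periodic extension -/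

lemma sum_range_mul_eq {M : Type*} [AddCommMonoid M] (f : ℕ → M) (m k : ℕ) :
    ∑ a ∈ Finset.range (m * k), f a = ∑ r ∈ Finset.range m, ∑ t ∈ Finset.range k, f (r + m * t) := by
  rw [Finset.sum_comm, mul_comm]
  induction k with
  | zero => simp
  | succ k ih =>
    rw [Finset.sum_range_succ, ← ih, Nat.succ_mul, Finset.sum_range_add]
    congr 1
    exact Finset.sum_congr rfl fun i _ => by rw [add_comm, mul_comm]

/-- The `k` partial sums of length `n` interleave, after scaling by `√k`, into a single partial sum
of length `kn` at `x`. The counterterms match because `k · 2√n = √k · 2√(kn)`. -/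
lemma hurwitzHalf_distribution {x : ℝ} (hx : 0 < x) {k : ℕ} (hk : 0 < k) :
    ∑ t ∈ Finset.range k, hurwitzHalf ((x + t) / k) = √k * hurwitzHalf x := by
  have hk' : (0 : ℝ) < k := by exact_mod_cast hk
  have h1 : Tendsto (fun n : ℕ => ∑ t ∈ Finset.range k,
      (∑ m ∈ Finset.range n, (√(m + (x + t) / k))⁻¹ - 2 * √n)) atTop
      (𝓝 (∑ t ∈ Finset.range k, hurwitzHalf ((x + t) / k))) :=
    tendsto_finsetSum _ fun t _ => tendsto_hurwitzHalf' (by positivity)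
  have h2 : Tendsto (fun n : ℕ => k * n) atTop atTop :=
    tendsto_id.const_mul_atTop' hk
  have h3 := ((tendsto_hurwitzHalf' hx).comp h2).const_mul √k
  refine tendsto_nhds_unique h1 (h3.congr fun n => ?_)
  simp only [Function.comp, Finset.sum_sub_distrib, Finset.sum_const, Finset.card_range,
    nsmul_eq_mul]
  rw [sum_range_mul_eq, mul_sub, Finset.mul_sum]
  congr 1
  · refine Finset.sum_congr rfl fun t _ => ?_
    rw [Finset.mul_sum]
    refine Finset.sum_congr rfl fun m _ => ?_
    have e : (m + (x + t) / k : ℝ) = (((t + k * m : ℕ) : ℝ) + x) / k := by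
      push_cast; field_simp; ring
    rw [e, Real.sqrt_div (by positivity), inv_div, div_eq_mul_inv]
  · push_cast
    rw [Real.sqrt_mul hk'.le]
    have := Real.mul_self_sqrt hk'.le
    linear_combination (2 * √(n : ℝ)) * this

/-- The function `ζ(1/2, x)`, extended periodically from `(0, 1]`. -/
noncomputable def periodicZeta (x : ℝ) : ℝ := hurwitzHalf (x - ⌈x⌉ + 1)

lemma periodicZeta_add_int (x : ℝ) (n : ℤ) : periodicZeta (x + n) = periodicZeta x := by
  rw [periodicZeta, periodicZeta, Int.ceil_add_intCast]; push_cast; ring_nf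

lemma periodicZeta_eq_of_sub {x y : ℝ} (n : ℤ) (h : x - y = n) : periodicZeta x = periodicZeta y := by
  rw [← periodicZeta_add_int y n, ← h]; ring_nf

lemma periodicZeta_of_mem {x : ℝ} (hx : 0 < x) (hx1 : x ≤ 1) : periodicZeta x = hurwitzHalf x := by
  have : ⌈x⌉ = 1 := by rw [Int.ceil_eq_iff]; constructor <;> simp [*]
  rw [periodicZeta, this]; simp

lemma exists_int_sub_mem_Ioc (x : ℝ) : ∃ n : ℤ, 0 < x - n ∧ x - n ≤ 1 :=
  ⟨⌈x⌉ - 1, by push_cast; linarith [Int.ceil_lt_add_one x], by push_cast; linarith [Int.le_ceil x]⟩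

lemma hurwitzZeta_half_eq_periodicZeta (x : ℝ) :
    HurwitzZeta.hurwitzZeta (x : UnitAddCircle) (1 / 2) = periodicZeta x := by
  obtain ⟨n, h0, h1⟩ := exists_int_sub_mem_Ioc x
  have e : ((x : ℝ) : UnitAddCircle) = ((x - n : ℝ) : UnitAddCircle) := by
    rw [← sub_eq_zero, ← AddCircle.coe_sub, AddCircle.coe_eq_zero_iff]
    exact ⟨n, by simp⟩
  rw [e, hurwitzZeta_half h0 h1, ← periodicZeta_of_mem h0 h1,
    periodicZeta_eq_of_sub (x := x) (y := x - n) n (by ring)]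

/-! ### Sums of periodic functions over complete residue systems -/

lemma sum_range_eq_sum_zmod {M : Type*} [AddCommMonoid M] {N : ℕ} [NeZero N] (f : ZMod N → M) :
    ∑ r ∈ Finset.range N, f (r : ZMod N) = ∑ a : ZMod N, f a := by
  obtain ⟨n, rfl⟩ : ∃ n, N = n + 1 := ⟨N - 1, (Nat.succ_pred_eq_of_ne_zero (NeZero.ne N)).symm⟩
  rw [Finset.sum_range]
  refine Finset.sum_congr rfl fun i _ => ?_
  congr 1
  exact Fin.cast_val_eq_self i

lemma exists_zmod_lift {M : Type*} {N : ℕ} {G : ℤ → M} (hG : ∀ n, G (n + N) = G n) :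
    ∃ F : ZMod N → M, ∀ n : ℤ, F (n : ZMod N) = G n := by
  have hG' : ∀ (m n : ℤ), G (n + m * N) = G n := fun m n => by
    have : Function.Periodic G (N : ℤ) := hG
    exact_mod_cast this.int_mul m n
  refine ⟨fun a => G (a.cast : ℤ), fun n => ?_⟩
  have h : ((((n : ZMod N).cast : ℤ) : ZMod N)) = (n : ZMod N) := ZMod.intCast_zmod_cast _
  rw [ZMod.intCast_eq_intCast_iff_dvd_sub] at h
  obtain ⟨m, hm⟩ := h
  have : n = (n : ZMod N).cast + m * N := by linarith
  conv_rhs => rw [this, hG']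

section Periodic
variable {M : Type*} [AddCommMonoid M] {N : ℕ} {G : ℤ → M}

lemma sum_range_affine_of_periodic (hG : ∀ n, G (n + N) = G n) {u : ℤ} (hu : IsCoprime u (N : ℤ))
    (m : ℤ) : ∑ r ∈ Finset.range N, G (u * r + m) = ∑ r ∈ Finset.range N, G r := by
  rcases Nat.eq_zero_or_pos N with rfl | hN
  · simp
  have : NeZero N := ⟨hN.ne'⟩
  obtain ⟨F, hF⟩ := exists_zmod_lift hG
  have hu' : IsUnit (u : ZMod N) := (ZMod.coe_int_isUnit_iff_isCoprime u N).2 hu.symm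
  have h1 : ∀ r ∈ Finset.range N, G (u * r + m) = F ((u : ZMod N) * (r : ZMod N) + m) := by
    intro r _; rw [← hF]; push_cast; rfl
  have h2 : ∀ r ∈ Finset.range N, G r = F (r : ZMod N) := by
    intro r _; rw [← hF]; push_cast; rfl
  rw [Finset.sum_congr rfl h1, Finset.sum_congr rfl h2, sum_range_eq_sum_zmod F]
  refine (sum_range_eq_sum_zmod (fun a : ZMod N => F ((u : ZMod N) * a + m))).trans ?_
  exact Equiv.sum_comp ((hu'.unit.mulLeft).trans (Equiv.addRight (m : ZMod N))) F

lemma sum_range_add_of_periodic (hG : ∀ n, G (n + N) = G n) (m : ℤ) :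
    ∑ r ∈ Finset.range N, G (r + m) = ∑ r ∈ Finset.range N, G r := by
  simpa using sum_range_affine_of_periodic hG isCoprime_one_left m

lemma sum_range_mul_of_periodic (hG : ∀ n, G (n + N) = G n) {u : ℤ} (hu : IsCoprime u (N : ℤ)) :
    ∑ r ∈ Finset.range N, G (u * r) = ∑ r ∈ Finset.range N, G r := by
  simpa using sum_range_affine_of_periodic hG hu 0

lemma sum_range_neg_of_periodic (hG : ∀ n, G (n + N) = G n) :
    ∑ r ∈ Finset.range N, G (-r) = ∑ r ∈ Finset.range N, G r := by
  simpa using sum_range_mul_of_periodic hG (u := -1) (isCoprime_one_left.neg_left)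

end Periodic

/-- Moving `kx` into `(0, 1]` by an integer only permutes the residues `t` modulo `k`. Afterwards
all arguments `(kx - n + t)/k` lie in `(0, 1]`, where the periodic and the ordinary function agree.
-/
lemma periodicZeta_distribution (x : ℝ) {k : ℕ} (hk : 0 < k) :
    ∑ t ∈ Finset.range k, periodicZeta (x + t / k) = √k * periodicZeta (k * x) := by
  have hk' : (0 : ℝ) < k := by exact_mod_cast hk
  obtain ⟨n, h0, h1⟩ := exists_int_sub_mem_Ioc (k * x)
  have hper : ∀ m : ℤ, periodicZeta ((k * x - n + ((m + (k : ℕ) : ℤ) : ℝ)) / k)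
      = periodicZeta ((k * x - n + (m : ℝ)) / k) := fun m =>
    periodicZeta_eq_of_sub 1 (by push_cast; field_simp; ring)
  have h2 := sum_range_add_of_periodic
    (G := fun m : ℤ => periodicZeta ((k * x - n + (m : ℝ)) / k)) hper n
  have h3 : ∑ t ∈ Finset.range k, periodicZeta (x + t / k) = ∑ r ∈ Finset.range k,
      periodicZeta ((k * x - n + (((r : ℤ) + n : ℤ) : ℝ)) / k) := by
    refine Finset.sum_congr rfl fun t _ => ?_
    congr 1; push_cast; field_simp; ring
  rw [h3, h2, periodicZeta_eq_of_sub (x := k * x) (y := k * x - n) n (by ring),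
    periodicZeta_of_mem h0 h1, ← hurwitzHalf_distribution h0 hk]
  refine Finset.sum_congr rfl fun t ht => ?_
  have ht' : (t : ℝ) + 1 ≤ k := by exact_mod_cast Finset.mem_range.1 ht
  rw [← periodicZeta_of_mem (by positivity) (by rw [div_le_one hk']; linarith)]
  push_cast; rfl

/-! ### The functional equation as a discrete Hartley transform -/

/-- `cos + sin`. -/
noncomputable def casFun (x : ℝ) : ℝ := Real.cos x + Real.sin x

lemma casFun_add_int (x : ℝ) (n : ℤ) :
    casFun (2 * Real.pi * (x + n)) = casFun (2 * Real.pi * x) := by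
  rw [mul_add, mul_comm (2 * Real.pi) (n : ℝ), casFun, casFun, Real.cos_add_int_mul_two_pi,
    Real.sin_add_int_mul_two_pi]

lemma casFun_eq_of_sub {x y : ℝ} (n : ℤ) (h : x - y = n) :
    casFun (2 * Real.pi * x) = casFun (2 * Real.pi * y) := by
  rw [← casFun_add_int y n, ← h]; ring_nf

lemma periodicZeta_toAddCircle {N : ℕ} [NeZero N] (y : ℤ) :
    HurwitzZeta.hurwitzZeta (ZMod.toAddCircle (y : ZMod N)) (1 / 2) = periodicZeta (y / N) := by
  rw [ZMod.toAddCircle_intCast, hurwitzZeta_half_eq_periodicZeta]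

lemma expZeta_half_toAddCircle {N : ℕ} [NeZero N] (y : ℤ) :
    HurwitzZeta.expZeta (ZMod.toAddCircle (y : ZMod N)) (1 / 2) =
      (√N : ℝ)⁻¹ * ∑ b ∈ Finset.range N, Complex.exp (2 * Real.pi * Complex.I * (b * y) / N) *
        periodicZeta (b / N) := by
  have hN : (N : ℂ) ^ (-(1 / 2) : ℂ) = ((√N : ℝ) : ℂ)⁻¹ := by
    have := ofReal_cpow_neg_half (Nat.cast_nonneg (α := ℝ) N)
    simpa using this
  rw [← ZMod.LFunction_stdAddChar_eq_expZeta _ _ (Or.inr (by norm_num)), ZMod.LFunction, hN, Complex.ofReal_inv]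
  congr 1
  rw [← sum_range_eq_sum_zmod]
  refine Finset.sum_congr rfl fun b _ => ?_
  have h1 := periodicZeta_toAddCircle (N := N) b
  have h2 := ZMod.stdAddChar_coe (N := N) (y * b)
  push_cast at h1 h2
  rw [h1, h2]
  ring_nf

/-- At `s = 1/2` the phases `e^{∓πis/2}` of Hurwitz's formula are eighth roots of unity, and they
combine the two exponentials into the single real kernel `cas`. -/
lemma casFun_eq_exp (t : ℝ) :
    ((√2 : ℝ) : ℂ) * casFun t =
      Complex.exp (-Real.pi * Complex.I * (1 / 2) / 2) * Complex.exp (t * Complex.I) +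
      Complex.exp (Real.pi * Complex.I * (1 / 2) / 2) * Complex.exp (-(t * Complex.I)) := by
  have e : ∀ u : ℝ, Complex.exp (u * Complex.I) = Real.cos u + Real.sin u * Complex.I := fun u => by
    rw [Complex.exp_mul_I]; push_cast; rfl
  have e1 : Complex.exp (-Real.pi * Complex.I * (1 / 2) / 2) = (√2 / 2 : ℝ) - (√2 / 2 : ℝ) * Complex.I := by
    have := e (-(Real.pi / 4))
    rw [Real.cos_neg, Real.sin_neg, Real.cos_pi_div_four, Real.sin_pi_div_four] at this
    rw [show (-Real.pi * Complex.I * (1 / 2) / 2 : ℂ) = ((-(Real.pi / 4) : ℝ) : ℂ) * Complex.I by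
      push_cast; ring, this]
    push_cast; ring
  have e2 : Complex.exp (Real.pi * Complex.I * (1 / 2) / 2) = (√2 / 2 : ℝ) + (√2 / 2 : ℝ) * Complex.I := by
    have := e (Real.pi / 4)
    rw [Real.cos_pi_div_four, Real.sin_pi_div_four] at this
    rw [show (Real.pi * Complex.I * (1 / 2) / 2 : ℂ) = ((Real.pi / 4 : ℝ) : ℂ) * Complex.I by
      push_cast; ring, this]
  have e3 : Complex.exp (-(t * Complex.I)) = Real.cos t - Real.sin t * Complex.I := by
    have := e (-t)
    rw [Real.cos_neg, Real.sin_neg] at this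
    rw [show (-(t * Complex.I) : ℂ) = ((-t : ℝ) : ℂ) * Complex.I by push_cast; ring, this]
    push_cast; ring
  rw [e1, e2, e3, e t, casFun]
  push_cast
  linear_combination ((√2 : ℝ) * Complex.sin t) * Complex.I_sq

/-- The functional equation at the central point: `ζ(1/2, ·)` is self-dual under the discrete
Hartley transform. -/
lemma sum_periodicZeta_mul_casFun {N : ℕ} (hN : 0 < N) (y : ℤ) :
    ∑ b ∈ Finset.range N, periodicZeta (b / N) * casFun (2 * Real.pi * (b * y / N)) =
      √N * periodicZeta (y / N) := by
  have : NeZero N := ⟨hN.ne'⟩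
  have hN0 : (0 : ℝ) < √N := Real.sqrt_pos.2 (by exact_mod_cast hN)
  have h := HurwitzZeta.hurwitzZeta_one_sub (ZMod.toAddCircle (y : ZMod N)) (s := 1 / 2)
    (fun n hn => by
      have := congrArg Complex.re hn
      simp at this
      have h2 : (0 : ℝ) ≤ n := Nat.cast_nonneg n
      norm_num at this
      linarith) (Or.inr (by norm_num))
  rw [show (1 - 1 / 2 : ℂ) = 1 / 2 by norm_num, periodicZeta_toAddCircle, expZeta_half_toAddCircle,
    ← map_neg, ← Int.cast_neg, expZeta_half_toAddCircle] at h
  -- The gamma factor at the central point cancels exactly the `√2` of `casFun_eq_exp`.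
  have hc : (2 * Real.pi : ℂ) ^ (-(1 / 2) : ℂ) * Complex.Gamma (1 / 2) = ((√2 : ℝ) : ℂ)⁻¹ := by
    have h1 := ofReal_cpow_neg_half (show (0 : ℝ) ≤ 2 * Real.pi by positivity)
    have h2 := Complex.Gamma_ofReal (1 / 2)
    rw [Real.Gamma_one_half_eq] at h2
    push_cast at h1 h2
    rw [h1, h2, Real.sqrt_mul (by norm_num)]
    have : ((√Real.pi : ℝ) : ℂ) ≠ 0 := Complex.ofReal_ne_zero.2 (by positivity)
    push_cast
    field_simp
  rw [hc] at h
  have hs2 : ((√2 : ℝ) : ℂ) ≠ 0 := Complex.ofReal_ne_zero.2 (by positivity)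
  have hsN : ((√N : ℝ) : ℂ) ≠ 0 := Complex.ofReal_ne_zero.2 hN0.ne'
  have hsum : ((∑ b ∈ Finset.range N, periodicZeta (b / N) *
      casFun (2 * Real.pi * (b * y / N)) : ℝ) : ℂ) * ((√2 : ℝ) : ℂ) =
      Complex.exp (-Real.pi * Complex.I * (1 / 2) / 2) * ∑ b ∈ Finset.range N,
        Complex.exp (2 * Real.pi * Complex.I * (b * y) / N) * periodicZeta (b / N) +
      Complex.exp (Real.pi * Complex.I * (1 / 2) / 2) * ∑ b ∈ Finset.range N,
        Complex.exp (2 * Real.pi * Complex.I * (b * (-y : ℤ)) / N) * periodicZeta (b / N) := by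
    rw [Complex.ofReal_sum, Finset.sum_mul, Finset.mul_sum, Finset.mul_sum, ← Finset.sum_add_distrib]
    refine Finset.sum_congr rfl fun b _ => ?_
    have := casFun_eq_exp (2 * Real.pi * (b * y / N))
    have e1 : (2 * Real.pi * Complex.I * (b * y) / N : ℂ) =
      ((2 * Real.pi * (b * y / N) : ℝ) : ℂ) * Complex.I := by push_cast; ring
    have e2 : (2 * Real.pi * Complex.I * (b * (-y : ℤ)) / N : ℂ) =
      -(((2 * Real.pi * (b * y / N) : ℝ) : ℂ) * Complex.I) := by push_cast; ring
    rw [e1, e2, Complex.ofReal_mul]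
    linear_combination (periodicZeta (b / N) : ℂ) * this
  have hfin : ((∑ b ∈ Finset.range N, periodicZeta (b / N) *
      casFun (2 * Real.pi * (b * y / N)) : ℝ) : ℂ) = ((√N * periodicZeta (y / N) : ℝ) : ℂ) := by
    refine mul_right_cancel₀ hs2 ?_
    rw [hsum, Complex.ofReal_mul, h, Complex.ofReal_inv]
    generalize ∑ b ∈ Finset.range N, Complex.exp (2 * Real.pi * Complex.I * (b * y) / N) *
      (periodicZeta (b / N) : ℂ) = A
    generalize ∑ b ∈ Finset.range N, Complex.exp (2 * Real.pi * Complex.I * (b * (-y : ℤ)) / N) *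
      (periodicZeta (b / N) : ℂ) = B
    generalize Complex.exp (-Real.pi * Complex.I * (1 / 2) / 2) = E₁
    generalize Complex.exp (Real.pi * Complex.I * (1 / 2) / 2) = E₂
    field_simp
  exact_mod_cast hfin

/-! ### Riemann sums of functions with controlled increments -/

/-- `B` controls the increments of `K` on `(0, 1]`. -/
structure IncrementBound (K B : ℝ → ℝ) : Prop where
  le_sub : ∀ {x y : ℝ}, 0 < x → x ≤ y → y ≤ 1 → |K x - K y| ≤ B y - B x
  zero_le : ∀ {x : ℝ}, 0 < x → x ≤ 1 → B 0 ≤ B x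

namespace IncrementBound
variable {K B : ℝ → ℝ}

lemma mono (h : IncrementBound K B) {x y : ℝ} (hx : 0 ≤ x) (hxy : x ≤ y) (hy : y ≤ 1) : B x ≤ B y := by
  rcases hx.eq_or_lt with rfl | hx
  · rcases hxy.eq_or_lt with rfl | h0
    · exact le_rfl
    · exact h.zero_le h0 hy
  · have := (abs_nonneg _).trans (h.le_sub hx hxy hy)
    linarith

lemma abs_sub_le_of_mem (h : IncrementBound K B) {a b x y : ℝ} (ha : 0 ≤ a) (hb : b ≤ 1)
    (hx : x ∈ Set.Ioc a b) (hy : y ∈ Set.Ioc a b) : |K x - K y| ≤ B b - B a := by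
  wlog hxy : x ≤ y generalizing x y
  · rw [abs_sub_comm]; exact this hy hx (le_of_not_ge hxy)
  have h1 := h.le_sub (ha.trans_lt hx.1) hxy (hy.2.trans hb)
  have h2 := h.mono ha hx.1.le (hx.2.trans hb)
  have h3 := h.mono (ha.trans hy.1.le) hy.2 hb
  linarith

/-- Each cell `(r/j, (r+1)/j]` holds one coarse sample and `card s` fine samples. Their differences
are bounded by the increment of `B` over that cell, and these increments telescope. -/
lemma sum_sub_le (h : IncrementBound K B) {j : ℕ} (hj : 0 < j) {ι : Type*} (s : Finset ι)
    {a : ℕ → ℝ} {b : ℕ → ι → ℝ} (ha : ∀ r < j, a r ∈ Set.Ioc ((r : ℝ) / j) ((r + 1 : ℝ) / j))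
    (hb : ∀ r < j, ∀ i ∈ s, b r i ∈ Set.Ioc ((r : ℝ) / j) ((r + 1 : ℝ) / j)) :
    |s.card * ∑ r ∈ Finset.range j, K (a r) - ∑ r ∈ Finset.range j, ∑ i ∈ s, K (b r i)|
      ≤ s.card * (B 1 - B 0) := by
  have hj' : (0 : ℝ) < j := by exact_mod_cast hj
  have e : s.card * ∑ r ∈ Finset.range j, K (a r) - ∑ r ∈ Finset.range j, ∑ i ∈ s, K (b r i)
      = ∑ r ∈ Finset.range j, ∑ i ∈ s, (K (a r) - K (b r i)) := by
    simp [Finset.sum_sub_distrib, Finset.mul_sum]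
  rw [e]
  calc _ ≤ ∑ r ∈ Finset.range j, ∑ i ∈ s, (B (((r + 1 : ℕ) : ℝ) / j) - B ((r : ℝ) / j)) := by
        refine (Finset.abs_sum_le_sum_abs _ _).trans (Finset.sum_le_sum fun r hr => ?_)
        refine (Finset.abs_sum_le_sum_abs _ _).trans (Finset.sum_le_sum fun i hi => ?_)
        have hr' := Finset.mem_range.1 hr
        have h1 : ((r : ℝ) + 1) / j ≤ 1 := by
          rw [div_le_one hj']; exact_mod_cast hr'
        push_cast
        exact h.abs_sub_le_of_mem (by positivity) h1 (ha r hr') (hb r hr' i hi)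
    _ = _ := by
        simp only [Finset.sum_const, nsmul_eq_mul, ← Finset.mul_sum]
        rw [Finset.sum_range_sub (fun r : ℕ => B ((r : ℝ) / j))]
        simp [hj'.ne']

/-- Equally spaced Riemann sums of a periodic function, over a grid and over a refinement of it. -/
lemma periodic_sum_sub_le (h : IncrementBound K B) (hK : ∀ (x : ℝ) (n : ℤ), K (x + n) = K x)
    {j M : ℕ} (hj : 0 < j) (hM : 0 < M) (s s' : ℝ) :
    |M * ∑ r ∈ Finset.range j, K ((r + s) / j) -
      ∑ r ∈ Finset.range (j * M), K ((r + s') / (j * M : ℕ))| ≤ M * (B 1 - B 0) := by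
  have hj' : (0 : ℝ) < j := by exact_mod_cast hj
  have hM' : (0 : ℝ) < M := by exact_mod_cast hM
  have shift : ∀ (N : ℕ) (_ : 0 < N) (u v : ℝ) (n : ℤ), u - v = n →
      ∑ r ∈ Finset.range N, K ((r + u) / N) = ∑ r ∈ Finset.range N, K ((r + v) / N) := by
    intro N hN u v n huv
    have hN' : (N : ℝ) ≠ 0 := by exact_mod_cast hN.ne'
    have := sum_range_add_of_periodic (N := N) (G := fun m : ℤ => K (((m : ℝ) + v) / N))
      (fun m => by
        have := hK (((m : ℝ) + v) / N) 1
        rw [← this]; congr 1; push_cast; field_simp; ring) n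
    push_cast at this
    rw [← this]
    refine Finset.sum_congr rfl fun r _ => ?_
    rw [show u = v + n by linarith]; ring_nf
  -- By periodicity the offsets may be moved into `(0, 1]`, which places the fine points `i + Mr`,
  -- `i < M`, in the same half-open cell as the coarse point `r`.
  obtain ⟨n, h0, h1⟩ := exists_int_sub_mem_Ioc s
  obtain ⟨n', h0', h1'⟩ := exists_int_sub_mem_Ioc s'
  rw [shift j hj s (s - n) n (by ring), shift (j * M) (by positivity) s' (s' - n') n' (by ring),
    mul_comm j M, sum_range_mul_eq, Finset.sum_comm]
  have := h.sum_sub_le hj (Finset.range M) (a := fun r => (r + (s - n)) / j)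
    (b := fun r i => ((i + M * r : ℕ) + (s' - n')) / ((M * j : ℕ) : ℝ)) (fun r _ => ?_)
    (fun r _ i hi => ?_)
  · simpa using this
  · constructor
    · gcongr; linarith
    · gcongr
  · have hi' : (i : ℝ) + 1 ≤ M := by exact_mod_cast Finset.mem_range.1 hi
    push_cast
    constructor
    · rw [div_lt_div_iff₀ hj' (by positivity)]
      nlinarith [mul_pos hj' (show (0 : ℝ) < i + (s' - n') by positivity)]
    · rw [div_le_div_iff₀ (by positivity) hj']
      nlinarith [mul_nonneg hj'.le (show (0 : ℝ) ≤ M - (i + (s' - n')) by linarith)]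

end IncrementBound

/-! ### Square root inequalities -/

lemma sub_le_two_mul_sqrt_sub {x y : ℝ} (hx : 0 ≤ x) (hxy : x ≤ y) (hy : y ≤ 1) :
    y - x ≤ 2 * (√y - √x) := by
  have h1 := Real.sq_sqrt hx
  have h2 := Real.sq_sqrt (hx.trans hxy)
  have h3 := Real.sqrt_le_sqrt hxy
  have h4 : √y ≤ 1 := Real.sqrt_le_one.2 hy
  nlinarith

lemma sub_mul_inv_sqrt_le {x y : ℝ} (hx : 0 ≤ x) (hxy : x ≤ y) (hy : 0 < y) :
    (y - x) * (√y)⁻¹ ≤ 2 * (√y - √x) := by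
  have h1 := Real.sq_sqrt hx
  have h2 := Real.sq_sqrt (hx.trans hxy)
  have h3 := Real.sqrt_le_sqrt hxy
  have h4 := Real.sqrt_pos.2 hy
  rw [← div_eq_mul_inv, div_le_iff₀ h4]
  nlinarith

lemma mul_inv_sqrt_sub_le {x y : ℝ} (hx : 0 < x) (hxy : x ≤ y) :
    x * ((√x)⁻¹ - (√y)⁻¹) ≤ √y - √x := by
  have h1 := Real.sq_sqrt hx.le
  have h3 := Real.sqrt_le_sqrt hxy
  have hx0 := Real.sqrt_pos.2 hx
  have hy0 := Real.sqrt_pos.2 (hx.trans_le hxy)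
  have e : x * ((√x)⁻¹ - (√y)⁻¹) = √x * (√y - √x) / √y := by
    nth_rewrite 1 [← h1]; field_simp
  rw [e, div_le_iff₀ hy0]
  nlinarith

lemma sub_le_two_mul_inv_sqrt_sub {x y : ℝ} (hx : 0 < x) (hxy : x ≤ y) (hy : y ≤ 1) :
    y - x ≤ 2 * ((√x)⁻¹ - (√y)⁻¹) := by
  have h1 := Real.sq_sqrt hx.le
  have h2 := Real.sq_sqrt (hx.le.trans hxy)
  have h3 := Real.sqrt_le_sqrt hxy
  have hx0 := Real.sqrt_pos.2 hx
  have hy0 := Real.sqrt_pos.2 (hx.trans_le hxy)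
  have hy1 : √y ≤ 1 := Real.sqrt_le_one.2 hy
  have e : 2 * ((√x)⁻¹ - (√y)⁻¹) = 2 * (√y - √x) / (√x * √y) := by field_simp
  rw [e, le_div_iff₀ (by positivity)]
  have : (√y + √x) * (√x * √y) ≤ 2 * 1 :=
    mul_le_mul (by linarith) (by nlinarith) (by positivity) (by norm_num)
  nlinarith [mul_le_mul_of_nonneg_left this (sub_nonneg.2 h3)]

lemma inv_sqrt_sub_le_of_half_le {x y : ℝ} (hx : 1 / 2 ≤ x) (hxy : x ≤ y) :
    (√x)⁻¹ - (√y)⁻¹ ≤ 2 * (y - x) := by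
  have hx0 : 0 < x := by linarith
  have h1 := Real.sq_sqrt hx0.le
  have h2 := Real.sq_sqrt (hx0.le.trans hxy)
  have h3 := Real.sqrt_le_sqrt hxy
  have hxp := Real.sqrt_pos.2 hx0
  have hyp := Real.sqrt_pos.2 (hx0.trans_le hxy)
  have e : (√x)⁻¹ - (√y)⁻¹ = (√y - √x) / (√x * √y) := by field_simp
  rw [e, div_le_iff₀ (by positivity), show y - x = (√y - √x) * (√y + √x) by linear_combination h1 - h2]
  have hxx : 1 / 2 ≤ √x := by
    rw [show (1 / 2 : ℝ) = √(1 / 4) by rw [show (1 / 4 : ℝ) = (1 / 2) ^ 2 by norm_num]; simp]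
    exact Real.sqrt_le_sqrt (by linarith)
  have h5 : 1 / 2 ≤ √x * √y := by nlinarith
  have h6 : 1 ≤ 2 * (√y + √x) * (√x * √y) := by nlinarith
  nlinarith [mul_le_mul_of_nonneg_left h6 (sub_nonneg.2 h3)]

/-- The profile of the increments of `ζ(1/2, δ + s) ζ(1/2, s)` as a function of `s`. -/
noncomputable def sqrtRatio (δ s : ℝ) : ℝ := √s / (√s + √δ)

section Ratio
variable {δ s t : ℝ}

lemma sqrtRatio_nonneg : 0 ≤ sqrtRatio δ s := by unfold sqrtRatio; positivity

lemma sqrtRatio_le_one : sqrtRatio δ s ≤ 1 := by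
  unfold sqrtRatio
  exact div_le_one_of_le₀ (by linarith [Real.sqrt_nonneg δ]) (by positivity)

lemma sqrt_add_sqrt_le (hδ : 0 < δ) (hs : 0 ≤ s) : √s + √δ ≤ 2 * √(δ + s) := by
  linarith [Real.sqrt_le_sqrt (show s ≤ δ + s by linarith),
    Real.sqrt_le_sqrt (show δ ≤ δ + s by linarith)]

/-- This is the common shape, `√t - √s` times an explicit factor, against which the products below
are compared. -/
lemma sqrtRatio_sub (hδ : 0 < δ) : (sqrtRatio δ t - sqrtRatio δ s) / δ =
    (√t - √s) / (√δ * (√t + √δ) * (√s + √δ)) := by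
  have hd := Real.sqrt_pos.2 hδ
  have hd2 := Real.sq_sqrt hδ.le
  have h1 : 0 < √t + √δ := by positivity
  have h2 : 0 < √s + √δ := by positivity
  unfold sqrtRatio
  nth_rewrite 3 [← hd2]
  field_simp
  ring

/-- Both sides carry the factor `√t - √s`; what remains is a comparison of denominators, for which
`√(δ + s)` and `√(δ + t)` may be replaced by `√s + √δ` and `√t + √δ` at the cost of factors 2. -/
lemma inv_sqrt_add_sub_mul_le (hδ : 0 < δ) (hs : 0 < s) (hst : s ≤ t) :
    ((√(δ + s))⁻¹ - (√(δ + t))⁻¹) * (√t)⁻¹ ≤ 8 * ((sqrtRatio δ t - sqrtRatio δ s) / δ) := by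
  have ht : 0 < t := hs.trans_le hst
  have h1 := sqrt_add_sqrt_le hδ hs.le
  have h2 := sqrt_add_sqrt_le hδ ht.le
  have h3 := Real.sqrt_le_sqrt (show δ ≤ δ + s by linarith)
  have h4 := Real.sqrt_le_sqrt hst
  have hd := Real.sqrt_pos.2 hδ
  have hσ := Real.sqrt_pos.2 hs
  have hτ := Real.sqrt_pos.2 ht
  have ha := Real.sqrt_pos.2 (show 0 < δ + s by linarith)
  have hb := Real.sqrt_pos.2 (show 0 < δ + t by linarith)
  have ea := Real.sq_sqrt (show 0 ≤ δ + s by linarith)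
  have eb := Real.sq_sqrt (show 0 ≤ δ + t by linarith)
  have es := Real.sq_sqrt hs.le
  have et := Real.sq_sqrt ht.le
  rw [sqrtRatio_sub hδ]
  set a := √(δ + s)
  set b := √(δ + t)
  set d := √δ
  set σ := √s
  set τ := √t
  have e : (a⁻¹ - b⁻¹) * τ⁻¹ = (τ - σ) * ((τ + σ) / (τ * (a * b * (b + a)))) := by
    have : (b - a) * (b + a) = (τ - σ) * (τ + σ) := by linear_combination eb - ea - et + es
    have e1 : a⁻¹ - b⁻¹ = ((b - a) * (b + a)) / (a * b * (b + a)) := by field_simp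
    rw [e1, this]; field_simp
  rw [e, show 8 * ((τ - σ) / (d * (τ + d) * (σ + d))) = (τ - σ) * (8 / (d * (τ + d) * (σ + d))) by ring]
  refine mul_le_mul_of_nonneg_left ?_ (by linarith)
  rw [div_le_div_iff₀ (by positivity) (by positivity)]
  have h5 : (τ + d) * (σ + d) ≤ (2 * b) * (2 * a) := mul_le_mul h2 h1 (by positivity) (by positivity)
  have h6 : d * ((τ + d) * (σ + d)) ≤ (b + a) * ((2 * b) * (2 * a)) :=
    mul_le_mul (by linarith) h5 (by positivity) (by positivity)
  have h7 : (τ + σ) * (d * ((τ + d) * (σ + d))) ≤ (2 * τ) * ((b + a) * ((2 * b) * (2 * a))) :=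
    mul_le_mul (by linarith) h6 (by positivity) (by positivity)
  linarith

lemma inv_sqrt_sub_inv_sqrt_add (hδ : 0 < δ) (hs : 0 < s) :
    (√δ)⁻¹ - (√(δ + s))⁻¹ = √s ^ 2 / (√δ * √(δ + s) * (√(δ + s) + √δ)) := by
  have hd := Real.sqrt_pos.2 hδ
  have ha := Real.sqrt_pos.2 (show 0 < δ + s by linarith)
  have ea := Real.sq_sqrt (show 0 ≤ δ + s by linarith)
  have ed := Real.sq_sqrt hδ.le
  rw [show √s ^ 2 = (√(δ + s) - √δ) * (√(δ + s) + √δ) by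
    rw [Real.sq_sqrt hs.le]; linear_combination ed - ea]
  field_simp

lemma inv_sqrt_sub_mul_inv_sqrt_sub_le (hδ : 0 < δ) (hs : 0 < s) (hst : s ≤ t) :
    ((√δ)⁻¹ - (√(δ + s))⁻¹) * ((√s)⁻¹ - (√t)⁻¹) ≤
      4 * ((sqrtRatio δ t - sqrtRatio δ s) / δ) := by
  have ht : 0 < t := hs.trans_le hst
  have h1 := sqrt_add_sqrt_le hδ hs.le
  have h4 := Real.sqrt_le_sqrt hst
  have hd := Real.sqrt_pos.2 hδ
  have hσ := Real.sqrt_pos.2 hs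
  have hτ := Real.sqrt_pos.2 ht
  have ha := Real.sqrt_pos.2 (show 0 < δ + s by linarith)
  rw [sqrtRatio_sub hδ, inv_sqrt_sub_inv_sqrt_add hδ hs]
  set a := √(δ + s)
  set d := √δ
  set σ := √s
  set τ := √t
  have e : σ ^ 2 / (d * a * (a + d)) * (σ⁻¹ - τ⁻¹) = (τ - σ) * (σ / (τ * (d * a * (a + d)))) := by
    field_simp
  rw [e, show 4 * ((τ - σ) / (d * (τ + d) * (σ + d))) = (τ - σ) * (4 / (d * (τ + d) * (σ + d))) by ring]
  refine mul_le_mul_of_nonneg_left ?_ (by linarith)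
  rw [div_le_div_iff₀ (by positivity) (by positivity)]
  have h5 : σ * (τ + d) ≤ τ * (σ + d) := by nlinarith
  have h6 : (σ * (τ + d)) * (σ + d) ≤ (τ * (σ + d)) * (σ + d) :=
    mul_le_mul_of_nonneg_right h5 (by positivity)
  have h7 : (σ + d) * (σ + d) ≤ (2 * a) * (2 * a) := mul_le_mul h1 h1 (by positivity) (by positivity)
  have h8 : d * ((σ * (τ + d)) * (σ + d)) ≤ d * (τ * ((2 * a) * (2 * a))) := by
    refine mul_le_mul_of_nonneg_left (h6.trans ?_) hd.le
    rw [mul_assoc]; exact mul_le_mul_of_nonneg_left h7 hτ.le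
  have h9 : 0 ≤ 4 * (τ * (d * a * d)) := by positivity
  nlinarith

lemma inv_sqrt_sub_mul_inv_sqrt_le (hδ : 0 < δ) (ht : 0 < t) :
    ((√δ)⁻¹ - (√(δ + t))⁻¹) * (√t)⁻¹ ≤ 2 * (sqrtRatio δ t / δ) := by
  have h1 := sqrt_add_sqrt_le hδ ht.le
  have hd := Real.sqrt_pos.2 hδ
  have hτ := Real.sqrt_pos.2 ht
  have ha := Real.sqrt_pos.2 (show 0 < δ + t by linarith)
  have h0 := sqrtRatio_sub (δ := δ) (t := t) (s := 0) hδ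
  rw [show sqrtRatio δ 0 = 0 by simp [sqrtRatio], sub_zero, Real.sqrt_zero, sub_zero, zero_add] at h0
  rw [h0, inv_sqrt_sub_inv_sqrt_add hδ ht]
  set a := √(δ + t)
  set d := √δ
  set τ := √t
  have e : τ ^ 2 / (d * a * (a + d)) * τ⁻¹ = τ * (1 / (d * a * (a + d))) := by field_simp
  rw [e, show 2 * (τ / (d * (τ + d) * d)) = τ * (2 / (d * (τ + d) * d)) by ring]
  refine mul_le_mul_of_nonneg_left ?_ hτ.le
  rw [div_le_div_iff₀ (by positivity) (by positivity)]
  have h5 : (τ + d) * d ≤ (2 * a) * (a + d) := mul_le_mul h1 (by linarith) hd.le (by positivity)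
  nlinarith [mul_le_mul_of_nonneg_left h5 hd.le]

end Ratio

lemma sqrt_sub_le_sqrtRatio {δ s t : ℝ} (hδ : 0 < δ) (hδ1 : δ ≤ 1) (hst : s ≤ t)
    (ht : t ≤ 1) : √t - √s ≤ 4 * ((sqrtRatio δ t - sqrtRatio δ s) / δ) := by
  rw [sqrtRatio_sub hδ]
  have hd := Real.sqrt_pos.2 hδ
  have hd1 : √δ ≤ 1 := Real.sqrt_le_one.2 hδ1
  have h4 := Real.sqrt_le_sqrt hst
  have ht1 : √t ≤ 1 := Real.sqrt_le_one.2 ht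
  have hs0 := Real.sqrt_nonneg s
  have h5 : √δ * (√t + √δ) * (√s + √δ) ≤ (1 * 2) * 2 :=
    mul_le_mul (mul_le_mul hd1 (by linarith) (by positivity) (by norm_num)) (by linarith)
      (by positivity) (by norm_num)
  have h6 : 0 < √δ * (√t + √δ) * (√s + √δ) := by positivity
  rw [← mul_div_assoc, le_div_iff₀ h6]
  nlinarith [mul_le_mul_of_nonneg_left h5 (sub_nonneg.2 h4)]

/-! ### The two-point kernel -/

/-- The product `ζ(1/2, x) ζ(1/2, x - δ)` with its two singularities removed. -/
noncomputable def twoPoint (δ x : ℝ) : ℝ :=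
  (periodicZeta x - periodicZeta δ) * (periodicZeta (x - δ) - periodicZeta (-δ))

/-- The function controlling the increments of `twoPoint δ`. -/
noncomputable def twoPointBound (δ x : ℝ) : ℝ :=
  if x ≤ δ then 8 * hurwitzBd ^ 2 * √x
  else 8 * hurwitzBd ^ 2 * √δ + 32 * hurwitzBd ^ 2 * (sqrtRatio δ (x - δ) / δ)

section TwoPoint
variable {δ : ℝ}

lemma twoPoint_of_le (hδ : 0 < δ) (hδ2 : δ ≤ 1 / 2) {x : ℝ} (hx : 0 < x) (hxδ : x ≤ δ) :
    twoPoint δ x = (hurwitzHalf x - hurwitzHalf δ) *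
      (hurwitzHalf (1 - δ + x) - hurwitzHalf (1 - δ)) := by
  rw [twoPoint, periodicZeta_of_mem hx (by linarith), periodicZeta_of_mem hδ (by linarith),
    periodicZeta_eq_of_sub (x := x - δ) (y := 1 - δ + x) (-1) (by push_cast; ring),
    periodicZeta_eq_of_sub (x := -δ) (y := 1 - δ) (-1) (by push_cast; ring),
    periodicZeta_of_mem (x := 1 - δ + x) (by linarith) (by linarith),
    periodicZeta_of_mem (x := 1 - δ) (by linarith) (by linarith)]

lemma twoPoint_add (hδ : 0 < δ) (hδ2 : δ ≤ 1 / 2) {s : ℝ} (hs : 0 < s) (hs1 : δ + s ≤ 1) :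
    twoPoint δ (δ + s) = (hurwitzHalf (δ + s) - hurwitzHalf δ) *
      (hurwitzHalf s - hurwitzHalf (1 - δ)) := by
  rw [twoPoint, periodicZeta_of_mem (by linarith) (by linarith),
    periodicZeta_of_mem hδ (by linarith), add_sub_cancel_left,
    periodicZeta_eq_of_sub (x := -δ) (y := 1 - δ) (-1) (by push_cast; ring),
    periodicZeta_of_mem (x := s) (by linarith) (by linarith),
    periodicZeta_of_mem (x := 1 - δ) (by linarith) (by linarith)]

/-- By the product rule: the increments of the first factor blow up at 0, but they are multiplied by
the second factor, which is `O(x)` there. The increments of the second factor are `O(y - x)` and are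
multiplied by `O(1/√y)`. Both products are controlled by the increment of the square root. -/
lemma twoPoint_sub_le_of_le (hδ : 0 < δ) (hδ2 : δ ≤ 1 / 2) {x y : ℝ} (hx : 0 < x) (hxy : x ≤ y)
    (hy : y ≤ δ) : |twoPoint δ x - twoPoint δ y| ≤ 8 * hurwitzBd ^ 2 * (√y - √x) := by
  have hy0 := hx.trans_le hxy
  rw [twoPoint_of_le hδ hδ2 hx (hxy.trans hy), twoPoint_of_le hδ hδ2 hy0 hy]
  have L0 := hurwitzLip_nonneg
  have c0 : hurwitzLip + 1 ≤ hurwitzBd := by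
    unfold hurwitzBd; linarith [abs_nonneg (hurwitzHalf 1)]
  have a1 := hurwitzHalf_sub_le hx hxy
  have a2 := hurwitzHalf_anti hx hxy
  have b1 := hurwitzHalf_sub_le hy0 hy
  have b2 := hurwitzHalf_anti hy0 hy
  have d1 := hurwitzHalf_sub_le (x := 1 - δ) (y := 1 - δ + x) (by linarith) (by linarith)
  have d2 := hurwitzHalf_anti (x := 1 - δ) (y := 1 - δ + x) (by linarith) (by linarith)
  have d3 := inv_sqrt_sub_le_of_half_le (x := 1 - δ) (y := 1 - δ + x) (by linarith) (by linarith)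
  have e1 := hurwitzHalf_sub_le (x := 1 - δ + x) (y := 1 - δ + y) (by linarith) (by linarith)
  have e2 := hurwitzHalf_anti (x := 1 - δ + x) (y := 1 - δ + y) (by linarith) (by linarith)
  have e3 := inv_sqrt_sub_le_of_half_le (x := 1 - δ + x) (y := 1 - δ + y) (by linarith) (by linarith)
  have m1 := mul_inv_sqrt_sub_le hx hxy
  have m2 := sub_mul_inv_sqrt_le hx.le hxy hy0
  have m3 := sub_le_two_mul_sqrt_sub hx.le hxy (by linarith)
  have n1 := one_le_inv_sqrt hy0 (by linarith)
  have n2 : 0 < (√δ)⁻¹ := inv_pos.2 (Real.sqrt_pos.2 hδ)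
  have n3 := inv_sqrt_anti hx hxy
  have sq := Real.sqrt_le_sqrt hxy
  set c := hurwitzBd
  set L := hurwitzLip
  set p := hurwitzHalf x
  set p' := hurwitzHalf y
  set z := hurwitzHalf δ
  set r := hurwitzHalf (1 - δ + x)
  set r' := hurwitzHalf (1 - δ + y)
  set w := hurwitzHalf (1 - δ)
  have g1 : w - r ≤ 2 * c * x := by nlinarith
  have g2 : r - r' ≤ 2 * c * (y - x) := by nlinarith
  have g3 : p' - z ≤ c * (√y)⁻¹ := by nlinarith
  have h1 : (p - p') * (w - r) ≤ 4 * c ^ 2 * (√y - √x) := by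
    calc (p - p') * (w - r) ≤ ((√x)⁻¹ - (√y)⁻¹ + L * (y - x)) * (2 * c * x) :=
          mul_le_mul a1 g1 (by linarith) (by linarith)
      _ = 2 * c * (x * ((√x)⁻¹ - (√y)⁻¹)) + 2 * c * L * (x * (y - x)) := by ring
      _ ≤ 2 * c * (√y - √x) + 2 * c * L * (2 * (√y - √x)) := by
          have : x * (y - x) ≤ 1 * (2 * (√y - √x)) :=
            mul_le_mul (by linarith) m3 (by linarith) (by norm_num)
          have hc : 0 ≤ 2 * c := by linarith
          have hcl : 0 ≤ 2 * c * L := by positivity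
          nlinarith [mul_le_mul_of_nonneg_left m1 hc, mul_le_mul_of_nonneg_left this hcl]
      _ = (2 * c * (1 + 2 * L)) * (√y - √x) := by ring
      _ ≤ _ := by
          refine mul_le_mul_of_nonneg_right ?_ (by linarith)
          nlinarith
  have h2 : (p' - z) * (r - r') ≤ 4 * c ^ 2 * (√y - √x) := by
    calc (p' - z) * (r - r') ≤ (c * (√y)⁻¹) * (2 * c * (y - x)) :=
          mul_le_mul g3 g2 (by linarith) (mul_nonneg (by linarith) (by linarith))
      _ = 2 * c ^ 2 * ((y - x) * (√y)⁻¹) := by ring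
      _ ≤ 2 * c ^ 2 * (2 * (√y - √x)) := by gcongr
      _ = _ := by ring
  have h3 : 0 ≤ (p - p') * (w - r) := mul_nonneg (by linarith) (by linarith)
  have h4 : 0 ≤ (p' - z) * (r - r') := mul_nonneg (by linarith) (by linarith)
  rw [show (p - z) * (r - w) - (p' - z) * (r' - w) = -((p - p') * (w - r)) + (p' - z) * (r - r') by ring,
    abs_le]
  have h5 : 0 ≤ 4 * c ^ 2 * (√y - √x) := h3.trans h1
  constructor <;> linarith

set_option maxHeartbeats 400000 in
-- To the right of `δ` the roles are exchanged: the second factor is singular at `s = 0` and the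
-- first one vanishes there. The first factor still varies on the scale `δ`, so the increments
-- follow the profile `sqrtRatio δ` divided by `δ`.
lemma twoPoint_add_sub_le (hδ : 0 < δ) (hδ2 : δ ≤ 1 / 2) {s t : ℝ} (hs : 0 < s) (hst : s ≤ t)
    (ht1 : δ + t ≤ 1) : |twoPoint δ (δ + s) - twoPoint δ (δ + t)| ≤
      32 * hurwitzBd ^ 2 * ((sqrtRatio δ t - sqrtRatio δ s) / δ) := by
  have ht := hs.trans_le hst
  rw [twoPoint_add hδ hδ2 hs (by linarith), twoPoint_add hδ hδ2 ht ht1]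
  have L0 := hurwitzLip_nonneg
  have c0 : hurwitzLip + 1 ≤ hurwitzBd := by
    unfold hurwitzBd; linarith [abs_nonneg (hurwitzHalf 1)]
  have a1 := hurwitzHalf_sub_le (x := δ + s) (y := δ + t) (by linarith) (by linarith)
  have a2 := hurwitzHalf_anti (x := δ + s) (y := δ + t) (by linarith) (by linarith)
  have b1 := hurwitzHalf_sub_le (x := δ) (y := δ + s) hδ (by linarith)
  have b2 := hurwitzHalf_anti (x := δ) (y := δ + s) hδ (by linarith)
  have d1 := hurwitzHalf_sub_le (x := t) (y := 1 - δ) ht (by linarith)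
  have d2 := hurwitzHalf_anti (x := t) (y := 1 - δ) ht (by linarith)
  have e1 := hurwitzHalf_sub_le hs hst
  have e2 := hurwitzHalf_anti hs hst
  have k1 := inv_sqrt_add_sub_mul_le hδ hs hst
  have k2 := inv_sqrt_sub_mul_inv_sqrt_sub_le hδ hs hst
  have k3 := sqrt_sub_le_sqrtRatio hδ (by linarith) hst (by linarith)
  have m1 := mul_inv_sqrt_sub_le hs hst
  have m2 := sub_mul_inv_sqrt_le hs.le hst ht
  have m3 := sub_le_two_mul_inv_sqrt_sub hs hst (by linarith)
  have n1 := one_le_inv_sqrt ht (by linarith)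
  have n2 := one_le_inv_sqrt (x := 1 - δ) (by linarith) (by linarith)
  have n3 := inv_sqrt_anti hs hst
  have n4 := inv_sqrt_anti hδ (show δ ≤ δ + s by linarith)
  have n5 := inv_sqrt_anti (show 0 < δ + s by linarith) (show δ + s ≤ δ + t by linarith)
  have sq := Real.sqrt_le_sqrt hst
  set R := (sqrtRatio δ t - sqrtRatio δ s) / δ
  set c := hurwitzBd
  set L := hurwitzLip
  set p := hurwitzHalf (δ + s)
  set p' := hurwitzHalf (δ + t)
  set z := hurwitzHalf δ
  set r := hurwitzHalf s
  set r' := hurwitzHalf t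
  set w := hurwitzHalf (1 - δ)
  have R0 : 0 ≤ R := by linarith
  have hc : 0 ≤ c := by linarith
  have g1 : r' - w ≤ c * (√t)⁻¹ := by
    have := mul_le_mul_of_nonneg_left (show 1 - δ - t ≤ 1 by linarith) L0
    have := mul_le_mul_of_nonneg_right c0 (show 0 ≤ (√t)⁻¹ by positivity)
    have := mul_le_mul_of_nonneg_left n1 L0
    linarith
  have g2 : r - r' ≤ 2 * c * ((√s)⁻¹ - (√t)⁻¹) := by
    have := mul_le_mul_of_nonneg_left m3 L0
    have := mul_le_mul_of_nonneg_right c0 (show 0 ≤ (√s)⁻¹ - (√t)⁻¹ by linarith)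
    linarith
  have h1 : (p - p') * (r' - w) ≤ 16 * c ^ 2 * R := by
    calc (p - p') * (r' - w) ≤ ((√(δ + s))⁻¹ - (√(δ + t))⁻¹ + L * (δ + t - (δ + s))) * (c * (√t)⁻¹) :=
          mul_le_mul a1 g1 (by linarith) (by linarith)
      _ = c * (((√(δ + s))⁻¹ - (√(δ + t))⁻¹) * (√t)⁻¹) + c * L * ((t - s) * (√t)⁻¹) := by ring
      _ ≤ c * (8 * R) + c * L * (2 * (4 * R)) := by
          have hcl : 0 ≤ c * L := mul_nonneg hc L0
          exact add_le_add (mul_le_mul_of_nonneg_left k1 hc)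
            (mul_le_mul_of_nonneg_left (by linarith) hcl)
      _ = 8 * (c * (1 + L)) * R := by ring
      _ ≤ _ := by
          refine mul_le_mul_of_nonneg_right ?_ R0
          nlinarith
  have h2 : (z - p) * (r - r') ≤ 16 * c ^ 2 * R := by
    calc (z - p) * (r - r') ≤ ((√δ)⁻¹ - (√(δ + s))⁻¹ + L * (δ + s - δ)) *
            (2 * c * ((√s)⁻¹ - (√t)⁻¹)) :=
          mul_le_mul b1 g2 (by linarith) (by linarith)
      _ = 2 * c * (((√δ)⁻¹ - (√(δ + s))⁻¹) * ((√s)⁻¹ - (√t)⁻¹)) +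
            2 * c * L * (s * ((√s)⁻¹ - (√t)⁻¹)) := by ring
      _ ≤ 2 * c * (4 * R) + 2 * c * L * (4 * R) := by
          have hc2 : 0 ≤ 2 * c := by linarith
          exact add_le_add (mul_le_mul_of_nonneg_left k2 hc2)
            (mul_le_mul_of_nonneg_left (by linarith) (mul_nonneg hc2 L0))
      _ = 8 * (c * (1 + L)) * R := by ring
      _ ≤ _ := by
          refine mul_le_mul_of_nonneg_right ?_ R0
          nlinarith
  have h3 : 0 ≤ (p - p') * (r' - w) := mul_nonneg (by linarith) (by linarith)
  have h4 : 0 ≤ (z - p) * (r - r') := mul_nonneg (by linarith) (by linarith)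
  rw [show (p - z) * (r - w) - (p' - z) * (r' - w) = (p - p') * (r' - w) - (z - p) * (r - r') by ring,
    abs_le]
  have h5 : 0 ≤ 16 * c ^ 2 * R := h3.trans h1
  constructor <;> linarith

lemma abs_twoPoint_add_le (hδ : 0 < δ) (hδ2 : δ ≤ 1 / 2) {t : ℝ} (ht : 0 < t)
    (ht1 : δ + t ≤ 1) : |twoPoint δ (δ + t)| ≤ 32 * hurwitzBd ^ 2 * (sqrtRatio δ t / δ) := by
  rw [twoPoint_add hδ hδ2 ht ht1]
  have L0 := hurwitzLip_nonneg
  have c0 : hurwitzLip + 1 ≤ hurwitzBd := by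
    unfold hurwitzBd; linarith [abs_nonneg (hurwitzHalf 1)]
  have b1 := hurwitzHalf_sub_le (x := δ) (y := δ + t) hδ (by linarith)
  have b2 := hurwitzHalf_anti (x := δ) (y := δ + t) hδ (by linarith)
  have d1 := hurwitzHalf_sub_le (x := t) (y := 1 - δ) ht (by linarith)
  have d2 := hurwitzHalf_anti (x := t) (y := 1 - δ) ht (by linarith)
  have k1 := inv_sqrt_sub_mul_inv_sqrt_le hδ ht
  have k3 := sqrt_sub_le_sqrtRatio hδ (by linarith) ht.le (by linarith)
  rw [show sqrtRatio δ 0 = 0 by simp [sqrtRatio], sub_zero, Real.sqrt_zero, sub_zero] at k3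
  have n1 := one_le_inv_sqrt ht (by linarith)
  have n2 := one_le_inv_sqrt (x := 1 - δ) (by linarith) (by linarith)
  have n4 := inv_sqrt_anti hδ (show δ ≤ δ + t by linarith)
  have ht2 : t * (√t)⁻¹ = √t := by rw [← div_eq_mul_inv, Real.div_sqrt]
  set R := sqrtRatio δ t / δ
  set c := hurwitzBd
  set L := hurwitzLip
  set p := hurwitzHalf (δ + t)
  set z := hurwitzHalf δ
  set r := hurwitzHalf t
  set w := hurwitzHalf (1 - δ)
  have R0 : 0 ≤ R := by linarith [Real.sqrt_nonneg t]
  have hc : 0 ≤ c := by linarith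
  have g1 : r - w ≤ c * (√t)⁻¹ := by nlinarith
  rw [abs_mul, abs_of_nonpos (by linarith : p - z ≤ 0), abs_of_nonneg (by linarith : 0 ≤ r - w)]
  calc -(p - z) * (r - w) ≤ ((√δ)⁻¹ - (√(δ + t))⁻¹ + L * (δ + t - δ)) * (c * (√t)⁻¹) :=
        mul_le_mul (by linarith) g1 (by linarith) (by linarith)
    _ = c * (((√δ)⁻¹ - (√(δ + t))⁻¹) * (√t)⁻¹) + c * L * (t * (√t)⁻¹) := by ring
    _ ≤ c * (2 * R) + c * L * (4 * R) := by rw [ht2]; gcongr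
    _ = c * (2 + 4 * L) * R := by ring
    _ ≤ _ := by
        refine mul_le_mul_of_nonneg_right ?_ R0
        nlinarith

lemma incrementBound_twoPoint (hδ : 0 < δ) (hδ2 : δ ≤ 1 / 2) :
    IncrementBound (twoPoint δ) (twoPointBound δ) where
  le_sub {x y} hx hxy hy := by
    unfold twoPointBound
    by_cases hyδ : y ≤ δ
    · rw [if_pos hyδ, if_pos (hxy.trans hyδ)]
      linarith [twoPoint_sub_le_of_le hδ hδ2 hx hxy hyδ]
    · push Not at hyδ
      rw [if_neg hyδ.not_ge]
      by_cases hxδ : x ≤ δ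
      · rw [if_pos hxδ]
        have h1 := twoPoint_sub_le_of_le hδ hδ2 hx hxδ le_rfl
        have h2 := abs_twoPoint_add_le hδ hδ2 (t := y - δ) (by linarith) (by linarith)
        -- When `x ≤ δ < y` the two regimes are joined at `δ`, where the kernel vanishes.
        have h0 : twoPoint δ δ = 0 := by simp [twoPoint]
        rw [h0, sub_zero] at h1
        rw [add_sub_cancel] at h2
        have := abs_sub (twoPoint δ x) (twoPoint δ y)
        linarith
      · push Not at hxδ
        rw [if_neg hxδ.not_ge]
        have h2 := twoPoint_add_sub_le hδ hδ2 (s := x - δ) (t := y - δ) (by linarith) (by linarith)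
          (by linarith)
        rw [add_sub_cancel, add_sub_cancel, sub_div] at h2
        linarith
  zero_le {x} hx hx1 := by
    unfold twoPointBound
    rw [if_pos hδ.le, Real.sqrt_zero, mul_zero]
    split_ifs
    · positivity
    · have := sqrtRatio_nonneg (δ := δ) (s := x - δ)
      positivity

lemma twoPointBound_sub_le (hδ : 0 < δ) (hδ2 : δ ≤ 1 / 2) :
    twoPointBound δ 1 - twoPointBound δ 0 ≤ 40 * hurwitzBd ^ 2 / δ := by
  unfold twoPointBound
  rw [if_pos hδ.le, if_neg (by linarith), Real.sqrt_zero, mul_zero, sub_zero]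
  have h1 : √δ ≤ 1 := Real.sqrt_le_one.2 (by linarith)
  have h2 := sqrtRatio_le_one (δ := δ) (s := 1 - δ)
  have h3 : (1 : ℝ) ≤ 1 / δ := by rw [le_div_iff₀ hδ]; linarith
  have h4 : sqrtRatio δ (1 - δ) / δ ≤ 1 / δ := by gcongr
  have : 40 * hurwitzBd ^ 2 / δ = 8 * hurwitzBd ^ 2 * (1 / δ) + 32 * hurwitzBd ^ 2 * (1 / δ) := by ring
  rw [this]
  gcongr
  linarith

end TwoPoint

/-! ### Shifted sums at two levels -/

/-- The sum of `ζ(1/2, r/j - α) ζ(1/2, r/j - β)` over the residues `r` modulo `j`. -/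
noncomputable def shiftedSum (j : ℕ) (α β : ℝ) : ℝ :=
  ∑ r ∈ Finset.range j, periodicZeta (r / j - α) * periodicZeta (r / j - β)

/-- The contribution of the singularities to `shiftedSum`. -/
noncomputable def shiftedSing (j : ℕ) (α β : ℝ) : ℝ :=
  periodicZeta (-(j * α)) * periodicZeta (α - β) + periodicZeta (-(j * β)) * periodicZeta (β - α)

lemma shiftedSum_comm (j : ℕ) (α β : ℝ) : shiftedSum j α β = shiftedSum j β α := by
  simp only [shiftedSum, mul_comm]

lemma shiftedSing_comm (j : ℕ) (α β : ℝ) : shiftedSing j α β = shiftedSing j β α := by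
  simp only [shiftedSing, add_comm]

lemma sum_periodicZeta_sub {j : ℕ} (hj : 0 < j) (α : ℝ) :
    ∑ r ∈ Finset.range j, periodicZeta (r / j - α) = √j * periodicZeta (-(j * α)) := by
  have := periodicZeta_distribution (-α) hj
  rw [mul_neg] at this
  rw [← this]
  refine Finset.sum_congr rfl fun r _ => ?_
  ring_nf

/-- Expanding the product, the cross terms are summed by the distribution relation and give `√j *
shiftedSing`. The last constant is proportional to `j`, so it drops out when `M` times level `j` is
compared with level `jM`. -/
lemma sum_twoPoint {j : ℕ} (hj : 0 < j) (α β : ℝ) :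
    ∑ r ∈ Finset.range j, twoPoint (β - α) ((r + (-(j * α))) / j) =
      shiftedSum j α β - √j * shiftedSing j α β + j * (periodicZeta (β - α) * periodicZeta (α - β)) := by
  have hj' : (j : ℝ) ≠ 0 := by exact_mod_cast hj.ne'
  have e : ∀ r : ℕ, twoPoint (β - α) ((r + (-(j * α))) / j) =
      periodicZeta (r / j - α) * periodicZeta (r / j - β)
      - periodicZeta (α - β) * periodicZeta (r / j - α)
      - periodicZeta (β - α) * periodicZeta (r / j - β)
      + periodicZeta (β - α) * periodicZeta (α - β) := fun r => by
    rw [twoPoint, show ((r : ℝ) + (-(j * α))) / j = r / j - α by field_simp; ring,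
      show (r : ℝ) / j - α - (β - α) = r / j - β by ring, neg_sub]
    ring
  simp only [e, Finset.sum_add_distrib, Finset.sum_sub_distrib, ← Finset.mul_sum,
    sum_periodicZeta_sub hj, Finset.sum_const, Finset.card_range, nsmul_eq_mul]
  rw [shiftedSum, shiftedSing]
  ring

lemma shiftedSum_sub_le {α β δ : ℝ} (hδ : 0 < δ) (hδ2 : δ ≤ 1 / 2) (n : ℤ) (hn : β - α = δ + n)
    {j M : ℕ} (hj : 0 < j) (hM : 0 < M) :
    |M * (shiftedSum j α β - √j * shiftedSing j α β) -
      (shiftedSum (j * M) α β - √(j * M : ℕ) * shiftedSing (j * M) α β)|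
      ≤ M * (40 * hurwitzBd ^ 2 / δ) := by
  have hper : ∀ (x : ℝ) (n : ℤ), twoPoint δ (x + n) = twoPoint δ x := fun x n => by
    rw [twoPoint, twoPoint, periodicZeta_add_int,
      periodicZeta_eq_of_sub (x := x + n - δ) (y := x - δ) n (by ring)]
  have e : twoPoint δ = twoPoint (β - α) := by
    ext x
    rw [twoPoint, twoPoint, periodicZeta_eq_of_sub (x := β - α) (y := δ) n (by linarith),
      periodicZeta_eq_of_sub (x := x - (β - α)) (y := x - δ) (-n) (by push_cast; linarith),
      periodicZeta_eq_of_sub (x := -(β - α)) (y := -δ) (-n) (by push_cast; linarith)]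
  have h := (incrementBound_twoPoint hδ hδ2).periodic_sum_sub_le hper hj hM
    (-(j * α)) (-((j * M : ℕ) * α))
  rw [e, sum_twoPoint hj, sum_twoPoint (Nat.mul_pos hj hM)] at h
  refine le_trans (le_of_eq ?_) (h.trans ?_)
  · congr 1; push_cast; ring
  · gcongr
    exact twoPointBound_sub_le hδ hδ2

/-- A version of `shiftedSum_sub_le` symmetric in `α` and `β`. -/
lemma shiftedSum_sub_le' {α β θ : ℝ} (hθ : 0 < θ) (hθ1 : θ < 1) (n : ℤ) (hn : β - α = θ + n)
    {j M : ℕ} (hj : 0 < j) (hM : 0 < M) :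
    |M * (shiftedSum j α β - √j * shiftedSing j α β) -
      (shiftedSum (j * M) α β - √(j * M : ℕ) * shiftedSing (j * M) α β)|
      ≤ M * (40 * hurwitzBd ^ 2 * (1 / θ + 1 / (1 - θ))) := by
  have h1 : 0 < 1 / θ := by positivity
  have h2 : 0 < 1 / (1 - θ) := by
    have : 0 < 1 - θ := by linarith
    positivity
  rcases le_total θ (1 / 2) with h | h
  · refine (shiftedSum_sub_le hθ h n hn hj hM).trans ?_
    rw [div_eq_mul_one_div]
    gcongr; linarith
  -- For `θ ≥ 1/2` the shifts are exchanged: `α - β = (1 - θ) + (-n - 1)`.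
  · have := shiftedSum_sub_le (α := β) (β := α) (δ := 1 - θ) (by linarith) (by linarith) (-n - 1)
      (by push_cast; linarith) hj hM
    rw [shiftedSum_comm j, shiftedSing_comm j, shiftedSum_comm (j * M), shiftedSing_comm (j * M)] at this
    refine this.trans ?_
    rw [div_eq_mul_one_div]
    gcongr; linarith

/-! ### The trapezoidal rule for log(1 + √t) -/

section LogSqrt

/-- An antiderivative of `log (1 + √t)`. -/
noncomputable def logSqrtPrim (t : ℝ) : ℝ := (t - 1) * Real.log (1 + √t) + √t - t / 2

lemma continuous_log_one_add_sqrt : Continuous fun t : ℝ => Real.log (1 + √t) :=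
  Continuous.log (by fun_prop) fun t => by positivity

lemma continuous_logSqrtPrim : Continuous logSqrtPrim := by
  have := continuous_log_one_add_sqrt
  unfold logSqrtPrim
  fun_prop

lemma hasDerivAt_log_one_add_sqrt {t : ℝ} (ht : 0 < t) :
    HasDerivAt (fun t : ℝ => Real.log (1 + √t)) (2 * √t * (1 + √t))⁻¹ t := by
  have h0 := Real.sqrt_pos.2 ht
  have h := ((Real.hasDerivAt_sqrt ht.ne').const_add 1).log (by positivity)
  convert h using 1
  field_simp

lemma hasDerivAt_logSqrtPrim {t : ℝ} (ht : 0 < t) :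
    HasDerivAt logSqrtPrim (Real.log (1 + √t)) t := by
  have h0 := Real.sqrt_pos.2 ht
  have h := ((((hasDerivAt_id t).sub_const 1).mul (hasDerivAt_log_one_add_sqrt ht)).add
    (Real.hasDerivAt_sqrt ht.ne')).sub ((hasDerivAt_id t).div_const 2)
  refine h.congr_deriv ?_
  have h2 := Real.sq_sqrt ht.le
  have h3 : t - 1 = (√t - 1) * (1 + √t) := by linear_combination -h2
  rw [id_eq, h3]
  field_simp
  ring

lemma deriv_log_one_add_sqrt_anti {x y : ℝ} (hx : 0 < x) (hxy : x ≤ y) :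
    (2 * √y * (1 + √y))⁻¹ ≤ (2 * √x * (1 + √x))⁻¹ := by
  have h0 := Real.sqrt_pos.2 hx
  have h1 := Real.sqrt_le_sqrt hxy
  gcongr

/-- The error of the trapezoidal rule for `log (1 + √t)`. -/
noncomputable def logSqrtTrap (a t : ℝ) : ℝ :=
  logSqrtPrim t - logSqrtPrim a - (t - a) * (Real.log (1 + √a) + Real.log (1 + √t)) / 2

/-- Two applications of the mean value theorem express the error through a difference of two values
of the derivative of `log (1 + √t)`. As that derivative decreases, the bound telescopes over
adjacent cells of equal length. -/
lemma abs_logSqrtTrap_le {a b : ℝ} (ha : 0 < a) (hab : a < b) :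
    |logSqrtTrap a b| ≤ (b - a) ^ 2 * ((2 * √a * (1 + √a))⁻¹ - (2 * √b * (1 + √b))⁻¹) := by
  have hd : ∀ t ∈ Set.Ioo a b, HasDerivAt (logSqrtTrap a)
      ((Real.log (1 + √t) - Real.log (1 + √a) - (t - a) * (2 * √t * (1 + √t))⁻¹) / 2) t := by
    intro t ht
    have ht0 := ha.trans ht.1
    have h := ((hasDerivAt_logSqrtPrim ht0).sub_const (logSqrtPrim a)).sub
      ((((hasDerivAt_id t).sub_const a).mul
        ((hasDerivAt_log_one_add_sqrt ht0).const_add (Real.log (1 + √a)))).div_const 2)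
    refine h.congr_deriv ?_
    simp only [id]
    ring
  have hc : Continuous (logSqrtTrap a) := by
    have := continuous_log_one_add_sqrt
    have := continuous_logSqrtPrim
    unfold logSqrtTrap
    fun_prop
  obtain ⟨t, ht, hte⟩ := exists_hasDerivAt_eq_slope _ _ hab hc.continuousOn hd
  obtain ⟨s, hs, hse⟩ := exists_hasDerivAt_eq_slope _ _ ht.1
    continuous_log_one_add_sqrt.continuousOn
    (fun s hs => hasDerivAt_log_one_add_sqrt (ha.trans hs.1))
  have h0 : logSqrtTrap a a = 0 := by simp [logSqrtTrap]
  have hta : 0 < t - a := sub_pos.2 ht.1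
  rw [eq_div_iff hta.ne'] at hse
  rw [h0, sub_zero, eq_div_iff (sub_pos.2 hab).ne', ← hse] at hte
  have e1 := deriv_log_one_add_sqrt_anti ha hs.1.le
  have e2 := deriv_log_one_add_sqrt_anti (ha.trans hs.1) hs.2.le
  have e3 := deriv_log_one_add_sqrt_anti (ha.trans ht.1) ht.2.le
  rw [← hte]
  set u := (2 * √a * (1 + √a))⁻¹
  set v := (2 * √b * (1 + √b))⁻¹
  set w := (2 * √s * (1 + √s))⁻¹
  set z := (2 * √t * (1 + √t))⁻¹
  have hba : 0 < b - a := sub_pos.2 hab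
  rw [show (w * (t - a) - (t - a) * z) / 2 * (b - a) = ((t - a) * (b - a)) * ((w - z) / 2) by ring,
    abs_of_nonneg (mul_nonneg (by positivity) (by linarith)), sq]
  refine mul_le_mul ?_ (by linarith) (by linarith) (by positivity)
  exact mul_le_mul_of_nonneg_right (by linarith [ht.2]) hba.le

/-- In the cell touching 0 the derivative is unbounded; monotonicity of the function gives a cruder
bound, sufficient for a single cell. -/
lemma abs_logSqrtTrap_zero_le {b : ℝ} (hb : 0 < b) :
    |logSqrtTrap 0 b| ≤ b * Real.log (1 + √b) := by
  obtain ⟨t, ht, hte⟩ := exists_hasDerivAt_eq_slope _ _ hb continuous_logSqrtPrim.continuousOn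
    (fun t ht => hasDerivAt_logSqrtPrim ht.1)
  rw [sub_zero, eq_div_iff hb.ne'] at hte
  have e : logSqrtTrap 0 b = b * (Real.log (1 + √t) - Real.log (1 + √b) / 2) := by
    rw [logSqrtTrap, ← hte]; simp; ring
  have h1 : 0 ≤ Real.log (1 + √t) := Real.log_nonneg (by linarith [Real.sqrt_nonneg t])
  have h2 : Real.log (1 + √t) ≤ Real.log (1 + √b) :=
    Real.log_le_log (by positivity) (by linarith [Real.sqrt_le_sqrt ht.2.le])
  rw [e, abs_mul, abs_of_pos hb]
  gcongr
  rw [abs_le]; constructor <;> linarith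

/-- The term `N / 2` is `N` times the integral of `log (1 + √t)` over `[0, 1]`, and the limit is
half the boundary difference in the trapezoidal rule. -/
lemma tendsto_sum_log_one_add_sqrt :
    Tendsto (fun N : ℕ => ∑ k ∈ Finset.range N, Real.log (1 + √((k + 1 : ℕ) / N)) - N / 2) atTop
      (𝓝 (Real.log 2 / 2)) := by
  -- The logarithm bounds the error of the first cell and `√(1 / N)` the telescoped errors of all
  -- the others.
  have hlim : Tendsto (fun N : ℕ => Real.log (1 + √(1 / N)) + √(1 / N)) atTop (𝓝 0) := by
    have h1 : Tendsto (fun N : ℕ => (1 / N : ℝ)) atTop (𝓝 0) := tendsto_one_div_atTop_nhds_zero_nat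
    have hc : Continuous fun t : ℝ => Real.log (1 + √t) + √t :=
      continuous_log_one_add_sqrt.add (by fun_prop)
    have h2 := (hc.tendsto 0).comp h1
    simp only [Real.sqrt_zero, add_zero, Real.log_one] at h2
    exact h2
  rw [tendsto_iff_norm_sub_tendsto_zero]
  refine squeeze_zero' (Eventually.of_forall fun _ => norm_nonneg _) ?_ hlim
  filter_upwards [eventually_gt_atTop 0] with N hN
  obtain ⟨n, rfl⟩ : ∃ n, N = n + 1 := ⟨N - 1, by omega⟩
  set N := n + 1
  have hN' : (0 : ℝ) < N := by positivity
  set F : ℕ → ℝ := fun k => Real.log (1 + √((k : ℝ) / N))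
  set P : ℕ → ℝ := fun k => logSqrtPrim ((k : ℝ) / N)
  have hF : ∀ k : ℕ, logSqrtTrap ((k : ℝ) / N) ((k + 1 : ℕ) / N) * N =
      N * (P (k + 1) - P k) + (F (k + 1) - F k) / 2 - F (k + 1) := fun k => by
    simp only [logSqrtTrap, F, P]; push_cast; field_simp; ring
  have hsum : ∑ k ∈ Finset.range N, F (k + 1) - N / 2 - Real.log 2 / 2 =
      - ∑ k ∈ Finset.range N, logSqrtTrap ((k : ℝ) / N) ((k + 1 : ℕ) / N) * N := by
    simp only [hF, Finset.sum_add_distrib, Finset.sum_sub_distrib (f := fun k => _ + _),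
      ← Finset.mul_sum, ← Finset.sum_div, Finset.sum_range_sub]
    have : P N = 1 / 2 := by simp only [P, div_self hN'.ne', logSqrtPrim]; norm_num
    have h0 : P 0 = 0 := by simp [P, logSqrtPrim]
    have h1 : F N = Real.log 2 := by simp only [F, div_self hN'.ne']; norm_num
    have h2 : F 0 = 0 := by simp [F]
    rw [this, h0, h1, h2]; ring
  rw [Real.norm_eq_abs, hsum, abs_neg, Finset.sum_range_succ']
  refine (abs_add_le _ _).trans ?_
  rw [add_comm]
  have hpos : (0 : ℝ) < 1 / N := by positivity
  refine add_le_add ?_ ?_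
  · have := abs_logSqrtTrap_zero_le hpos
    simp only [Nat.cast_zero, zero_div, zero_add, Nat.cast_one, abs_mul, abs_of_pos hN']
    calc _ ≤ (1 / (N : ℝ) * Real.log (1 + √(1 / N))) * N := by gcongr
      _ = _ := by field_simp
  · refine (Finset.abs_sum_le_sum_abs _ _).trans ?_
    have hb : ∀ k ∈ Finset.range n, |logSqrtTrap ((k + 1 : ℕ) / N) ((k + 1 + 1 : ℕ) / N) * N| ≤
        - (((2 * √((k + 1 + 1 : ℕ) / N) * (1 + √((k + 1 + 1 : ℕ) / N)))⁻¹) / N -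
          ((2 * √((k + 1 : ℕ) / N) * (1 + √((k + 1 : ℕ) / N)))⁻¹) / N) := by
      intro k _
      have h1 := abs_logSqrtTrap_le (a := (k + 1 : ℕ) / N) (b := (k + 1 + 1 : ℕ) / N)
        (by positivity) (by gcongr; omega)
      rw [abs_mul, abs_of_pos hN']
      refine (mul_le_mul_of_nonneg_right h1 hN'.le).trans (le_of_eq ?_)
      have : ((k + 1 + 1 : ℕ) : ℝ) / N - (k + 1 : ℕ) / N = 1 / N := by
        push_cast; field_simp; ring
      rw [this]; field_simp; ring
    refine (Finset.sum_le_sum hb).trans ?_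
    rw [Finset.sum_neg_distrib,
      Finset.sum_range_sub (fun k : ℕ => (2 * √((k + 1 : ℕ) / N) * (1 + √((k + 1 : ℕ) / N)))⁻¹ / N)]
    have h3 : 0 ≤ (2 * √((n + 1 : ℕ) / N) * (1 + √((n + 1 : ℕ) / N)))⁻¹ / (N : ℝ) := by positivity
    have h4 : (2 * √((0 + 1 : ℕ) / N) * (1 + √((0 + 1 : ℕ) / N)))⁻¹ / (N : ℝ) ≤ √(1 / N) := by
      have hs := Real.sqrt_pos.2 hpos
      have hs2 := Real.sq_sqrt hpos.le
      rw [show ((0 + 1 : ℕ) : ℝ) / N = 1 / N by simp, div_eq_mul_one_div, ← hs2]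
      rw [Real.sqrt_sq hs.le, ← div_eq_inv_mul, div_le_iff₀ (by positivity)]
      nlinarith
    linarith

end LogSqrt

/-! ### Integrals of products of inverse square roots -/

section DoubleIntegral

lemma hasDerivAt_two_mul_log_sqrt_add_sqrt {k l x : ℝ} (hk : 0 < k + x) (hl : 0 < l + x) :
    HasDerivAt (fun x => 2 * Real.log (√(k + x) + √(l + x))) ((√(k + x))⁻¹ * (√(l + x))⁻¹) x := by
  have h1 := Real.sqrt_pos.2 hk
  have h2 := Real.sqrt_pos.2 hl
  have e1 := ((hasDerivAt_id x).const_add k).sqrt hk.ne'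
  have e2 := ((hasDerivAt_id x).const_add l).sqrt hl.ne'
  have h := ((e1.add e2).log (by simp only [id, Pi.add_apply]; positivity)).const_mul 2
  refine h.congr_deriv ?_
  simp only [id, Pi.add_apply]
  field_simp
  ring

/-- As long as `k` and `l` are not both 0 the antiderivative is continuous up to 0. Integrability of
the possibly singular integrand follows because it is a nonnegative derivative of that function. -/
lemma integral_inv_sqrt_mul_inv_sqrt {k l : ℝ} (hk : 0 ≤ k) (hl : 0 ≤ l) (h : 0 < k ∨ 0 < l) :
    IntervalIntegrable (fun x => (√(k + x))⁻¹ * (√(l + x))⁻¹) MeasureTheory.volume 0 1 ∧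
    ∫ x in (0 : ℝ)..1, (√(k + x))⁻¹ * (√(l + x))⁻¹ =
      2 * Real.log (√(k + 1) + √(l + 1)) - 2 * Real.log (√k + √l) := by
  have hc : ContinuousOn (fun x => 2 * Real.log (√(k + x) + √(l + x))) (Set.Icc 0 1) := by
    refine ContinuousOn.mul continuousOn_const (ContinuousOn.log (by fun_prop) fun x hx => ?_)
    rcases h with h | h
    · have := Real.sqrt_pos.2 (show 0 < k + x by linarith [hx.1]); positivity
    · have := Real.sqrt_pos.2 (show 0 < l + x by linarith [hx.1]); positivity
  have hd : ∀ x ∈ Set.Ioo (0 : ℝ) 1, HasDerivAt (fun x => 2 * Real.log (√(k + x) + √(l + x)))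
      ((√(k + x))⁻¹ * (√(l + x))⁻¹) x := fun x hx =>
    hasDerivAt_two_mul_log_sqrt_add_sqrt (by linarith [hx.1]) (by linarith [hx.1])
  have hi : IntervalIntegrable (fun x => (√(k + x))⁻¹ * (√(l + x))⁻¹) MeasureTheory.volume 0 1 := by
    refine intervalIntegral.intervalIntegrable_deriv_of_nonneg
      (g := fun x => 2 * Real.log (√(k + x) + √(l + x))) ?_ ?_ ?_
    · rwa [Set.uIcc_of_le zero_le_one]
    · simpa using hd
    · intro x _; positivity
  refine ⟨hi, ?_⟩
  rw [intervalIntegral.integral_eq_sub_of_hasDerivAt_of_le zero_le_one hc hd hi]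
  simp

lemma integral_inv_sqrt {k : ℝ} (hk : 0 ≤ k) :
    IntervalIntegrable (fun x => (√(k + x))⁻¹) MeasureTheory.volume 0 1 ∧
    ∫ x in (0 : ℝ)..1, (√(k + x))⁻¹ = 2 * √(k + 1) - 2 * √k := by
  have hc : ContinuousOn (fun x => 2 * √(k + x)) (Set.Icc 0 1) := by fun_prop
  have hd : ∀ x ∈ Set.Ioo (0 : ℝ) 1, HasDerivAt (fun x => 2 * √(k + x)) ((√(k + x))⁻¹) x := by
    intro x hx
    have hp : 0 < k + x := by linarith [hx.1]
    have h := (((hasDerivAt_id x).const_add k).sqrt hp.ne').const_mul 2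
    refine h.congr_deriv ?_
    simp only [id]
    field_simp
  have hi : IntervalIntegrable (fun x => (√(k + x))⁻¹) MeasureTheory.volume 0 1 := by
    refine intervalIntegral.intervalIntegrable_deriv_of_nonneg (g := fun x => 2 * √(k + x)) ?_ ?_ ?_
    · rwa [Set.uIcc_of_le zero_le_one]
    · simpa using hd
    · intro x _; positivity
  refine ⟨hi, ?_⟩
  rw [intervalIntegral.integral_eq_sub_of_hasDerivAt_of_le zero_le_one hc hd hi]
  simp

lemma sum_range_sum_range_succ_sub (φ : ℕ → ℕ → ℝ) (n : ℕ) :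
    ∑ k ∈ Finset.range n, ∑ l ∈ Finset.range n, (φ (k + 1) (l + 1) - φ k l) =
      ∑ k ∈ Finset.range n, φ k n + ∑ l ∈ Finset.range n, φ n l + φ n n
        - ∑ k ∈ Finset.range n, φ (k + 1) 0 - ∑ l ∈ Finset.range n, φ 0 (l + 1) - φ 0 0 := by
  have h1 : ∑ k ∈ Finset.range (n + 1), ∑ l ∈ Finset.range (n + 1), φ k l =
      ∑ k ∈ Finset.range n, ∑ l ∈ Finset.range n, φ (k + 1) (l + 1)
        + ∑ k ∈ Finset.range n, φ (k + 1) 0 + ∑ l ∈ Finset.range n, φ 0 (l + 1) + φ 0 0 := by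
    simp only [Finset.sum_range_succ', Finset.sum_add_distrib]
    ring
  have h2 : ∑ k ∈ Finset.range (n + 1), ∑ l ∈ Finset.range (n + 1), φ k l =
      ∑ k ∈ Finset.range n, ∑ l ∈ Finset.range n, φ k l
        + ∑ k ∈ Finset.range n, φ k n + ∑ l ∈ Finset.range n, φ n l + φ n n := by
    simp only [Finset.sum_range_succ, Finset.sum_add_distrib]
    ring
  simp only [Finset.sum_sub_distrib]
  linarith

/-- Summing the increments along diagonals leaves only the edges of the square. The edges with an
index 0 produce `log N!`, the far edges produce the sum over `k`. Omitting the pair `(0, 0)`, which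
corresponds to the nonintegrable `1/x`, costs `2 log 2`. -/
lemma sum_offDiag_log_sqrt_add_sqrt {N : ℕ} (hN : 0 < N) :
    ∑ p ∈ (Finset.range N ×ˢ Finset.range N).erase (0, 0),
      (2 * Real.log (√((p.1 : ℝ) + 1) + √((p.2 : ℝ) + 1)) - 2 * Real.log (√(p.1 : ℝ) + √(p.2 : ℝ)))
    = 4 * ∑ k ∈ Finset.range N, Real.log (√((k + 1 : ℕ) : ℝ) + √N)
      - 2 * Real.log N.factorial - 4 * Real.log 2 + Real.log N := by
  have hN' : (0 : ℝ) < N := by exact_mod_cast hN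
  have hmem : ((0 : ℕ), (0 : ℕ)) ∈ Finset.range N ×ˢ Finset.range N := by simp [hN]
  set φ : ℕ → ℕ → ℝ := fun k l => 2 * Real.log (√k + √l) with hφ
  have hfac : ∑ k ∈ Finset.range N, 2 * Real.log (√((k + 1 : ℕ) : ℝ)) = Real.log N.factorial := by
    rw [← Finset.prod_range_add_one_eq_factorial, Nat.cast_prod, Real.log_prod]
    · refine Finset.sum_congr rfl fun k _ => ?_
      rw [Real.log_sqrt (by positivity)]; ring
    · intro k _; positivity
  have hsh : ∑ k ∈ Finset.range N, Real.log (√(k : ℝ) + √N) =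
      ∑ k ∈ Finset.range N, Real.log (√((k + 1 : ℕ) : ℝ) + √N) - Real.log 2 := by
    have h := Finset.sum_range_sub (fun k : ℕ => Real.log (√(k : ℝ) + √N)) N
    rw [Finset.sum_sub_distrib] at h
    have h2 : Real.log (√(N : ℝ) + √N) = Real.log 2 + Real.log √N := by
      rw [← two_mul, Real.log_mul (by norm_num) (Real.sqrt_pos.2 hN').ne']
    simp only [h2, Nat.cast_zero, Real.sqrt_zero, zero_add] at h
    linarith
  have hNN : φ N N = 2 * Real.log 2 + Real.log N := by
    simp only [hφ]
    rw [← two_mul, Real.log_mul (by norm_num) (Real.sqrt_pos.2 hN').ne', Real.log_sqrt hN'.le]; ring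
  have h := sum_range_sum_range_succ_sub φ N
  have hall : ∑ p ∈ Finset.range N ×ˢ Finset.range N, (φ (p.1 + 1) (p.2 + 1) - φ p.1 p.2) =
      4 * ∑ k ∈ Finset.range N, Real.log (√((k + 1 : ℕ) : ℝ) + √N)
      - 2 * Real.log N.factorial - 2 * Real.log 2 + Real.log N := by
    rw [Finset.sum_product, h, hNN]
    have e1 : ∑ k ∈ Finset.range N, φ k N = 2 * ∑ k ∈ Finset.range N, Real.log (√(k : ℝ) + √N) := by
      rw [Finset.mul_sum]
    have e2 : ∑ k ∈ Finset.range N, φ N k = 2 * ∑ k ∈ Finset.range N, Real.log (√(k : ℝ) + √N) := by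
      rw [Finset.mul_sum]; simp only [hφ, add_comm]
    have e3 : ∑ k ∈ Finset.range N, φ (k + 1) 0 = Real.log N.factorial := by
      rw [← hfac]; simp [hφ]
    have e4 : ∑ k ∈ Finset.range N, φ 0 (k + 1) = Real.log N.factorial := by
      rw [← hfac]; simp [hφ]
    rw [e1, e2, e3, e4, hsh]
    simp [hφ]; ring
  have h11 : φ (0 + 1) (0 + 1) - φ 0 0 = 2 * Real.log 2 := by
    simp [hφ]; norm_num
  have he := Finset.add_sum_erase _ (fun p : ℕ × ℕ => φ (p.1 + 1) (p.2 + 1) - φ p.1 p.2) hmem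
  simp only [h11] at he
  rw [hall] at he
  have e5 : ∀ p : ℕ × ℕ, (2 * Real.log (√((p.1 : ℝ) + 1) + √((p.2 : ℝ) + 1)) -
      2 * Real.log (√(p.1 : ℝ) + √(p.2 : ℝ))) = φ (p.1 + 1) (p.2 + 1) - φ p.1 p.2 := fun p => by
    simp [hφ]
  rw [Finset.sum_congr rfl fun p _ => e5 p]
  linarith

/-- The factorial is treated by Stirling's formula, which contributes `-log π`, and the remaining
sum by the trapezoidal rule. Together with the powers of 2 this makes `-log(8π)`. -/
lemma tendsto_sum_offDiag :
    Tendsto (fun N : ℕ => 4 * ∑ k ∈ Finset.range N, Real.log (√((k + 1 : ℕ) : ℝ) + √N)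
      - 2 * Real.log N.factorial - 4 * Real.log 2 + Real.log N - 4 * N) atTop
      (𝓝 (-Real.log (8 * Real.pi))) := by
  have h1 := tendsto_sum_log_one_add_sqrt.const_mul 4
  have h2 : Tendsto (fun N => Real.log (Stirling.stirlingSeq N)) atTop (𝓝 (Real.log √Real.pi)) :=
    (Real.continuousAt_log (by positivity)).tendsto.comp Stirling.tendsto_stirlingSeq_sqrt_pi
  have h3 := (h1.sub (h2.const_mul 2)).sub_const (5 * Real.log 2)
  have hlim : 4 * (Real.log 2 / 2) - 2 * Real.log √Real.pi - 5 * Real.log 2 =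
      -Real.log (8 * Real.pi) := by
    rw [Real.log_sqrt Real.pi_pos.le, Real.log_mul (by norm_num) Real.pi_ne_zero,
      show (8 : ℝ) = 2 ^ 3 by norm_num, Real.log_pow]
    push_cast; ring
  rw [hlim] at h3
  refine h3.congr' ?_
  filter_upwards [eventually_gt_atTop 0] with N hN
  have hN' : (0 : ℝ) < N := by exact_mod_cast hN
  have hs := Stirling.log_stirlingSeq_formula N
  rw [Real.log_mul (by norm_num) hN'.ne', Real.log_div hN'.ne' (Real.exp_pos 1).ne', Real.log_exp] at hs
  have e : ∑ k ∈ Finset.range N, Real.log (√((k + 1 : ℕ) : ℝ) + √N) =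
      ∑ k ∈ Finset.range N, Real.log (1 + √((k + 1 : ℕ) / N)) + N * (Real.log N / 2) := by
    have : (N : ℝ) * (Real.log N / 2) = ∑ k ∈ Finset.range N, Real.log N / 2 := by simp
    rw [this, ← Finset.sum_add_distrib]
    refine Finset.sum_congr rfl fun k _ => ?_
    have hs := Real.sqrt_pos.2 hN'
    rw [← Real.log_sqrt hN'.le, ← Real.log_mul (by positivity) hs.ne', Real.sqrt_div (by positivity)]
    congr 1; field_simp; ring
  rw [e, hs]
  ring

end DoubleIntegral

open Filter Topology MeasureTheory

/-- On each cell the deviation from the right endpoint value is at most the increment of `B`; the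
increments telescope. -/
lemma IncrementBound.abs_sum_sub_integral_le {K B : ℝ → ℝ} (h : IncrementBound K B)
    (hK : IntervalIntegrable K volume 0 1) {j : ℕ} (hj : 0 < j) :
    |∑ r ∈ Finset.range j, K ((r + 1 : ℕ) / j) - j * ∫ x in (0 : ℝ)..1, K x| ≤ B 1 - B 0 := by
  have hj' : (0 : ℝ) < j := by exact_mod_cast hj
  have hle : ∀ r ∈ Finset.range j, (((r + 1 : ℕ) : ℝ) / j) ≤ 1 := fun r hr => by
    rw [div_le_one hj']; exact_mod_cast Finset.mem_range.1 hr
  have hlt : ∀ r : ℕ, (r : ℝ) / j ≤ ((r + 1 : ℕ) : ℝ) / j := fun r => by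
    gcongr; omega
  have hint : ∀ r < j, IntervalIntegrable K volume ((r : ℝ) / j) ((r + 1 : ℕ) / j) := fun r hr => by
    refine hK.mono_set ?_
    rw [Set.uIcc_of_le (hlt r), Set.uIcc_of_le zero_le_one]
    exact Set.Icc_subset_Icc (by positivity) (hle r (Finset.mem_range.2 hr))
  have hsum := intervalIntegral.sum_integral_adjacent_intervals hint
  rw [Nat.cast_zero, zero_div, div_self hj'.ne'] at hsum
  rw [← hsum, Finset.mul_sum, ← Finset.sum_sub_distrib]
  refine (Finset.abs_sum_le_sum_abs _ _).trans ?_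
  calc _ ≤ ∑ r ∈ Finset.range j, (B ((r + 1 : ℕ) / j) - B ((r : ℝ) / j)) := by
        refine Finset.sum_le_sum fun r hr => ?_
        have e : K ((r + 1 : ℕ) / j) - j * ∫ x in ((r : ℝ) / j)..((r + 1 : ℕ) / j), K x =
            j * ∫ x in ((r : ℝ) / j)..((r + 1 : ℕ) / j), (K ((r + 1 : ℕ) / j) - K x) := by
          rw [intervalIntegral.integral_sub (by simp) (hint r (Finset.mem_range.1 hr)),
            intervalIntegral.integral_const, smul_eq_mul]
          push_cast; field_simp; ring
        rw [e, abs_mul, abs_of_pos hj']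
        have hb := intervalIntegral.norm_integral_le_of_norm_le_const (a := (r : ℝ) / j)
          (b := (r + 1 : ℕ) / j) (f := fun x => K ((r + 1 : ℕ) / j) - K x)
          (C := B ((r + 1 : ℕ) / j) - B ((r : ℝ) / j)) fun x hx => by
            rw [Set.uIoc_of_le (hlt r)] at hx
            exact h.abs_sub_le_of_mem (by positivity) (hle r hr) ⟨hx.1.trans_le hx.2, le_rfl⟩ hx
        rw [Real.norm_eq_abs, abs_of_nonneg (sub_nonneg.2 (hlt r))] at hb
        refine (mul_le_mul_of_nonneg_left hb hj'.le).trans (le_of_eq ?_)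
        push_cast; field_simp; ring
    _ = _ := by
        rw [Finset.sum_range_sub (fun r : ℕ => B ((r : ℝ) / j))]
        simp [hj'.ne']

/-! ### The integral of ζ(1/2, x)² - 1/x -/

section Regularised

/-- The partial sums converging to `ζ(1/2, x)`. -/
noncomputable def hurwitzPartial (N : ℕ) (x : ℝ) : ℝ := ∑ k ∈ Finset.range N, (√(k + x))⁻¹ - 2 * √N

lemma hurwitzPartial_sq_sub {N : ℕ} (hN : 0 < N) {x : ℝ} (hx : 0 < x) :
    hurwitzPartial N x ^ 2 - x⁻¹ =
      ∑ p ∈ (Finset.range N ×ˢ Finset.range N).erase (0, 0), (√((p.1 : ℝ) + x))⁻¹ * (√((p.2 : ℝ) + x))⁻¹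
      - 4 * √N * ∑ k ∈ Finset.range N, (√((k : ℝ) + x))⁻¹ + 4 * N := by
  have hmem : ((0 : ℕ), (0 : ℕ)) ∈ Finset.range N ×ˢ Finset.range N := by simp [hN]
  have h := Finset.add_sum_erase _ (fun p : ℕ × ℕ => (√((p.1 : ℝ) + x))⁻¹ * (√((p.2 : ℝ) + x))⁻¹) hmem
  rw [Finset.sum_product] at h
  simp only at h
  rw [← Finset.sum_mul_sum] at h
  simp only [Nat.cast_zero, zero_add, ← mul_inv, Real.mul_self_sqrt hx.le] at h
  have h2 := Real.sq_sqrt (Nat.cast_nonneg (α := ℝ) N)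
  simp only [mul_inv] at h
  rw [hurwitzPartial]
  linear_combination -h + 4 * h2

lemma integral_hurwitzPartial_sq_sub {N : ℕ} (hN : 0 < N) :
    ∫ x in (0 : ℝ)..1, (hurwitzPartial N x ^ 2 - x⁻¹) =
      4 * ∑ k ∈ Finset.range N, Real.log (√((k + 1 : ℕ) : ℝ) + √N)
      - 2 * Real.log N.factorial - 4 * Real.log 2 + Real.log N - 4 * N := by
  have e : ∫ x in (0 : ℝ)..1, (hurwitzPartial N x ^ 2 - x⁻¹) = ∫ x in (0 : ℝ)..1,
      (∑ p ∈ (Finset.range N ×ˢ Finset.range N).erase (0, 0), (√((p.1 : ℝ) + x))⁻¹ * (√((p.2 : ℝ) + x))⁻¹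
      - 4 * √N * ∑ k ∈ Finset.range N, (√((k : ℝ) + x))⁻¹ + 4 * N) := by
    refine intervalIntegral.integral_congr_ae (ae_of_all _ fun x hx => ?_)
    rw [Set.uIoc_of_le zero_le_one] at hx
    exact hurwitzPartial_sq_sub hN hx.1
  have hp : ∀ p ∈ (Finset.range N ×ˢ Finset.range N).erase (0, 0),
      (0 : ℝ) < p.1 ∨ (0 : ℝ) < p.2 := fun p hp => by
    have := (Finset.mem_erase.1 hp).1
    by_contra! hcon
    refine this (Prod.ext ?_ ?_)
    · exact_mod_cast le_antisymm hcon.1 (Nat.cast_nonneg _)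
    · exact_mod_cast le_antisymm hcon.2 (Nat.cast_nonneg _)
  have i1 : IntervalIntegrable (fun x : ℝ => ∑ p ∈ (Finset.range N ×ˢ Finset.range N).erase (0, 0),
      (√((p.1 : ℝ) + x))⁻¹ * (√((p.2 : ℝ) + x))⁻¹) volume 0 1 := by
    rw [← Finset.sum_fn]
    refine IntervalIntegrable.sum _ fun p hq => ?_
    exact (integral_inv_sqrt_mul_inv_sqrt (Nat.cast_nonneg _) (Nat.cast_nonneg _) (hp p hq)).1
  have i2 : IntervalIntegrable (fun x : ℝ => ∑ k ∈ Finset.range N, (√((k : ℝ) + x))⁻¹) volume 0 1 := by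
    rw [← Finset.sum_fn]
    exact IntervalIntegrable.sum _ fun k _ => (integral_inv_sqrt (Nat.cast_nonneg _)).1
  rw [e, intervalIntegral.integral_add (i1.sub (i2.const_mul _)) (by simp),
    intervalIntegral.integral_sub i1 (i2.const_mul _), intervalIntegral.integral_const_mul,
    intervalIntegral.integral_finsetSum, intervalIntegral.integral_finsetSum,
    Finset.sum_congr rfl (fun p hq => (integral_inv_sqrt_mul_inv_sqrt (Nat.cast_nonneg _)
      (Nat.cast_nonneg _) (hp p hq)).2),
    sum_offDiag_log_sqrt_add_sqrt hN,
    Finset.sum_congr rfl (fun k _ => (integral_inv_sqrt (Nat.cast_nonneg k)).2)]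
  · have : ∑ k ∈ Finset.range N, (2 * √((k : ℝ) + 1) - 2 * √k) = 2 * √N := by
      have := Finset.sum_range_sub (fun k : ℕ => 2 * √(k : ℝ)) N
      simpa using this
    rw [this]
    have h2 := Real.sq_sqrt (Nat.cast_nonneg (α := ℝ) N)
    simp
    linear_combination -8 * h2
  · intro k _; exact (integral_inv_sqrt (Nat.cast_nonneg _)).1
  · intro p hq
    exact (integral_inv_sqrt_mul_inv_sqrt (Nat.cast_nonneg _) (Nat.cast_nonneg _) (hp p hq)).1

/-- Without the term `k = 0` the partial sums vary by at most the Lipschitz constant over `(0, 1]`,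
and at `x = 1` they converge, hence are bounded. This supplies the majorant for dominated
convergence. -/
lemma exists_abs_hurwitzPartial_sub_le : ∃ C : ℝ, 0 ≤ C ∧ ∀ N : ℕ, 0 < N → ∀ x : ℝ, 0 < x → x ≤ 1 →
    |hurwitzPartial N x - (√x)⁻¹| ≤ C := by
  have hT := (tendsto_hurwitzHalf' one_pos)
  obtain ⟨C, hC⟩ := (Metric.isBounded_range_of_tendsto _ hT).exists_norm_le
  have hC0 : 0 ≤ C := (norm_nonneg _).trans (hC _ (Set.mem_range_self 0))
  refine ⟨C + hurwitzLip + 3, by linarith [hurwitzLip_nonneg], fun N hN x hx hx1 => ?_⟩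
  obtain ⟨n, rfl⟩ : ∃ n, N = n + 1 := ⟨N - 1, by omega⟩
  have hb := hC _ (Set.mem_range_self (n + 1))
  rw [Real.norm_eq_abs, abs_le] at hb
  have hL := sum_inv_sqrt_sub_le hx hx1 n
  have hL0 := hurwitzLip_nonneg
  have e0 : hurwitzPartial (n + 1) x - (√x)⁻¹ =
      ∑ k ∈ Finset.range n, (√(k + 1 + x))⁻¹ - 2 * √(n + 1 : ℕ) := by
    rw [hurwitzPartial, Finset.sum_range_succ']; push_cast; simp only [zero_add]; ring
  have e1 : ∑ k ∈ Finset.range (n + 1), (√((k : ℝ) + 1))⁻¹ =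
      ∑ k ∈ Finset.range n, (√((k : ℝ) + 1 + 1))⁻¹ + 1 := by
    rw [Finset.sum_range_succ']; simp
  have m1 : ∑ k ∈ Finset.range n, (√((k : ℝ) + 1 + 1))⁻¹ ≤ ∑ k ∈ Finset.range n, (√(k + 1 + x))⁻¹ :=
    Finset.sum_le_sum fun k _ => inv_sqrt_anti (by positivity) (by linarith)
  have e1' := e1
  rw [e1] at hb
  rw [e0, abs_le]
  have h3 : hurwitzLip * (1 - x) ≤ hurwitzLip := by nlinarith
  constructor <;> linarith [hb.1, hb.2]

/-- Dominated convergence from the partial sums, whose integrals are known in closed form. -/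
lemma tendsto_integral_hurwitzHalf : IntervalIntegrable (fun x => hurwitzHalf x ^ 2 - x⁻¹) volume 0 1 ∧
    ∫ x in (0 : ℝ)..1, (hurwitzHalf x ^ 2 - x⁻¹) = -Real.log (8 * Real.pi) := by
  obtain ⟨C, hC0, hC⟩ := exists_abs_hurwitzPartial_sub_le
  -- If `P = x^{-1/2} + E` with `|E| ≤ C`, then `P² - 1/x = 2E x^{-1/2} + E²`. The form `0 + x`
  -- matches `integral_inv_sqrt` at `k = 0`.
  set bd : ℝ → ℝ := fun x => 2 * C * (√(0 + x))⁻¹ + C ^ 2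
  have hbi : IntervalIntegrable bd volume 0 1 :=
    ((integral_inv_sqrt le_rfl).1.const_mul (2 * C)).add (by simp)
  have hbound : ∀ N : ℕ, 0 < N → ∀ x : ℝ, 0 < x → x ≤ 1 →
      ‖hurwitzPartial N x ^ 2 - x⁻¹‖ ≤ bd x := fun N hN x hx hx1 => by
    have h := hC N hN x hx hx1
    have hs := Real.sqrt_pos.2 hx
    have e : hurwitzPartial N x ^ 2 - x⁻¹ = 2 * (hurwitzPartial N x - (√x)⁻¹) * (√x)⁻¹
        + (hurwitzPartial N x - (√x)⁻¹) ^ 2 := by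
      have : x⁻¹ = (√x)⁻¹ ^ 2 := by rw [inv_pow, Real.sq_sqrt hx.le]
      rw [this]; ring
    rw [Real.norm_eq_abs, e]
    refine (abs_add_le _ _).trans ?_
    simp only [bd, zero_add]
    rw [abs_mul, abs_mul, abs_of_pos (inv_pos.2 hs), abs_two, abs_pow]
    gcongr
  have hlim : ∀ x : ℝ, 0 < x → Tendsto (fun N : ℕ => hurwitzPartial N x ^ 2 - x⁻¹) atTop
      (𝓝 (hurwitzHalf x ^ 2 - x⁻¹)) := fun x hx => ((tendsto_hurwitzHalf' hx).pow 2).sub_const _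
  have hmeas : ∀ N : ℕ, Measurable fun x => hurwitzPartial N x ^ 2 - x⁻¹ := fun N => by
    unfold hurwitzPartial; fun_prop
  have hT : Tendsto (fun N : ℕ => ∫ x in (0 : ℝ)..1, (hurwitzPartial N x ^ 2 - x⁻¹)) atTop
      (𝓝 (∫ x in (0 : ℝ)..1, (hurwitzHalf x ^ 2 - x⁻¹))) := by
    refine intervalIntegral.tendsto_integral_filter_of_dominated_convergence bd ?_ ?_ hbi ?_
    · exact Eventually.of_forall fun N => (hmeas N).aestronglyMeasurable
    · filter_upwards [eventually_gt_atTop 0] with N hN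
      refine ae_of_all _ fun x hx => ?_
      rw [Set.uIoc_of_le zero_le_one] at hx
      exact hbound N hN x hx.1 hx.2
    · refine ae_of_all _ fun x hx => ?_
      rw [Set.uIoc_of_le zero_le_one] at hx
      exact hlim x hx.1
  refine ⟨?_, tendsto_nhds_unique hT (tendsto_sum_offDiag.congr' ?_)⟩
  · refine hbi.mono_fun ?_ ?_
    · refine aestronglyMeasurable_of_tendsto_ae atTop
        (fun N => (hmeas N).aestronglyMeasurable) ?_
      rw [Set.uIoc_of_le zero_le_one]
      filter_upwards [ae_restrict_mem measurableSet_Ioc] with x hx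
      exact hlim x hx.1
    · rw [Set.uIoc_of_le zero_le_one]
      filter_upwards [ae_restrict_mem measurableSet_Ioc] with x hx
      refine (le_of_tendsto (hlim x hx.1).norm ?_).trans (le_abs_self _)
      filter_upwards [eventually_gt_atTop 0] with N hN
      exact hbound N hN x hx.1 hx.2
  · filter_upwards [eventually_gt_atTop 0] with N hN
    exact (integral_hurwitzPartial_sq_sub hN).symm

end Regularised

/-! ### The diagonal sum of ζ(1/2, r/j)² -/

section Diagonal

/-- The square of `ζ(1/2, x)` with its singular part removed. -/
noncomputable def diagKernel (x : ℝ) : ℝ :=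
  hurwitzHalf x ^ 2 - x⁻¹ - 2 * hurwitzHalf 1 * (√x)⁻¹

lemma intervalIntegrable_diagKernel : IntervalIntegrable diagKernel volume 0 1 ∧
    ∫ x in (0 : ℝ)..1, diagKernel x = -Real.log (8 * Real.pi) - 4 * hurwitzHalf 1 := by
  obtain ⟨h1, h2⟩ := tendsto_integral_hurwitzHalf
  obtain ⟨h3, h4⟩ := integral_inv_sqrt (k := 0) le_rfl
  simp only [zero_add] at h3 h4
  refine ⟨h1.sub (h3.const_mul _), ?_⟩
  unfold diagKernel
  rw [intervalIntegral.integral_sub h1 (h3.const_mul _), h2, intervalIntegral.integral_const_mul, h4]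
  simp; ring

/-- From `ζ(x) = x^{-1/2} + ζ(1 + x)` the kernel equals `2 (ζ(1 + x) - ζ(1)) x^{-1/2} + ζ(1 + x)²`.
Here `ζ(1 + x)` is Lipschitz, so the increments are bounded by those of a multiple of `√x`. -/
lemma incrementBound_diagKernel :
    IncrementBound diagKernel (fun x => 36 * hurwitzBd ^ 2 * √x) where
  zero_le {x} _ _ := by simp only [Real.sqrt_zero, mul_zero]; positivity
  le_sub {x y} hx hxy hy := by
    have hy0 := hx.trans_le hxy
    have key : ∀ t : ℝ, 0 < t → diagKernel t = 2 * (hurwitzHalf (1 + t) - hurwitzHalf 1) * (√t)⁻¹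
        + hurwitzHalf (1 + t) ^ 2 := fun t ht => by
      have h2 : t⁻¹ = (√t)⁻¹ ^ 2 := by rw [inv_pow, Real.sq_sqrt ht.le]
      rw [diagKernel, hurwitzHalf_add_one ht, h2, add_comm t 1]; ring
    rw [key x hx, key y hy0]
    have L0 := hurwitzLip_nonneg
    have c1 : |hurwitzHalf 1| + hurwitzLip + 1 = hurwitzBd := rfl
    have a1 := hurwitzHalf_sub_le (x := 1 + x) (y := 1 + y) (by linarith) (by linarith)
    have a2 := hurwitzHalf_anti (x := 1 + x) (y := 1 + y) (by linarith) (by linarith)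
    have a3 := inv_sqrt_sub_le_of_half_le (x := 1 + x) (y := 1 + y) (by linarith) (by linarith)
    have b1 := hurwitzHalf_sub_le (x := 1) (y := 1 + x) (by linarith) (by linarith)
    have b2 := hurwitzHalf_anti (x := 1) (y := 1 + x) (by linarith) (by linarith)
    have b3 := inv_sqrt_sub_le_of_half_le (x := 1) (y := 1 + x) (by linarith) (by linarith)
    have d1 := hurwitzHalf_sub_le (x := 1) (y := 1 + y) (by linarith) (by linarith)
    have d2 := hurwitzHalf_anti (x := 1) (y := 1 + y) (by linarith) (by linarith)
    have d3 := inv_sqrt_sub_le_of_half_le (x := 1) (y := 1 + y) (by linarith) (by linarith)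
    have m1 := mul_inv_sqrt_sub_le hx hxy
    have m2 := sub_mul_inv_sqrt_le hx.le hxy hy0
    have m3 := sub_le_two_mul_sqrt_sub hx.le hxy hy
    have n1 := one_le_inv_sqrt hy0 hy
    have n3 := inv_sqrt_anti hx hxy
    have sq := Real.sqrt_le_sqrt hxy
    have z0 := abs_nonneg (hurwitzHalf 1)
    have z1 := le_abs_self (hurwitzHalf 1)
    have z2 := neg_abs_le (hurwitzHalf 1)
    set L := hurwitzLip
    set c := hurwitzBd
    set z := hurwitzHalf 1
    set g := hurwitzHalf (1 + x)
    set g' := hurwitzHalf (1 + y)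
    have f1 : g - g' ≤ 2 * c * (y - x) := by nlinarith
    have f2 : z - g ≤ 2 * c * x := by nlinarith
    have f3 : z - g' ≤ 2 * c := by nlinarith
    have hc : 0 ≤ c := by linarith
    have g1 : |g| ≤ 3 * c := by rw [abs_le]; constructor <;> linarith
    have g2 : |g'| ≤ 3 * c := by rw [abs_le]; constructor <;> linarith
    have D0 : 0 ≤ √y - √x := by linarith
    have e : 2 * (g - z) * (√x)⁻¹ + g ^ 2 - (2 * (g' - z) * (√y)⁻¹ + g' ^ 2) =
        2 * ((g - g') * (√y)⁻¹) - 2 * ((z - g) * ((√x)⁻¹ - (√y)⁻¹)) + (g - g') * (g + g') := by ring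
    rw [e]
    have t1 : |(g - g') * (√y)⁻¹| ≤ 4 * c * (√y - √x) := by
      rw [abs_of_nonneg (mul_nonneg (by linarith) (by linarith))]
      calc _ ≤ 2 * c * (y - x) * (√y)⁻¹ := mul_le_mul_of_nonneg_right f1 (by linarith)
        _ = 2 * c * ((y - x) * (√y)⁻¹) := by ring
        _ ≤ 2 * c * (2 * (√y - √x)) := by gcongr
        _ = _ := by ring
    have t2 : |(z - g) * ((√x)⁻¹ - (√y)⁻¹)| ≤ 2 * c * (√y - √x) := by
      rw [abs_of_nonneg (mul_nonneg (by linarith) (by linarith))]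
      calc _ ≤ 2 * c * x * ((√x)⁻¹ - (√y)⁻¹) := mul_le_mul_of_nonneg_right f2 (by linarith)
        _ = 2 * c * (x * ((√x)⁻¹ - (√y)⁻¹)) := by ring
        _ ≤ 2 * c * (√y - √x) := by gcongr
    have t3 : |(g - g') * (g + g')| ≤ 24 * c ^ 2 * (√y - √x) := by
      rw [abs_mul, abs_of_nonneg (show 0 ≤ g - g' by linarith)]
      calc _ ≤ 2 * c * (2 * (√y - √x)) * (6 * c) := by
            refine mul_le_mul (f1.trans (by gcongr)) ?_ (abs_nonneg _) (by positivity)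
            exact (abs_add_le _ _).trans (by linarith)
        _ = _ := by ring
    have t4 : 12 * c * (√y - √x) ≤ 12 * c ^ 2 * (√y - √x) := by
      refine mul_le_mul_of_nonneg_right ?_ D0
      nlinarith
    refine (abs_add_le _ _).trans ?_
    have := abs_sub (2 * ((g - g') * (√y)⁻¹)) (2 * ((z - g) * ((√x)⁻¹ - (√y)⁻¹)))
    rw [abs_mul 2, abs_mul 2, abs_two] at this
    linarith

lemma abs_sum_inv_sqrt_sub_le {j : ℕ} (hj : 0 < j) :
    |∑ r ∈ Finset.range j, (√((r : ℝ) + 1))⁻¹ - 2 * √j - hurwitzHalf 1| ≤ (√j)⁻¹ := by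
  have hj' : (0 : ℝ) < j := by exact_mod_cast hj
  have hlim := (tendsto_hurwitzHalf' one_pos)
  have hstep : ∀ t : ℝ, 0 < t → (√(t + 1))⁻¹ ≤ 2 * √(t + 1) - 2 * √t ∧
      2 * √(t + 1) - 2 * √t ≤ (√t)⁻¹ := fun t ht => by
    have h1 := Real.sq_sqrt ht.le
    have h2 := Real.sq_sqrt (show 0 ≤ t + 1 by linarith)
    have h3 := Real.sqrt_pos.2 ht
    have h4 := Real.sqrt_le_sqrt (show t ≤ t + 1 by linarith)
    have h5 : 0 < √(t + 1) := by linarith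
    constructor
    · rw [inv_le_iff_one_le_mul₀ h5]; nlinarith
    · rw [← one_div, le_div_iff₀ h3]; nlinarith
  have hb : ∀ n : ℕ, |(∑ r ∈ Finset.range (j + n), (√((r : ℝ) + 1))⁻¹ - 2 * √(j + n : ℕ)) -
      (∑ r ∈ Finset.range j, (√((r : ℝ) + 1))⁻¹ - 2 * √j)| ≤ (√j)⁻¹ := by
    intro n
    rw [Finset.sum_range_add]
    have e := Finset.sum_range_sub (fun k : ℕ => 2 * √((j + k : ℕ) : ℝ)) n
    have e2 := Finset.sum_range_sub (fun k : ℕ => (√((j + k : ℕ) : ℝ))⁻¹) n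
    have u1 : ∑ k ∈ Finset.range n, (√(((j + k : ℕ) : ℝ) + 1))⁻¹ ≤
        ∑ k ∈ Finset.range n, (2 * √((j + (k + 1) : ℕ) : ℝ) - 2 * √((j + k : ℕ) : ℝ)) :=
      Finset.sum_le_sum fun k _ => by
        have := (hstep (j + k : ℕ) (by positivity)).1
        rw [← add_assoc]; push_cast at this ⊢; exact this
    have u2 : ∑ k ∈ Finset.range n, (2 * √((j + (k + 1) : ℕ) : ℝ) - 2 * √((j + k : ℕ) : ℝ)) -
        ∑ k ∈ Finset.range n, (√(((j + k : ℕ) : ℝ) + 1))⁻¹ ≤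
        - ∑ k ∈ Finset.range n, ((√((j + (k + 1) : ℕ) : ℝ))⁻¹ - (√((j + k : ℕ) : ℝ))⁻¹) := by
      rw [← Finset.sum_sub_distrib, ← Finset.sum_neg_distrib]
      refine Finset.sum_le_sum fun k _ => ?_
      have := (hstep (j + k : ℕ) (by positivity)).2
      rw [← add_assoc]; push_cast at this ⊢; linarith
    rw [e] at u1 u2
    rw [e2] at u2
    simp only [add_zero] at u1 u2
    have : (0 : ℝ) ≤ (√((j + n : ℕ) : ℝ))⁻¹ := by positivity
    have : (0 : ℝ) ≤ (√(j : ℝ))⁻¹ := by positivity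
    rw [abs_le]; constructor <;> linarith
  have hT := ((hlim.comp (tendsto_add_atTop_nat j)).sub_const
    (∑ r ∈ Finset.range j, (√((r : ℝ) + 1))⁻¹ - 2 * √j)).abs
  rw [show ∑ r ∈ Finset.range j, (√((r : ℝ) + 1))⁻¹ - 2 * √j - hurwitzHalf 1 =
    -(hurwitzHalf 1 - (∑ r ∈ Finset.range j, (√((r : ℝ) + 1))⁻¹ - 2 * √j)) by ring, abs_neg]
  refine le_of_tendsto hT (Eventually.of_forall fun n => ?_)
  have := hb n
  simpa [add_comm] using this

/-- The constant in the mean square of `ζ(1/2, r/j)`. -/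
noncomputable def diagConst : ℝ := Real.eulerMascheroniConstant - Real.log (8 * Real.pi)

/-- This is `Γ'/Γ(1/2) = -γ - 2 log 2`; it identifies the constant found here with the one in
`mainTerm`. -/
lemma diagConst_eq : diagConst = 2 * Real.eulerMascheroniConstant
    + deriv Real.Gamma (1 / 2) / Real.Gamma (1 / 2) - Real.log (2 * Real.pi) := by
  have hp := Real.sqrt_pos.2 Real.pi_pos
  rw [Real.hasDerivAt_Gamma_one_half.deriv, Real.Gamma_one_half_eq, diagConst,
    show 8 * Real.pi = 2 ^ 2 * (2 * Real.pi) by ring, Real.log_mul (by norm_num) (by positivity),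
    Real.log_pow]
  push_cast
  field_simp
  ring

lemma abs_harmonic_sub_le {j : ℕ} (hj : 0 < j) :
    |∑ r ∈ Finset.range j, ((r : ℝ) + 1)⁻¹ - Real.log j - Real.eulerMascheroniConstant| ≤ 1 / j := by
  have hj' : (0 : ℝ) < j := by exact_mod_cast hj
  have h1 := Real.eulerMascheroniSeq_lt_eulerMascheroniConstant j
  have h2 := Real.eulerMascheroniConstant_lt_eulerMascheroniSeq' j
  have e : (harmonic j : ℝ) = ∑ r ∈ Finset.range j, ((r : ℝ) + 1)⁻¹ := by
    simp [harmonic]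
  rw [Real.eulerMascheroniSeq', if_neg hj.ne', e] at h2
  rw [Real.eulerMascheroniSeq, e] at h1
  have h3 : Real.log (j + 1) - Real.log j ≤ 1 / j := by
    rw [← Real.log_div (by positivity) hj'.ne']
    refine (Real.log_le_sub_one_of_pos (by positivity)).trans (le_of_eq ?_)
    field_simp; ring
  rw [abs_le]; constructor <;> linarith [show (0 : ℝ) < 1 / j by positivity]

/-- At the points `x = (r + 1)/j`, split `ζ² = diagKernel + 1/x + 2 ζ(1) x^{-1/2}`. The second part
is a harmonic sum and gives `j (log j + γ)`. The third gives `4 ζ(1) j + 2 √j ζ(1)²`, whose linear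
term cancels the `-4 ζ(1) j` from the integral of the kernel. -/
lemma exists_abs_shiftedSum_diag_le : ∃ C : ℝ, 0 ≤ C ∧ ∀ j : ℕ, 0 < j →
    |shiftedSum j 0 0 - (j * (Real.log j + diagConst) + 2 * √j * hurwitzHalf 1 ^ 2)| ≤ C := by
  refine ⟨1 + 2 * |hurwitzHalf 1| + 36 * hurwitzBd ^ 2, by positivity, fun j hj => ?_⟩
  have hj' : (0 : ℝ) < j := by exact_mod_cast hj
  have hjs := Real.sqrt_pos.2 hj'
  have hjsq := Real.sq_sqrt hj'.le
  have e0 : shiftedSum j 0 0 = ∑ r ∈ Finset.range j, hurwitzHalf ((r + 1 : ℕ) / j) ^ 2 := by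
    have h := sum_range_add_of_periodic (N := j) (G := fun m : ℤ => periodicZeta (m / j) ^ 2)
      (fun m => by
        rw [periodicZeta_eq_of_sub (x := ((m + (j : ℕ) : ℤ) : ℝ) / j) (y := m / j) 1
          (by push_cast; field_simp; ring)]) 1
    rw [shiftedSum]
    simp only [sub_zero, ← sq]
    refine (Eq.trans ?_ h.symm).trans ?_
    · simp
    · refine Finset.sum_congr rfl fun r hr => ?_
      have : ((r + 1 : ℕ) : ℝ) / j ≤ 1 := by
        rw [div_le_one hj']; exact_mod_cast Finset.mem_range.1 hr
      rw [← periodicZeta_of_mem (by positivity) this]; push_cast; rfl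
  have e1 : ∀ r : ℕ, hurwitzHalf ((r + 1 : ℕ) / j) ^ 2 = diagKernel ((r + 1 : ℕ) / j) +
      j * ((r : ℝ) + 1)⁻¹ + 2 * hurwitzHalf 1 * √j * (√((r : ℝ) + 1))⁻¹ := fun r => by
    rw [diagKernel, Real.sqrt_div (by positivity)]
    push_cast
    field_simp
    ring
  have h1 := incrementBound_diagKernel.abs_sum_sub_integral_le intervalIntegrable_diagKernel.1 hj
  rw [intervalIntegrable_diagKernel.2] at h1
  simp only [Real.sqrt_one, Real.sqrt_zero, mul_zero, sub_zero, mul_one] at h1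
  have h2 := abs_harmonic_sub_le hj
  have h3 := abs_sum_inv_sqrt_sub_le hj
  simp only [e0, e1, Finset.sum_add_distrib, ← Finset.mul_sum]
  set H := ∑ r ∈ Finset.range j, ((r : ℝ) + 1)⁻¹
  set Q := ∑ r ∈ Finset.range j, (√((r : ℝ) + 1))⁻¹
  set KS := ∑ r ∈ Finset.range j, diagKernel ((r + 1 : ℕ) / j)
  set z := hurwitzHalf 1
  have e : KS + j * H + 2 * z * √j * Q - (j * (Real.log j + diagConst) + 2 * √j * z ^ 2) =
      (KS - j * (-Real.log (8 * Real.pi) - 4 * z)) + j * (H - Real.log j - Real.eulerMascheroniConstant)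
      + 2 * z * (√j * (Q - 2 * √j - z)) := by
    rw [diagConst]; linear_combination 4 * z * hjsq
  rw [e]
  have h2' : |j * (H - Real.log j - Real.eulerMascheroniConstant)| ≤ 1 := by
    rw [abs_mul, abs_of_pos hj']
    calc _ ≤ j * (1 / (j : ℝ)) := by gcongr
      _ = 1 := by field_simp
  have h3' : |2 * z * (√j * (Q - 2 * √j - z))| ≤ 2 * |z| := by
    rw [abs_mul, abs_mul 2, abs_two, abs_mul, abs_of_pos hjs]
    have : √j * |Q - 2 * √j - z| ≤ √j * (√j)⁻¹ := by gcongr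
    rw [mul_inv_cancel₀ hjs.ne'] at this
    nlinarith [abs_nonneg z]
  refine (abs_add_le _ _).trans ?_
  have := abs_add_le (KS - j * (-Real.log (8 * Real.pi) - 4 * z))
    (j * (H - Real.log j - Real.eulerMascheroniConstant))
  linarith

end Diagonal

/-! ### Correlations of dilates -/

/-- Normalised correlation of the dilates `ζ(1/2, a r/j)` and `ζ(1/2, b r/j)`. -/
noncomputable def corr (j : ℕ) (a b : ℤ) : ℝ :=
  (√j)⁻¹ * ∑ r ∈ Finset.range j, periodicZeta (a * r / j) * periodicZeta (b * r / j)

lemma corr_comm (j : ℕ) (a b : ℤ) : corr j a b = corr j b a := by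
  simp only [corr, mul_comm]

section Sums

/-- As `h` varies, `ut + fh` sweeps the residues modulo `fe` congruent to `ut` modulo `f`; as `t`
varies, `ut` runs through the classes modulo `f`. -/
lemma sum_range_sum_range_of_periodic {M : Type*} [AddCommMonoid M] {e f : ℕ} {F : ℤ → M}
    (hF : ∀ n, F (n + (f * e : ℕ)) = F n) {u : ℤ} (hu : IsCoprime u f) :
    ∑ t ∈ Finset.range f, ∑ h ∈ Finset.range e, F (u * t + f * h) =
      ∑ b ∈ Finset.range (f * e), F b := by
  have hG : ∀ n : ℤ, ∑ h ∈ Finset.range e, F (n + (f : ℕ) + f * h) =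
      ∑ h ∈ Finset.range e, F (n + f * h) := fun n => by
    have := sum_range_add_of_periodic (N := e) (G := fun m => F (n + f * m)) (fun m => by
      rw [← hF (n + f * m)]; congr 1; push_cast; ring) 1
    rw [← this]
    refine Finset.sum_congr rfl fun h _ => ?_
    congr 1; ring
  have := sum_range_mul_of_periodic (N := f) (G := fun n => ∑ h ∈ Finset.range e, F (n + f * h)) hG hu
  rw [this, sum_range_mul_eq (fun n : ℕ => F n)]
  push_cast; rfl

lemma sum_range_mul_mul_of_periodic {e f : ℕ} (hef : Nat.Coprime e f) {A B : ℤ → ℝ}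
    (hA : ∀ n, A (n + f) = A n) (hB : ∀ n, B (n + e) = B n) :
    ∑ s ∈ Finset.range (f * e), A s * B s =
      (∑ s ∈ Finset.range f, A s) * ∑ s ∈ Finset.range e, B s := by
  have hA' : ∀ n m : ℤ, A (n + m * f) = A n := fun n m => by
    have : Function.Periodic A (f : ℤ) := hA
    exact_mod_cast this.int_mul m n
  have hB' : ∀ n m : ℤ, B (n + m * e) = B n := fun n m => by
    have : Function.Periodic B (e : ℤ) := hB
    exact_mod_cast this.int_mul m n
  have hcop : IsCoprime (e : ℤ) f := Nat.isCoprime_iff_coprime.2 hef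
  rw [← sum_range_sum_range_of_periodic (F := fun s => A s * B s) (fun n => by
    rw [← hA' n e, ← hB' n f]; push_cast; ring_nf) hcop,
    ← sum_range_mul_of_periodic hA hcop, ← sum_range_mul_of_periodic hB hcop.symm, Finset.sum_mul_sum]
  refine Finset.sum_congr rfl fun t _ => Finset.sum_congr rfl fun h _ => ?_
  rw [show (e : ℤ) * t + f * h = e * t + h * f by ring, hA',
    show (e : ℤ) * t + h * f = f * h + t * e by ring, hB']

end Sums

section Bounds

lemma periodicZeta_zero : periodicZeta 0 = hurwitzHalf 1 := by simp [periodicZeta]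

lemma periodic_zmod_div {j : ℕ} (hj : 0 < j) (a n : ℤ) :
    periodicZeta (a * ((n + (j : ℕ) : ℤ) : ℝ) / j) = periodicZeta (a * n / j) := by
  have hj' : (j : ℝ) ≠ 0 := by exact_mod_cast hj.ne'
  exact periodicZeta_eq_of_sub a (by push_cast; field_simp; ring)

lemma sum_periodicZeta_sq_mul {j : ℕ} (hj : 0 < j) {a : ℤ} (ha : IsCoprime a j) :
    ∑ r ∈ Finset.range j, periodicZeta (a * r / j) ^ 2 = shiftedSum j 0 0 := by
  have := sum_range_mul_of_periodic (N := j) (G := fun n : ℤ => periodicZeta (n / j) ^ 2) (fun n => by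
    have := periodic_zmod_div hj 1 n
    simp only [Int.cast_one, one_mul] at this
    rw [this]) ha
  push_cast at this
  rw [this, shiftedSum]
  simp [sq]

/-- By `2|xy| ≤ x² + y²`, since dilation by a unit permutes the residues and so both squares have
the same sum. -/
lemma abs_corr_le {j : ℕ} (hj : 0 < j) {a b : ℤ} (ha : IsCoprime a j) (hb : IsCoprime b j) :
    |corr j a b| ≤ (√j)⁻¹ * shiftedSum j 0 0 := by
  rw [corr, abs_mul, abs_of_nonneg (by positivity)]
  refine mul_le_mul_of_nonneg_left ?_ (by positivity)
  refine (Finset.abs_sum_le_sum_abs _ _).trans ?_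
  calc _ ≤ ∑ r ∈ Finset.range j, (periodicZeta (a * r / j) ^ 2 + periodicZeta (b * r / j) ^ 2) / 2 := by
        refine Finset.sum_le_sum fun r _ => ?_
        rw [abs_mul, ← sq_abs (periodicZeta (a * r / j)), ← sq_abs (periodicZeta (b * r / j))]
        nlinarith [sq_nonneg (|periodicZeta (a * r / j)| - |periodicZeta (b * r / j)|)]
    _ = _ := by
        rw [← Finset.sum_div, Finset.sum_add_distrib, sum_periodicZeta_sq_mul hj ha,
          sum_periodicZeta_sq_mul hj hb]
        ring

lemma exists_abs_corr_le : ∃ C : ℝ, 0 ≤ C ∧ ∀ (j : ℕ) (a b : ℤ), 0 < j → IsCoprime a j →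
    IsCoprime b j → |corr j a b| ≤ C * √j * (1 + Real.log j) := by
  obtain ⟨C, hC, h⟩ := exists_abs_shiftedSum_diag_le
  refine ⟨1 + |diagConst| + 2 * hurwitzHalf 1 ^ 2 + C, by positivity, fun j a b hj ha hb => ?_⟩
  refine (abs_corr_le hj ha hb).trans ?_
  have hj' : (1 : ℝ) ≤ j := by exact_mod_cast hj
  have hs : 1 ≤ √(j : ℝ) := Real.one_le_sqrt.2 hj'
  have hsq := Real.sq_sqrt (show (0 : ℝ) ≤ j by linarith)
  have hl := Real.log_nonneg hj'
  have h1 := (abs_le.1 (h j hj)).2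
  have h2 := le_abs_self diagConst
  have h3 : shiftedSum j 0 0 ≤ (1 + |diagConst| + 2 * hurwitzHalf 1 ^ 2 + C) * j * (1 + Real.log j) := by
    have e1 : j * (Real.log j + diagConst) ≤ j * ((1 + |diagConst|) * (1 + Real.log j)) := by
      gcongr
      nlinarith [abs_nonneg diagConst]
    have e2 : √(j : ℝ) ≤ j * (1 + Real.log j) := by nlinarith
    have e3 : 1 ≤ j * (1 + Real.log j) := by nlinarith
    have e4 := mul_le_mul_of_nonneg_left e2 (show 0 ≤ 2 * hurwitzHalf 1 ^ 2 by positivity)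
    have e5 := mul_le_mul_of_nonneg_left e3 hC
    linarith
  rw [← div_eq_inv_mul, div_le_iff₀ (by linarith)]
  refine h3.trans (le_of_eq ?_)
  nth_rewrite 1 [← hsq]; ring

end Bounds

/-! ### The reciprocity law -/

section Reciprocity

/-- The deviation of `shiftedSum` from the contribution of its singularities. -/
noncomputable def shiftedDev (j : ℕ) (α β : ℝ) : ℝ := shiftedSum j α β - √j * shiftedSing j α β

variable {e f j : ℕ}

/-- For fixed `r` the double sum factors, and the distribution relation turns the two factors into
dilates by `e` and by `f`. -/
lemma sum_shiftedSum (he : 0 < e) (hf : 0 < f) (hj : 0 < j) :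
    ∑ p ∈ Finset.range e ×ˢ Finset.range f, shiftedSum j (-(p.1 / e : ℝ)) (-(p.2 / f : ℝ)) =
      √e * √f * √j * corr j e f := by
  have hj' : (√j : ℝ) ≠ 0 := (Real.sqrt_pos.2 (by exact_mod_cast hj)).ne'
  simp only [shiftedSum, sub_neg_eq_add]
  rw [Finset.sum_comm]
  have : ∀ r ∈ Finset.range j, ∑ p ∈ Finset.range e ×ˢ Finset.range f,
      periodicZeta ((r : ℝ) / j + p.1 / e) * periodicZeta ((r : ℝ) / j + p.2 / f) =
      √e * √f * (periodicZeta (e * r / j) * periodicZeta (f * r / j)) := fun r _ => by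
    rw [Finset.sum_product]
    simp only
    rw [← Finset.sum_mul_sum, periodicZeta_distribution _ he, periodicZeta_distribution _ hf,
      mul_div_assoc, mul_div_assoc]
    ring
  rw [Finset.sum_congr rfl this, ← Finset.mul_sum, corr]
  simp only [Int.cast_natCast]
  rw [mul_assoc (√(e : ℝ) * √f), mul_inv_cancel_left₀ hj']

/-- The sum over `t` is a distribution sum. What remains is a correlation modulo `e` of the dilates
by `j` and `-f`, and `h ↦ -h` moves the sign to `j`. This is where the dual correlations arise. -/
lemma sum_periodicZeta_mul_sum (he : 0 < e) (hf : 0 < f) :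
    ∑ h ∈ Finset.range e, ∑ t ∈ Finset.range f,
      periodicZeta (j * (h / e)) * periodicZeta (t / f - h / e) = √e * √f * corr e f (-j) := by
  have he' : (√e : ℝ) ≠ 0 := (Real.sqrt_pos.2 (by exact_mod_cast he)).ne'
  have : ∀ h ∈ Finset.range e, ∑ t ∈ Finset.range f,
      periodicZeta (j * (h / e)) * periodicZeta (t / f - h / e) =
      √f * (periodicZeta ((j : ℤ) * h / e) * periodicZeta (((-f : ℤ) : ℝ) * h / e)) := fun h _ => by
    rw [← Finset.mul_sum]
    have := periodicZeta_distribution (-(h / e : ℝ)) hf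
    simp only [neg_add_eq_sub] at this
    rw [this]; push_cast
    ring_nf
  rw [Finset.sum_congr rfl this, ← Finset.mul_sum, corr]
  have := sum_range_neg_of_periodic (N := e) (G := fun n : ℤ => periodicZeta ((f : ℤ) * n / e) *
    periodicZeta (((-j : ℤ) : ℝ) * n / e)) (fun n => by
      rw [periodic_zmod_div he f n, periodic_zmod_div he (-j) n])
  push_cast at this ⊢
  rw [← this]
  simp only [mul_neg, neg_mul, neg_neg]
  field_simp
  simp only [mul_comm]

lemma sum_shiftedSing (he : 0 < e) (hf : 0 < f) :
    ∑ p ∈ Finset.range e ×ˢ Finset.range f, shiftedSing j (-(p.1 / e : ℝ)) (-(p.2 / f : ℝ)) =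
      √e * √f * (corr e f (-j) + corr f e (-j)) := by
  simp only [shiftedSing, mul_neg, neg_neg, neg_add_eq_sub, Finset.sum_add_distrib, sub_neg_eq_add]
  rw [mul_add, ← sum_periodicZeta_mul_sum he hf, mul_comm √(e : ℝ),
    ← sum_periodicZeta_mul_sum (j := j) hf he, Finset.sum_product, Finset.sum_product_right]

lemma sum_shiftedDev (he : 0 < e) (hf : 0 < f) (hj : 0 < j) :
    ∑ p ∈ Finset.range e ×ˢ Finset.range f, shiftedDev j (-(p.1 / e : ℝ)) (-(p.2 / f : ℝ)) =
      √e * √f * √j * (corr j e f - corr e f (-j) - corr f e (-j)) := by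
  simp only [shiftedDev, Finset.sum_sub_distrib, ← Finset.mul_sum]
  rw [sum_shiftedSum he hf hj, sum_shiftedSing he hf]
  ring

/-- One factor is constantly `ζ(1)`; the other is summed by the distribution relation at 0. -/
lemma corr_of_dvd (he : 0 < e) {a b : ℤ} (ha : IsCoprime a e) (hb : (e : ℤ) ∣ b) :
    corr e a b = hurwitzHalf 1 ^ 2 := by
  have he' : (0 : ℝ) < e := by exact_mod_cast he
  have hs : (√e : ℝ) ≠ 0 := (Real.sqrt_pos.2 he').ne'
  obtain ⟨c, rfl⟩ := hb
  have h1 : ∀ r : ℕ, periodicZeta (((e * c : ℤ) : ℝ) * r / e) = hurwitzHalf 1 := fun r => by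
    rw [← periodicZeta_zero]
    exact periodicZeta_eq_of_sub (c * r) (by push_cast; field_simp; ring)
  have h2 := sum_range_mul_of_periodic (N := e) (G := fun n : ℤ => periodicZeta (n / e)) (fun n => by
    have := periodic_zmod_div he 1 n
    simpa using this) ha
  have h3 := periodicZeta_distribution 0 he
  simp only [zero_add, mul_zero, periodicZeta_zero] at h3
  push_cast at h2
  rw [corr]
  simp only [h1]
  rw [← Finset.sum_mul, h2, h3]
  field_simp

/-- Write a residue modulo `efj` as `r + js`. One factor then depends on `s` modulo `f` only and the
other on `s` modulo `e` only. By coprimality the sum over `s` factors into two distribution sums,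
each a multiple of `ζ(r/j)`. -/
lemma corr_mul (he : 0 < e) (hf : 0 < f) (hj : 0 < j) (hef : Nat.Coprime e f) :
    √(e * f * j : ℕ) * corr (e * f * j) e f = √e * √f * shiftedSum j 0 0 := by
  have he' : (0 : ℝ) < e := by exact_mod_cast he
  have hf' : (0 : ℝ) < f := by exact_mod_cast hf
  have hj' : (0 : ℝ) < j := by exact_mod_cast hj
  have hs : √(e * f * j : ℕ) ≠ 0 := (Real.sqrt_pos.2 (by positivity)).ne'
  rw [corr, mul_inv_cancel_left₀ hs, show e * f * j = j * (f * e) by ring, sum_range_mul_eq,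
    shiftedSum, Finset.mul_sum]
  refine Finset.sum_congr rfl fun r _ => ?_
  have h1 := sum_range_mul_mul_of_periodic hef
    (A := fun s : ℤ => periodicZeta (r / (f * j) + s / f)) (B := fun s : ℤ => periodicZeta (r / (e * j) + s / e))
    (fun n => periodicZeta_eq_of_sub 1 (by push_cast; field_simp; ring))
    (fun n => periodicZeta_eq_of_sub 1 (by push_cast; field_simp; ring))
  push_cast at h1
  rw [periodicZeta_distribution _ hf, periodicZeta_distribution _ he] at h1
  have e1 : (f : ℝ) * (r / (f * j)) = r / j := by field_simp
  have e2 : (e : ℝ) * (r / (e * j)) = r / j := by field_simp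
  rw [e1, e2] at h1
  rw [sub_zero]
  calc _ = ∑ s ∈ Finset.range (f * e), periodicZeta (r / (f * j) + s / f) *
        periodicZeta (r / (e * j) + s / e) := by
        refine Finset.sum_congr rfl fun s _ => ?_
        congr 2 <;> (push_cast; field_simp)
    _ = _ := by rw [h1]; ring

/-- The bound for the oscillation of `shiftedDev` at the fraction `b / N`. -/
noncomputable def fracBound (N : ℕ) (b : ℤ) : ℝ :=
  1 / Int.fract ((b : ℝ) / N) + 1 / (1 - Int.fract ((b : ℝ) / N))

lemma sum_fracBound_le {N : ℕ} (hN : 0 < N) :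
    ∑ b ∈ Finset.range N, fracBound N b ≤ 1 + 2 * N * (1 + Real.log N) := by
  have hN' : (0 : ℝ) < N := by exact_mod_cast hN
  obtain ⟨n, rfl⟩ : ∃ n, N = n + 1 := ⟨N - 1, by omega⟩
  rw [Finset.sum_range_succ']
  -- Since `1 / 0 = 0`, the residue `b = 0` contributes just 1.
  have h0 : fracBound (n + 1) (0 : ℕ) = 1 := by simp [fracBound]
  have hb : ∀ k ∈ Finset.range n, fracBound (n + 1) ((k + 1 : ℕ) : ℤ) =
      (n + 1 : ℕ) * (((k : ℝ) + 1)⁻¹ + (((n - 1 - k : ℕ) : ℝ) + 1)⁻¹) := fun k hk => by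
    have hk' := Finset.mem_range.1 hk
    have hlt : ((k + 1 : ℕ) : ℝ) < (n + 1 : ℕ) := by exact_mod_cast (by omega : k + 1 < n + 1)
    have hfr : Int.fract ((((k + 1 : ℕ) : ℤ) : ℝ) / (n + 1 : ℕ)) = ((k + 1 : ℕ) : ℝ) / (n + 1 : ℕ) := by
      rw [Int.cast_natCast, Int.fract_eq_self]
      exact ⟨by positivity, by rwa [div_lt_one hN']⟩
    have h2 : ((n - 1 - k : ℕ) : ℝ) + 1 = (n + 1 : ℕ) - (k + 1 : ℕ) := by
      have : n - 1 - k + 1 + (k + 1) = n + 1 := by omega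
      have : ((n - 1 - k : ℕ) : ℝ) + 1 + ((k + 1 : ℕ) : ℝ) = (n + 1 : ℕ) := by exact_mod_cast this
      linarith
    have h3 : ((n + 1 : ℕ) : ℝ) - (k + 1 : ℕ) ≠ 0 := by linarith
    rw [fracBound, hfr, h2, mul_add]
    congr 1
    · push_cast; field_simp
    · rw [one_sub_div hN'.ne', one_div, inv_div, div_eq_mul_inv]
  rw [h0, Finset.sum_congr rfl hb, ← Finset.mul_sum, Finset.sum_add_distrib,
    Finset.sum_range_reflect (fun k : ℕ => ((k : ℝ) + 1)⁻¹) n]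
  have h4 : ∑ k ∈ Finset.range n, ((k : ℝ) + 1)⁻¹ ≤ 1 + Real.log (n + 1 : ℕ) := by
    have := harmonic_le_one_add_log n
    have e : (harmonic n : ℝ) = ∑ r ∈ Finset.range n, ((r : ℝ) + 1)⁻¹ := by simp [harmonic]
    rw [e] at this
    refine this.trans ?_
    rcases Nat.eq_zero_or_pos n with rfl | hn
    · simp
    · gcongr; omega
  have := mul_le_mul_of_nonneg_left h4 hN'.le
  linarith

lemma fracBound_add (hN : 0 < e) (b : ℤ) : fracBound e (b + e) = fracBound e b := by
  have hN' : (e : ℝ) ≠ 0 := by exact_mod_cast hN.ne'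
  rw [fracBound, fracBound]
  have : (((b + (e : ℕ) : ℤ) : ℝ) / e) = b / e + (1 : ℤ) := by push_cast; field_simp
  rw [this, Int.fract_add_intCast]

lemma abs_shiftedDev_sub_le (he : 0 < e) (hf : 0 < f) (hef : Nat.Coprime e f) (hj : 0 < j)
    {M : ℕ} (hM : 0 < M) {h t : ℕ} (hh : h < e) (ht : t < f) (h0 : (h, t) ≠ (0, 0)) :
    |M * shiftedDev j (-(h / e : ℝ)) (-(t / f : ℝ)) -
      shiftedDev (j * M) (-(h / e : ℝ)) (-(t / f : ℝ))| ≤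
      M * (40 * hurwitzBd ^ 2 * fracBound (f * e) (-e * t + f * h)) := by
  have he' : (0 : ℝ) < e := by exact_mod_cast he
  have hf' : (0 : ℝ) < f := by exact_mod_cast hf
  set b : ℤ := -e * t + f * h with hb
  have hdiv : -(t / f : ℝ) - -(h / e : ℝ) = (b : ℝ) / (f * e : ℕ) := by
    rw [hb]; push_cast; field_simp; ring
  -- If `h/e - t/f` were an integer, coprimality would force `e ∣ h` and `f ∣ t`, hence `(h, t) =
  -- (0, 0)`.
  have hpos : 0 < Int.fract ((b : ℝ) / (f * e : ℕ)) := by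
    refine lt_of_le_of_ne (Int.fract_nonneg _) fun hcon => ?_
    obtain ⟨m, hm⟩ := Int.fract_eq_zero_iff.1 hcon.symm
    rw [eq_div_iff (by positivity)] at hm
    have hm' : m * ((f * e : ℕ) : ℤ) = b := by exact_mod_cast hm
    have hcop : IsCoprime (e : ℤ) f := Nat.isCoprime_iff_coprime.2 hef
    have d1 : (e : ℤ) ∣ h := by
      refine hcop.dvd_of_dvd_mul_left (show (e : ℤ) ∣ f * h from ?_)
      exact ⟨m * f + t, by push_cast at hm'; linarith⟩
    have d2 : (f : ℤ) ∣ t := by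
      refine hcop.symm.dvd_of_dvd_mul_left (show (f : ℤ) ∣ e * t from ?_)
      exact ⟨h - m * e, by push_cast at hm'; linarith⟩
    have z1 := Nat.eq_zero_of_dvd_of_lt (Int.natCast_dvd_natCast.1 d1) hh
    have z2 := Nat.eq_zero_of_dvd_of_lt (Int.natCast_dvd_natCast.1 d2) ht
    exact h0 (by rw [z1, z2])
  exact shiftedSum_sub_le' hpos (Int.fract_lt_one _) ⌊(b : ℝ) / (f * e : ℕ)⌋
    (by rw [hdiv, Int.fract_add_floor]) hj hM

lemma fracBound_nonneg (N : ℕ) (b : ℤ) : 0 ≤ fracBound N b := by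
  have h1 := Int.fract_nonneg ((b : ℝ) / N)
  have h2 := Int.fract_lt_one ((b : ℝ) / N)
  have h3 : 0 < 1 - Int.fract ((b : ℝ) / N) := by linarith
  unfold fracBound
  positivity

/-- The differences of the shifts run through all fractions `b/(ef)` by the Chinese remainder
theorem. Summing the bound, reciprocal in the distance to the nearest integer, therefore costs only
a logarithm. -/
lemma abs_sum_shiftedDev_sub_le (he : 0 < e) (hf : 0 < f) (hef : Nat.Coprime e f) (hj : 0 < j)
    {M : ℕ} (hM : 0 < M) :
    |M * ∑ p ∈ (Finset.range e ×ˢ Finset.range f).erase (0, 0), shiftedDev j (-(p.1 / e : ℝ)) (-(p.2 / f : ℝ))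
      - ∑ p ∈ (Finset.range e ×ˢ Finset.range f).erase (0, 0), shiftedDev (j * M) (-(p.1 / e : ℝ)) (-(p.2 / f : ℝ))|
      ≤ M * (40 * hurwitzBd ^ 2 * (1 + 2 * (e * f : ℕ) * (1 + Real.log (e * f : ℕ)))) := by
  rw [Finset.mul_sum, ← Finset.sum_sub_distrib]
  refine (Finset.abs_sum_le_sum_abs _ _).trans ?_
  calc _ ≤ ∑ p ∈ (Finset.range e ×ˢ Finset.range f).erase (0, 0),
        M * (40 * hurwitzBd ^ 2 * fracBound (f * e) (-e * p.2 + f * p.1)) := by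
        refine Finset.sum_le_sum fun p hp => ?_
        obtain ⟨h1, h2⟩ := Finset.mem_erase.1 hp
        obtain ⟨h3, h4⟩ := Finset.mem_product.1 h2
        exact abs_shiftedDev_sub_le he hf hef hj hM (Finset.mem_range.1 h3) (Finset.mem_range.1 h4) h1
    _ ≤ ∑ p ∈ Finset.range e ×ˢ Finset.range f,
        M * (40 * hurwitzBd ^ 2 * fracBound (f * e) (-e * p.2 + f * p.1)) := by
        refine Finset.sum_le_sum_of_subset_of_nonneg (Finset.erase_subset _ _) fun p _ _ => ?_
        have := fracBound_nonneg (f * e) (-e * p.2 + f * p.1)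
        positivity
    _ = M * (40 * hurwitzBd ^ 2 * ∑ b ∈ Finset.range (f * e), fracBound (f * e) b) := by
        rw [← Finset.mul_sum, ← Finset.mul_sum, Finset.sum_product_right]
        congr 2
        refine sum_range_sum_range_of_periodic (fracBound_add (Nat.mul_pos hf he)) ?_
        exact (Nat.isCoprime_iff_coprime.2 hef).neg_left
    _ ≤ _ := by
        rw [mul_comm e f]
        gcongr
        exact sum_fracBound_le (Nat.mul_pos hf he)

/-- A reciprocity law for correlations. -/
theorem exists_abs_corr_sub_le : ∃ C : ℝ, 0 ≤ C ∧ ∀ e f j : ℕ, 0 < e → 0 < f → 0 < j →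
    Nat.Coprime e f →
    |corr j e f - √(j / (e * f)) * (Real.log (j / (e * f)) + diagConst) - corr e f (-j) - corr f e (-j)|
      ≤ C * √(e * f / j) * (1 + Real.log (e * f)) := by
  obtain ⟨C, hC, hdiag⟩ := exists_abs_shiftedSum_diag_le
  refine ⟨120 * hurwitzBd ^ 2 + 3 * C, by positivity, fun e f j he hf hj hef => ?_⟩
  have he' : (0 : ℝ) < e := by exact_mod_cast he
  have hf' : (0 : ℝ) < f := by exact_mod_cast hf
  have hj' : (0 : ℝ) < j := by exact_mod_cast hj
  set N := e * f with hN
  have hNpos : 0 < N := Nat.mul_pos he hf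
  have hN' : (0 : ℝ) < N := by exact_mod_cast hNpos
  have hN1 : (1 : ℝ) ≤ N := by exact_mod_cast hNpos
  have hNe : (N : ℝ) = e * f := by rw [hN]; push_cast; ring
  have hl : 0 ≤ Real.log N := Real.log_nonneg hN1
  have hmem : ((0 : ℕ), (0 : ℕ)) ∈ Finset.range e ×ˢ Finset.range f := by simp [he, hf]
  set S : ℕ → ℝ := fun j => ∑ p ∈ (Finset.range e ×ˢ Finset.range f).erase (0, 0),
    shiftedDev j (-(p.1 / e : ℝ)) (-(p.2 / f : ℝ)) with hS
  have hD0 : ∀ i, shiftedDev i 0 0 = shiftedSum i 0 0 - 2 * √i * hurwitzHalf 1 ^ 2 := fun i => by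
    rw [shiftedDev, shiftedSing]; simp [periodicZeta_zero]; ring
  have hsplit : ∀ i : ℕ, 0 < i → √e * √f * √i * (corr i e f - corr e f (-i) - corr f e (-i)) =
      shiftedDev i 0 0 + S i := fun i hi => by
    rw [← sum_shiftedDev he hf hi, ← Finset.add_sum_erase _ _ hmem]
    simp [hS]
  have hmain := abs_sum_shiftedDev_sub_le he hf hef hj hNpos
  change |N * S j - S (j * N)| ≤ _ at hmain
  -- At level `jN` all three correlations are explicit, by `corr_mul` and `corr_of_dvd`.
  have hSN : S (j * N) = N * shiftedDev j 0 0 - shiftedDev (j * N) 0 0 := by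
    have h := hsplit (j * N) (Nat.mul_pos hj hNpos)
    have h1 := corr_mul he hf hj hef
    rw [← hN, mul_comm N j] at h1
    have dv1 : (e : ℤ) ∣ (-(j * N : ℕ) : ℤ) := ⟨-(j * f), by rw [hN]; push_cast; ring⟩
    have dv2 : (f : ℤ) ∣ (-(j * N : ℕ) : ℤ) := ⟨-(j * e), by rw [hN]; push_cast; ring⟩
    have hcop : IsCoprime (e : ℤ) f := Nat.isCoprime_iff_coprime.2 hef
    rw [corr_of_dvd he hcop.symm dv1, corr_of_dvd hf hcop dv2] at h
    have hsq : √(e : ℝ) * √f * (√e * √f) = N := by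
      rw [hNe, mul_mul_mul_comm, Real.mul_self_sqrt he'.le, Real.mul_self_sqrt hf'.le]
    have hsj : √(j * N : ℕ) = √j * (√e * √f) := by
      rw [← Real.sqrt_mul he'.le, ← hNe, ← Real.sqrt_mul hj'.le]; push_cast; rfl
    have : S (j * N) = √e * √f * (√e * √f * shiftedSum j 0 0) -
        √e * √f * √(j * N : ℕ) * (2 * hurwitzHalf 1 ^ 2) - shiftedDev (j * N) 0 0 := by
      rw [← h1]; linear_combination -h
    rw [this, hD0 j, hsj]
    linear_combination (shiftedSum j 0 0 - 2 * √j * hurwitzHalf 1 ^ 2) * hsq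
  have hdj := hdiag j hj
  have hdJ := hdiag (j * N) (Nat.mul_pos hj hNpos)
  have e1 : shiftedSum j 0 0 - (j * (Real.log j + diagConst) + 2 * √j * hurwitzHalf 1 ^ 2) =
    shiftedDev j 0 0 - j * (Real.log j + diagConst) := by rw [hD0]; ring
  have e2 : shiftedSum (j * N) 0 0 - ((j * N : ℕ) * (Real.log (j * N : ℕ) + diagConst)
      + 2 * √(j * N : ℕ) * hurwitzHalf 1 ^ 2) =
      shiftedDev (j * N) 0 0 - (j * N) * (Real.log j + Real.log N + diagConst) := by
    rw [hD0]; push_cast; rw [Real.log_mul hj'.ne' hN'.ne']; ring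
  rw [e1] at hdj
  rw [e2] at hdJ
  rw [hSN] at hmain
  set d := shiftedDev j 0 0
  set dJ := shiftedDev (j * N) 0 0
  set B := 40 * hurwitzBd ^ 2 * (1 + 2 * (N : ℝ) * (1 + Real.log N))
  have hfin : |d + S j - j * (Real.log j - Real.log N + diagConst)| ≤ B + 3 * C := by
    -- Up to bounded errors `d + S j` is `2d - dJ/N`: subtracting `log j + log N` from `2 log j` is
    -- what produces `log (j / N)`.
    have hx : N * (d + S j - j * (Real.log j - Real.log N + diagConst)) =
        (N * S j - (N * d - dJ)) - (dJ - (j * N) * (Real.log j + Real.log N + diagConst))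
        + 2 * N * (d - j * (Real.log j + diagConst)) := by ring
    have h3 : |N * (d + S j - j * (Real.log j - Real.log N + diagConst))| ≤ N * (B + 3 * C) := by
      rw [hx]
      have a1 := abs_add_le ((N * S j - (N * d - dJ)) -
        (dJ - (j * N) * (Real.log j + Real.log N + diagConst))) (2 * N * (d - j * (Real.log j + diagConst)))
      have a2 := abs_sub (N * S j - (N * d - dJ)) (dJ - (j * N) * (Real.log j + Real.log N + diagConst))
      have a3 : |2 * N * (d - j * (Real.log j + diagConst))| ≤ 2 * N * C := by
        rw [abs_mul, abs_of_pos (by positivity)]; gcongr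
      have a4 : C ≤ N * C := by nlinarith
      linarith
    rw [abs_mul, abs_of_pos hN'] at h3
    exact le_of_mul_le_mul_left h3 hN'
  rw [← hsplit j hj] at hfin
  have hsj := Real.sqrt_pos.2 hj'
  have hsN := Real.sqrt_pos.2 hN'
  have hs2 : √(e : ℝ) * √f = √N := by rw [← Real.sqrt_mul he'.le, ← hNe]
  rw [hs2] at hfin
  rw [← hNe, Real.log_div hj'.ne' hN'.ne', Real.sqrt_div hj'.le, Real.sqrt_div hN'.le]
  have hjj := Real.mul_self_sqrt hj'.le
  have hNN := Real.mul_self_sqrt hN'.le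
  refine le_of_mul_le_mul_left ?_ (mul_pos hsN hsj)
  rw [← abs_of_pos (mul_pos hsN hsj), ← abs_mul, abs_of_pos (mul_pos hsN hsj)]
  calc _ = |√N * √j * (corr j e f - corr e f (-j) - corr f e (-j)) -
        j * (Real.log j - Real.log N + diagConst)| := by
        congr 1
        have : √(N : ℝ) * √j * (√j / √N * (Real.log j - Real.log N + diagConst)) =
            j * (Real.log j - Real.log N + diagConst) := by
          field_simp
          rw [sq, hjj]
          ring
        rw [← this]; ring
    _ ≤ B + 3 * C := hfin
    _ ≤ (120 * hurwitzBd ^ 2 + 3 * C) * (N * (1 + Real.log N)) := by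
        have h1 : 1 ≤ N * (1 + Real.log N) := by nlinarith
        have := mul_le_mul_of_nonneg_left h1 (show 0 ≤ 40 * hurwitzBd ^ 2 + 3 * C by positivity)
        simp only [B]; linarith
    _ = _ := by
        field_simp
        rw [Real.sq_sqrt hN'.le]

end Reciprocity

/-! ### Characters, Gauss sums and the central functional equation -/

section Characters

open DirichletCharacter

variable {m q : ℕ}

/-- `cas (2πx/m)` as a function on residues. -/
noncomputable def casMod (x : ZMod m) : ℝ := casFun (2 * Real.pi * (x.val / m))

lemma casMod_intCast [NeZero m] (n : ℤ) : casMod (n : ZMod m) = casFun (2 * Real.pi * (n / m)) := by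
  have hm : (m : ℝ) ≠ 0 := by exact_mod_cast NeZero.ne m
  obtain ⟨c, hc⟩ : (m : ℤ) ∣ ((n : ZMod m).val : ℤ) - n := by
    rw [← ZMod.intCast_eq_intCast_iff_dvd_sub]; simp
  refine casFun_eq_of_sub c ?_
  have : (((n : ZMod m).val : ℤ) : ℝ) - n = m * c := by exact_mod_cast hc
  rw [Int.cast_natCast] at this
  rw [← sub_div, this]; field_simp

lemma ofReal_casMod [NeZero m] (x : ZMod m) : (casMod x : ℂ) =
    (1 - Complex.I) / 2 * ZMod.stdAddChar x + (1 + Complex.I) / 2 * ZMod.stdAddChar (-x) := by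
  obtain ⟨n, rfl⟩ := ZMod.intCast_surjective x
  have e1 : (2 * Real.pi * Complex.I * n / m : ℂ) = ((2 * Real.pi * (n / m) : ℝ) : ℂ) * Complex.I := by
    push_cast; ring
  have e2 : (2 * Real.pi * Complex.I * (-n : ℤ) / m : ℂ) =
      ((-(2 * Real.pi * (n / m)) : ℝ) : ℂ) * Complex.I := by push_cast; ring
  rw [casMod_intCast, ← Int.cast_neg, ZMod.stdAddChar_coe, ZMod.stdAddChar_coe, e1, e2,
    Complex.exp_mul_I, Complex.exp_mul_I, casFun, Complex.ofReal_neg, Complex.cos_neg, Complex.sin_neg,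
    Complex.ofReal_add, Complex.ofReal_cos, Complex.ofReal_sin]
  linear_combination (Complex.sin ((2 * Real.pi * (n / m) : ℝ) : ℂ)) * Complex.I_sq

lemma sum_mul_casMod [NeZero m] (ψ : DirichletCharacter ℂ m) (a : ZMod m) :
    ∑ x : ZMod m, ψ x * casMod (a * x) =
      ((1 - Complex.I) / 2 + ψ (-1) * ((1 + Complex.I) / 2)) *
        gaussSum ψ ((ZMod.stdAddChar (N := m)).mulShift a) := by
  have h1 : ∑ x : ZMod m, ψ x * ZMod.stdAddChar (-(a * x)) =
      ψ (-1) * gaussSum ψ ((ZMod.stdAddChar (N := m)).mulShift a) := by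
    rw [gaussSum, Finset.mul_sum, ← Equiv.sum_comp (Equiv.neg (ZMod m))]
    refine Finset.sum_congr rfl fun x _ => ?_
    rw [AddChar.mulShift_apply, ← mul_assoc, ← map_mul]
    simp
  simp only [ofReal_casMod, mul_add, Finset.sum_add_distrib]
  rw [add_mul, mul_right_comm, ← h1, gaussSum, Finset.mul_sum, Finset.sum_mul]
  simp only [AddChar.mulShift_apply]
  congr 1 <;> exact Finset.sum_congr rfl fun x _ => by ring

/-- The factor `(1 - i)/2 + ψ(-1)(1 + i)/2` is 1 for even and `-i` for odd characters. Hence both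
parities are covered by one Gauss sum formed with the real kernel `cas`. -/
lemma parityFactor_mul_gaussTau [NeZero m] (ψ : DirichletCharacter ℂ m) :
    parityFactor ψ * gaussTau ψ⁻¹ = ∑ x : ZMod m, ψ⁻¹ x * casMod x := by
  have h := sum_mul_casMod ψ⁻¹ 1
  simp only [one_mul, AddChar.mulShift_one] at h
  rw [h, gaussTau]
  congr 1
  have hinv : ψ⁻¹ (-1) * ψ (-1) = 1 := by
    rw [← MulChar.mul_apply, inv_mul_cancel, MulChar.one_apply (isUnit_one.neg)]
  rw [parityFactor]
  rcases ψ.even_or_odd with he | ho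
  · have he' : ψ (-1) = 1 := he
    rw [if_neg he.not_odd]
    rw [he', mul_one] at hinv
    rw [hinv]; ring
  · have ho' : ψ (-1) = -1 := ho
    rw [if_pos ho]
    have : ψ⁻¹ (-1) = -1 := by rw [ho'] at hinv; linear_combination -hinv
    rw [this]; ring

lemma sum_inv_apply_mul_apply [NeZero m] (x : ZMod m) {b : ZMod m} (hb : IsUnit b) :
    ∑ ψ : DirichletCharacter ℂ m, ψ⁻¹ x * ψ b = if x = b then (m.totient : ℂ) else 0 := by
  rw [← Equiv.sum_comp (Equiv.inv (DirichletCharacter ℂ m))]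
  have h := sum_char_inv_mul_char_eq ℂ hb x
  simp only [eq_comm (a := b)] at h
  rw [← h]
  refine Finset.sum_congr rfl fun χ _ => ?_
  have h1 : χ⁻¹ b * χ b = 1 := by
    rw [← MulChar.mul_apply, inv_mul_cancel, MulChar.one_apply hb]
  have h2 : χ b⁻¹ * χ b = 1 := by
    rw [← map_mul, ZMod.inv_mul_of_unit b hb, map_one]
  have h3 : χ b ≠ 0 := fun h0 => by rw [h0, mul_zero] at h2; exact zero_ne_one h2
  have h4 : χ⁻¹ b = χ b⁻¹ := mul_right_cancel₀ h3 (h1.trans h2.symm)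
  simp only [Equiv.inv_apply, inv_inv, h4, mul_comm]

/-- The residues `0 ≤ a < q` prime to `q`. -/
def coprimeRange (q : ℕ) : Finset ℕ := (Finset.range q).filter fun a => Nat.Coprime a q

lemma isUnit_cast_of_mem (h : m ∣ q) {a : ℕ} (ha : a ∈ coprimeRange q) : IsUnit (a : ZMod m) :=
  (ZMod.isUnit_iff_coprime a m).2 (Nat.Coprime.coprime_dvd_right h (Finset.mem_filter.1 ha).2)

lemma sum_changeLevel [NeZero q] (h : m ∣ q) (ψ : DirichletCharacter ℂ m) (F : ZMod q → ℂ) :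
    ∑ a : ZMod q, changeLevel h ψ a * F a = ∑ a ∈ coprimeRange q, ψ (a : ZMod m) * F a := by
  rw [← sum_range_eq_sum_zmod, coprimeRange, Finset.sum_filter]
  refine Finset.sum_congr rfl fun a _ => ?_
  split_ifs with ha
  · have := changeLevel_eq_cast_of_dvd' ψ h (a := (a : ℤ)) (Nat.isCoprime_iff_coprime.2 ha)
    rw [Int.cast_natCast, Int.cast_natCast] at this
    rw [this]
  · rw [MulChar.map_nonunit, zero_mul]
    rwa [ZMod.isUnit_iff_coprime]

lemma LFunction_half [NeZero q] (χ : DirichletCharacter ℂ q) :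
    LFunction χ (1 / 2) = ((√q)⁻¹ : ℝ) * ∑ a : ZMod q, χ a * periodicZeta (a.val / q) := by
  have hN : (q : ℂ) ^ (-(1 / 2) : ℂ) = (((√q)⁻¹ : ℝ) : ℂ) := by
    have := ofReal_cpow_neg_half (t := (q : ℝ)) (Nat.cast_nonneg q)
    exact_mod_cast this
  rw [DirichletCharacter.LFunction, ZMod.LFunction, hN]
  congr 1
  refine Finset.sum_congr rfl fun a _ => ?_
  have := periodicZeta_toAddCircle (N := q) (a.val : ℤ)
  rw [Int.cast_natCast, ZMod.natCast_zmod_val] at this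
  rw [this, Int.cast_natCast]

lemma LFunction_changeLevel_half [NeZero q] (h : m ∣ q) (ψ : DirichletCharacter ℂ m) :
    LFunction (changeLevel h ψ) (1 / 2) =
      ((√q)⁻¹ : ℝ) * ∑ a ∈ coprimeRange q, ψ (a : ZMod m) * periodicZeta (a / q) := by
  rw [LFunction_half, sum_changeLevel h ψ fun a => periodicZeta (a.val / q)]
  congr 1
  refine Finset.sum_congr rfl fun a ha => ?_
  rw [ZMod.val_natCast_of_lt (Finset.mem_range.1 (Finset.mem_filter.1 ha).1)]

/-- The second moment of `ζ(1/2, a/q)` over residues prime to `q`, twisted by `cas (2πh·/k)`. -/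
noncomputable def twistedMoment (q k : ℕ) (h : ℤ) : ℝ :=
  (q : ℝ)⁻¹ * ∑ a ∈ coprimeRange q, ∑ b ∈ coprimeRange q,
    periodicZeta (a / q) * periodicZeta (b / q) * casFun (2 * Real.pi * (h * a * b / k))

lemma ofReal_sqrt_inv_sq : (((√q)⁻¹ : ℝ) : ℂ) ^ 2 = ((q : ℝ)⁻¹ : ℝ) := by
  rw [← Complex.ofReal_pow, inv_pow, Real.sq_sqrt (Nat.cast_nonneg q)]

/-- Open the square of `L` as a double sum over `a, b` and apply orthogonality modulo `m`, which
selects `G x = ab`. -/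
lemma sum_characters_sq [NeZero m] [NeZero q] (h : m ∣ q) (F : ℕ → ℂ) (s : Finset ℕ) (G : ℕ → ZMod m) :
    ∑ ψ : DirichletCharacter ℂ m, (∑ x ∈ s, ψ⁻¹ (G x) * F x) *
      LFunction (changeLevel h ψ) (1 / 2) ^ 2 =
    m.totient * ((q : ℝ)⁻¹ : ℝ) * ∑ a ∈ coprimeRange q, ∑ b ∈ coprimeRange q,
      ((periodicZeta (a / q) * periodicZeta (b / q) : ℝ) : ℂ) *
        ∑ x ∈ s, if G x = a * b then F x else 0 := by
  have e : ∀ ψ : DirichletCharacter ℂ m, (∑ x ∈ s, ψ⁻¹ (G x) * F x) *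
      LFunction (changeLevel h ψ) (1 / 2) ^ 2 = ∑ a ∈ coprimeRange q, ∑ b ∈ coprimeRange q, ∑ x ∈ s,
        ((q : ℝ)⁻¹ : ℝ) * ((periodicZeta (a / q) * periodicZeta (b / q) : ℝ) : ℂ) * F x *
          (ψ⁻¹ (G x) * ψ (a * b : ZMod m)) := fun ψ => by
    rw [LFunction_changeLevel_half, mul_pow, ofReal_sqrt_inv_sq, sq, Finset.sum_mul_sum,
      Finset.sum_comm' (s := coprimeRange q) (t := fun _ => coprimeRange q) (t' := coprimeRange q)
        (s' := fun _ => coprimeRange q) (by tauto)]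
    simp only [Finset.mul_sum, Finset.sum_mul]
    rw [Finset.sum_comm]
    refine Finset.sum_congr rfl fun a _ => Finset.sum_congr rfl fun b _ =>
      Finset.sum_congr rfl fun x _ => ?_
    rw [map_mul]; push_cast; ring
  simp only [e]
  rw [Finset.sum_comm, Finset.mul_sum]
  refine Finset.sum_congr rfl fun a ha => ?_
  rw [Finset.sum_comm, Finset.mul_sum]
  refine Finset.sum_congr rfl fun b hb => ?_
  rw [Finset.sum_comm, Finset.mul_sum, Finset.mul_sum]
  refine Finset.sum_congr rfl fun x _ => ?_
  rw [← Finset.mul_sum, sum_inv_apply_mul_apply _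
    ((isUnit_cast_of_mem h ha).mul (isUnit_cast_of_mem h hb))]
  split_ifs <;> ring

/-- Orthogonality selects the single residue `x = kab`, because `k` inverts `y`. -/
lemma sum_parityFactor_mul [NeZero m] [NeZero q] (h : m ∣ q) {y : ZMod m} {k : ℤ} (hk : (k : ZMod m) * y = 1) :
    ∑ ψ : DirichletCharacter ℂ m, parityFactor ψ * gaussTau ψ⁻¹ * ψ⁻¹ y * LCoprime q (1 / 2) ψ ^ 2 =
      m.totient * (twistedMoment q m k : ℂ) := by
  have e : ∀ ψ : DirichletCharacter ℂ m,
      parityFactor ψ * gaussTau ψ⁻¹ * ψ⁻¹ y * LCoprime q (1 / 2) ψ ^ 2 =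
      (∑ x ∈ Finset.range m, ψ⁻¹ ((x : ZMod m) * y) * (casMod (x : ZMod m) : ℂ))
        * LFunction (changeLevel h ψ) (1 / 2) ^ 2 := fun ψ => by
    rw [LCoprime_eq_changeLevel h ψ (Or.inr (by norm_num)), parityFactor_mul_gaussTau,
      ← sum_range_eq_sum_zmod, Finset.sum_mul]
    simp only [map_mul]
    congr 1
    exact Finset.sum_congr rfl fun x _ => by ring
  rw [Finset.sum_congr rfl fun ψ _ => e ψ, sum_characters_sq h (fun x => (casMod (x : ZMod m) : ℂ)) _ (fun x => (x : ZMod m) * y), twistedMoment]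
  push_cast
  rw [mul_assoc]
  congr 2
  refine Finset.sum_congr rfl fun a ha => Finset.sum_congr rfl fun b hb => ?_
  congr 1
  rw [sum_range_eq_sum_zmod (fun x : ZMod m => if x * y = a * b then (casMod x : ℂ) else 0)]
  have hx : ∀ x : ZMod m, x * y = a * b ↔ x = ((k * a * b : ℤ) : ZMod m) := fun x => by
    constructor
    · intro hx
      push_cast
      linear_combination (k : ZMod m) * hx - x * hk
    · rintro rfl
      push_cast
      linear_combination (a * b : ZMod m) * hk
  simp only [hx, Finset.sum_ite_eq', Finset.mem_univ, if_true, casMod_intCast]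
  push_cast; rfl

/-- Functional equation at the central point. -/
lemma IsPrimitive.sum_mul_LFunction_half [NeZero q] {χ : DirichletCharacter ℂ q} (hχ : χ.IsPrimitive) :
    (∑ x : ZMod q, χ⁻¹ x * casMod x) * LFunction χ (1 / 2) = √q * LFunction χ⁻¹ (1 / 2) := by
  have hprim : χ⁻¹.IsPrimitive := by
    rw [isPrimitive_def, conductor_inv]; exact hχ
  -- Primitivity makes the Gauss sum separable for every `a`, including nonunits.
  have key : ∀ a : ZMod q, χ a * ∑ x : ZMod q, χ⁻¹ x * casMod x = ∑ x : ZMod q, χ⁻¹ x * casMod (a * x) := by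
    intro a
    have h1 := sum_mul_casMod χ⁻¹ 1
    simp only [one_mul, AddChar.mulShift_one] at h1
    rw [h1, sum_mul_casMod, gaussSum_mulShift_of_isPrimitive _ hprim, inv_inv]
    ring
  have dual : ∀ x : ZMod q, ∑ a : ZMod q, (periodicZeta (a.val / q) : ℂ) * casMod (a * x) =
      √q * periodicZeta (x.val / q) := fun x => by
    have h := sum_periodicZeta_mul_casFun (NeZero.pos q) (x.val : ℤ)
    rw [← sum_range_eq_sum_zmod]
    rw [Int.cast_natCast] at h
    rw [← Complex.ofReal_mul, ← h, Complex.ofReal_sum]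
    refine Finset.sum_congr rfl fun b hb => ?_
    rw [ZMod.val_natCast_of_lt (Finset.mem_range.1 hb), ← Complex.ofReal_mul]
    congr 2
    have := casMod_intCast (m := q) (b * x.val : ℤ)
    push_cast at this
    rw [ZMod.natCast_zmod_val] at this
    rw [this]
  rw [LFunction_half, LFunction_half]
  calc _ = ((√q)⁻¹ : ℝ) * ∑ a : ZMod q, (χ a * ∑ x : ZMod q, χ⁻¹ x * casMod x) * periodicZeta (a.val / q) := by
        simp only [Finset.mul_sum, Finset.sum_mul]
        refine Finset.sum_congr rfl fun a _ => Finset.sum_congr rfl fun x _ => by ring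
    _ = ((√q)⁻¹ : ℝ) * ∑ x : ZMod q, χ⁻¹ x * ∑ a : ZMod q, (periodicZeta (a.val / q) : ℂ) * casMod (a * x) := by
        simp only [key]
        congr 1
        simp only [Finset.mul_sum, Finset.sum_mul]
        rw [Finset.sum_comm]
        refine Finset.sum_congr rfl fun a _ => Finset.sum_congr rfl fun x _ => by ring
    _ = _ := by
        simp only [dual, Finset.mul_sum]
        refine Finset.sum_congr rfl fun a _ => by ring

lemma conj_LFunction_half [NeZero q] (χ : DirichletCharacter ℂ q) :
    (starRingEnd ℂ) (LFunction χ (1 / 2)) = LFunction χ⁻¹ (1 / 2) := by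
  rw [LFunction_half, LFunction_half, map_mul, map_sum, Complex.conj_ofReal]
  congr 1
  refine Finset.sum_congr rfl fun a _ => ?_
  rw [map_mul, Complex.conj_ofReal, ← MulChar.star_apply']
  rfl

/-- As `ζ(x)` is real, the conjugate of `L(1/2, χ)` is `L(1/2, χ̄)`. The functional equation
replaces it by a Gauss sum times `L(1/2, χ)`, so that only squares of `L` occur. -/
lemma IsPrimitive.norm_LFunction_half_sq [NeZero q] {χ : DirichletCharacter ℂ q} (hχ : χ.IsPrimitive) :
    ((‖LFunction χ (1 / 2)‖ ^ 2 : ℝ) : ℂ) =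
      ((√q)⁻¹ : ℝ) * ((∑ x : ZMod q, χ⁻¹ x * casMod x) * LFunction χ (1 / 2) ^ 2) := by
  have hq : ((√q : ℝ) : ℂ) ≠ 0 := by
    rw [Complex.ofReal_ne_zero]; exact (Real.sqrt_pos.2 (by exact_mod_cast NeZero.pos q)).ne'
  rw [sq (LFunction χ (1 / 2)), ← mul_assoc (∑ x : ZMod q, _), IsPrimitive.sum_mul_LFunction_half hχ,
    ← conj_LFunction_half]
  push_cast
  rw [← Complex.mul_conj']
  field_simp

end Characters

/-! ### Möbius inversion from primitive to all characters -/

section PrimitiveSums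

open DirichletCharacter

lemma sum_divisors_moebius_ite {q : ℕ} (hq : 0 < q) (x : ℕ) :
    ∑ s ∈ q.divisors, (if s ∣ x then (ArithmeticFunction.moebius s : ℝ) else 0) =
      if Nat.Coprime x q then 1 else 0 := by
  have h : q.divisors.filter (· ∣ x) = (Nat.gcd x q).divisors := by
    ext s
    simp only [Finset.mem_filter, Nat.mem_divisors, Nat.dvd_gcd_iff]
    constructor
    · rintro ⟨⟨h1, _⟩, h2⟩; exact ⟨⟨h2, h1⟩, (Nat.gcd_pos_of_pos_right _ hq).ne'⟩
    · rintro ⟨⟨h1, h2⟩, _⟩; exact ⟨⟨h2, hq.ne'⟩, h1⟩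
  rw [← Finset.sum_filter, h, ← Int.cast_sum, ← ArithmeticFunction.coe_mul_zeta_apply,
    ArithmeticFunction.moebius_mul_coe_zeta, ArithmeticFunction.one_apply]
  simp only [Nat.Coprime]
  split_ifs <;> simp

lemma sum_antidiagonal_moebius_ite {q f : ℕ} (hq : 0 < q) (hf : f ∣ q) :
    ∑ x ∈ q.divisorsAntidiagonal, (if f ∣ x.2 then (ArithmeticFunction.moebius x.1 : ℝ) else 0) =
      if f = q then 1 else 0 := by
  rw [Nat.sum_divisorsAntidiagonal (fun c d => if f ∣ d then (ArithmeticFunction.moebius c : ℝ) else 0)]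
  obtain ⟨s, rfl⟩ := hf
  have hf0 : 0 < f := Nat.pos_of_mul_pos_right hq
  have hs0 : 0 < s := Nat.pos_of_mul_pos_left hq
  have h : (f * s).divisors.filter (fun c => f ∣ f * s / c) = s.divisors := by
    ext c
    simp only [Finset.mem_filter, Nat.mem_divisors]
    constructor
    · rintro ⟨⟨⟨d, hd⟩, _⟩, h2⟩
      have hc : 0 < c := Nat.pos_of_ne_zero fun h0 => by rw [h0, zero_mul] at hd; omega
      rw [hd, Nat.mul_div_cancel_left _ hc] at h2
      obtain ⟨e, rfl⟩ := h2
      exact ⟨⟨e, Nat.eq_of_mul_eq_mul_left hf0 (by rw [hd]; ring)⟩, hs0.ne'⟩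
    · rintro ⟨⟨e, rfl⟩, _⟩
      have hc : 0 < c := Nat.pos_of_mul_pos_right hs0
      refine ⟨⟨⟨f * e, by ring⟩, hq.ne'⟩, ?_⟩
      rw [show f * (c * e) = c * (f * e) by ring, Nat.mul_div_cancel_left _ hc]
      exact dvd_mul_right _ _
  rw [← Finset.sum_filter, h, ← Int.cast_sum, ← ArithmeticFunction.coe_mul_zeta_apply,
    ArithmeticFunction.moebius_mul_coe_zeta, ArithmeticFunction.one_apply]
  have : s = 1 ↔ f = f * s := by
    constructor
    · rintro rfl; simp
    · intro h; exact Nat.eq_of_mul_eq_mul_left hf0 (by rw [← h, mul_one])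
  simp only [this]
  split_ifs <;> simp

open scoped Classical in
-- A character factors through `d ∣ q` exactly when its conductor divides `d`, so Möbius inversion
-- isolates conductor `q`.
lemma sum_isPrimitive {q : ℕ} [NeZero q] (g : DirichletCharacter ℂ q → ℂ) :
    ∑ χ ∈ Finset.univ.filter (fun χ : DirichletCharacter ℂ q => χ.IsPrimitive), g χ =
      ∑ x ∈ q.divisorsAntidiagonal, (ArithmeticFunction.moebius x.1 : ℂ) *
        ∑ χ ∈ Finset.univ.filter (fun χ : DirichletCharacter ℂ q => χ.FactorsThrough x.2), g χ := by
  simp only [Finset.mul_sum, Finset.sum_filter]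
  rw [Finset.sum_comm]
  refine Finset.sum_congr rfl fun χ _ => ?_
  have h := sum_antidiagonal_moebius_ite (NeZero.pos q) χ.conductor_dvd_level
  have e : ∀ x ∈ q.divisorsAntidiagonal, (ArithmeticFunction.moebius x.1 : ℂ) *
      (if χ.FactorsThrough x.2 then g χ else 0) =
      ((if χ.conductor ∣ x.2 then (ArithmeticFunction.moebius x.1 : ℝ) else 0 : ℝ) : ℂ) * g χ := fun x hx => by
    have hx2 : x.2 ∣ q := ⟨x.1, by rw [mul_comm]; exact (Nat.mem_divisorsAntidiagonal.1 hx).1.symm⟩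
    have := mem_conductorSet_iff_conductor_dvd (χ := χ) hx2
    rw [mem_conductorSet_iff] at this
    simp only [this]
    split_ifs <;> simp
  rw [Finset.sum_congr rfl e, ← Finset.sum_mul, ← Complex.ofReal_sum, h, isPrimitive_def]
  split_ifs <;> simp

open scoped Classical in
lemma sum_factorsThrough {q d : ℕ} [NeZero q] [NeZero d] (hd : d ∣ q) (g : DirichletCharacter ℂ q → ℂ) :
    ∑ χ ∈ Finset.univ.filter (fun χ : DirichletCharacter ℂ q => χ.FactorsThrough d), g χ =
      ∑ ψ : DirichletCharacter ℂ d, g (changeLevel hd ψ) := by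
  symm
  refine Finset.sum_bij (fun ψ _ => changeLevel hd ψ) (fun ψ _ => ?_) (fun _ _ _ _ h => ?_)
    (fun χ hχ => ?_) (fun _ _ => rfl)
  · simpa using changeLevel_factorsThrough ψ hd
  · exact changeLevel_injective hd h
  · obtain ⟨h, ψ, rfl⟩ := (Finset.mem_filter.1 hχ).2
    exact ⟨ψ, Finset.mem_univ _, rfl⟩

end PrimitiveSums

/-! ### Ramanujan sums along a progression -/

section Ramanujan

lemma casFun_eq_re (u : ℝ) : casFun u = ((1 - Complex.I) * Complex.exp (u * Complex.I)).re := by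
  rw [Complex.exp_mul_I]
  simp [casFun, Complex.cos_ofReal_re, Complex.sin_ofReal_re]

lemma sum_casFun_add_div {K : ℕ} (hK : 0 < K) (y : ℝ) :
    ∑ t ∈ Finset.range K, casFun (2 * Real.pi * (y + t / K)) =
      if K = 1 then casFun (2 * Real.pi * y) else 0 := by
  split_ifs with h1
  · subst h1; simp
  have hζ := Complex.isPrimitiveRoot_exp K hK.ne'
  have h := hζ.geom_sum_eq_zero (by omega)
  have e : ∀ t : ℕ, casFun (2 * Real.pi * (y + t / K)) = ((1 - Complex.I) *
      Complex.exp (2 * Real.pi * y * Complex.I) * Complex.exp (2 * Real.pi * Complex.I / K) ^ t).re := fun t => by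
    rw [casFun_eq_re, ← Complex.exp_nat_mul, mul_assoc (1 - Complex.I), ← Complex.exp_add]
    congr 3
    push_cast; ring
  simp only [e]
  rw [← Complex.re_sum, ← Finset.mul_sum, h]
  simp

lemma sum_range_ite_dvd_sub {q m : ℕ} (hm : 0 < m) (hmq : m ∣ q) {F : ℤ → ℝ} (hF : ∀ n, F (n + q) = F n)
    (x₀ : ℤ) : ∑ x ∈ Finset.range q, (if (m : ℤ) ∣ x - x₀ then F x else 0) =
      ∑ t ∈ Finset.range (q / m), F (x₀ + m * t) := by
  obtain ⟨k, rfl⟩ := hmq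
  have h := sum_range_add_of_periodic (N := m * k)
    (G := fun x : ℤ => if (m : ℤ) ∣ x - x₀ then F x else 0) (fun n => by
      have : (m : ℤ) ∣ n + (m * k : ℕ) - x₀ ↔ (m : ℤ) ∣ n - x₀ := by
        rw [show n + ((m * k : ℕ) : ℤ) - x₀ = (n - x₀) + m * k by push_cast; ring]
        exact dvd_add_left (dvd_mul_right _ _)
      simp only [this, hF]) x₀
  rw [← h, sum_range_mul_eq (fun x : ℕ => if (m : ℤ) ∣ (x : ℤ) + x₀ - x₀ then F (x + x₀) else 0),
    Finset.sum_comm, Nat.mul_div_cancel_left _ hm]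
  refine Finset.sum_congr rfl fun t _ => ?_
  rw [Finset.sum_eq_single_of_mem 0 (Finset.mem_range.2 hm)]
  · rw [if_pos]
    · congr 1; push_cast; ring
    · push_cast; exact ⟨t, by ring⟩
  · intro r hr hr0
    rw [if_neg]
    intro hdvd
    have h2 : (m : ℤ) ∣ ((r : ℕ) : ℤ) := by
      obtain ⟨e, he⟩ := hdvd
      exact ⟨e - t, by push_cast at he ⊢; linear_combination he⟩
    exact hr0 (Nat.eq_zero_of_dvd_of_lt (Int.natCast_dvd_natCast.1 h2) (Finset.mem_range.1 hr))

lemma periodic_casFun_div {q : ℕ} (hq : 0 < q) (n : ℤ) :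
    casFun (2 * Real.pi * (((n + (q : ℕ) : ℤ) : ℝ) / q)) = casFun (2 * Real.pi * (n / q)) := by
  have : (q : ℝ) ≠ 0 := by exact_mod_cast hq.ne'
  exact casFun_eq_of_sub 1 (by push_cast; field_simp; ring)

/-- Ramanujan sums over an arithmetic progression. -/
lemma sum_coprimeRange_casFun {c d : ℕ} (hc : 0 < c) (hd : 0 < d) {n : ℕ} (hn : Nat.Coprime n d) :
    ∑ x ∈ coprimeRange (c * d), (if (x : ZMod d) = (n : ZMod d) then
      casFun (2 * Real.pi * (x / (c * d : ℕ))) else 0) =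
    if Nat.Coprime c d then
      ArithmeticFunction.moebius c * casFun (2 * Real.pi * (Nat.gcdA c d * n / d)) else 0 := by
  set q := c * d with hq
  have hq0 : 0 < q := Nat.mul_pos hc hd
  have hd' : (d : ℝ) ≠ 0 := by exact_mod_cast hd.ne'
  have hc' : (c : ℝ) ≠ 0 := by exact_mod_cast hc.ne'
  set F : ℤ → ℝ := fun x => casFun (2 * Real.pi * (x / q))
  have hF : ∀ x, F (x + q) = F x := fun x => periodic_casFun_div hq0 x
  have step1 : ∑ x ∈ coprimeRange q, (if (x : ZMod d) = (n : ZMod d) then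
      casFun (2 * Real.pi * (x / q)) else 0) = ∑ s ∈ q.divisors, ArithmeticFunction.moebius s *
        ∑ x ∈ Finset.range q, (if s ∣ x ∧ (x : ZMod d) = (n : ZMod d) then F x else 0) := by
    simp only [Finset.mul_sum]
    rw [Finset.sum_comm, coprimeRange, Finset.sum_filter]
    refine Finset.sum_congr rfl fun x _ => ?_
    have := sum_divisors_moebius_ite hq0 x
    calc _ = (if Nat.Coprime x q then (1 : ℝ) else 0) * (if (x : ZMod d) = (n : ZMod d) then F x else 0) := by
          simp only [F, Int.cast_natCast]; split_ifs <;> simp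
      _ = _ := by
          rw [← this, Finset.sum_mul]
          refine Finset.sum_congr rfl fun s _ => ?_
          by_cases h1 : s ∣ x <;> by_cases h2 : (x : ZMod d) = (n : ZMod d) <;> simp [h1, h2]
  -- If `s` is coprime to `d`, the two conditions define one class modulo `sd`. Over it the kernel
  -- sums to 0 unless the class is a single residue modulo `q`, that is, unless `s = c`. If `s` is
  -- not coprime to `d`, no `x` qualifies because `n` is coprime to `d`.
  have step2 : ∀ s ∈ q.divisors, ∑ x ∈ Finset.range q,
      (if s ∣ x ∧ (x : ZMod d) = (n : ZMod d) then F x else 0) =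
      if s = c ∧ Nat.Coprime c d then casFun (2 * Real.pi * (Nat.gcdA c d * n / d)) else 0 := by
    intro s hs
    have hsq := Nat.dvd_of_mem_divisors hs
    have hs0 : 0 < s := Nat.pos_of_mem_divisors hs
    by_cases hsd : Nat.Coprime s d
    · have hsc : s ∣ c := hsd.dvd_of_dvd_mul_right hsq
      obtain ⟨k, hk⟩ := hsc
      have hbez := Nat.gcd_eq_gcd_ab s d
      rw [hsd.gcd_eq_one] at hbez
      set A := Nat.gcdA s d
      set B := Nat.gcdB s d
      have hiff : ∀ x : ℕ, (s ∣ x ∧ (x : ZMod d) = (n : ZMod d)) ↔ ((s * d : ℕ) : ℤ) ∣ x - n * A * s := by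
        intro x
        have h1 : (x : ZMod d) = (n : ZMod d) ↔ (d : ℤ) ∣ x - n := by
          have := ZMod.intCast_eq_intCast_iff_dvd_sub (n : ℤ) x d
          push_cast at this
          rw [← this, eq_comm]
        have hcop : IsCoprime (s : ℤ) d := Nat.isCoprime_iff_coprime.2 hsd
        rw [h1, ← Int.natCast_dvd_natCast]
        push_cast at hbez ⊢
        constructor
        · rintro ⟨h2, h3⟩
          refine hcop.mul_dvd (dvd_sub h2 (dvd_mul_left _ _)) ?_
          rw [show (x : ℤ) - n * A * s = (x - n) + d * (n * B) by linear_combination n * hbez]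
          exact dvd_add h3 (dvd_mul_right _ _)
        · intro h2
          constructor
          · have := dvd_add ((dvd_mul_right (s : ℤ) d).trans h2) (dvd_mul_left (s : ℤ) (n * A))
            simpa using this
          · have := dvd_sub ((dvd_mul_left (d : ℤ) s).trans h2) (dvd_mul_right (d : ℤ) (n * B))
            rwa [show (x : ℤ) - n * A * s - d * (n * B) = x - n by linear_combination n * hbez] at this
      simp only [hiff]
      rw [sum_range_ite_dvd_sub (Nat.mul_pos hs0 hd) (by rw [hq, hk]; exact ⟨k, by ring⟩) hF]
      have hk0 : 0 < k := Nat.pos_of_ne_zero fun h => by rw [h] at hk; omega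
      have hqk : q / (s * d) = k := by
        rw [hq, hk, show s * k * d = s * d * k by ring]
        exact Nat.mul_div_cancel_left _ (Nat.mul_pos hs0 hd)
      have hs' : (s : ℝ) ≠ 0 := by exact_mod_cast hs0.ne'
      have hk' : (k : ℝ) ≠ 0 := by exact_mod_cast hk0.ne'
      have e : ∀ t : ℕ, F (n * A * s + (s * d : ℕ) * t) =
          casFun (2 * Real.pi * ((n * A * s : ℝ) / q + t / k)) := fun t => by
        simp only [F]
        congr 2
        rw [hq, hk]; push_cast; field_simp
      rw [hqk, Finset.sum_congr rfl fun t _ => e t, sum_casFun_add_div hk0]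
      by_cases hk1 : k = 1
      · have hsc : s = c := by rw [hk, hk1, mul_one]
        rw [if_pos hk1, if_pos ⟨hsc, hsc ▸ hsd⟩]
        simp only [A]
        rw [hsc, hq]
        congr 2
        push_cast; field_simp
      · rw [if_neg hk1, if_neg]
        rintro ⟨rfl, _⟩
        exact hk1 (Nat.eq_of_mul_eq_mul_left hs0 (by rw [mul_one]; exact hk.symm))
    · rw [if_neg (by rintro ⟨rfl, h⟩; exact hsd h)]
      refine Finset.sum_eq_zero fun x _ => if_neg ?_
      rintro ⟨h1, h2⟩
      refine hsd (Nat.Coprime.coprime_dvd_left h1 ?_)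
      rw [← ZMod.isUnit_iff_coprime, h2, ZMod.isUnit_iff_coprime]
      exact hn
  rw [step1, Finset.sum_congr rfl fun s hs => by rw [step2 s hs]]
  split_ifs with hcop
  · rw [Finset.sum_eq_single_of_mem c (Nat.mem_divisors.2 ⟨⟨d, hq⟩, hq0.ne'⟩)]
    · simp [hcop]
    · intro s _ hsc; simp [hsc]
  · simp [hcop]

end Ramanujan

/-! ### Mean square and secondary terms as twisted moments -/

section Formulas

open DirichletCharacter

/-- The coprime factorisations `q = c d`. -/
def coprimePairs (q : ℕ) : Finset (ℕ × ℕ) :=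
  q.divisorsAntidiagonal.filter (fun x : ℕ × ℕ => Nat.Coprime x.1 x.2)

lemma gcdA_mul_cast {c d : ℕ} (h : Nat.Coprime c d) : ((Nat.gcdA c d : ℤ) : ZMod d) * (c : ZMod d) = 1 := by
  have hb := Nat.gcd_eq_gcd_ab c d
  rw [h.gcd_eq_one] at hb
  have := congrArg (Int.cast : ℤ → ZMod d) hb
  push_cast at this
  rw [ZMod.natCast_self, zero_mul, add_zero] at this
  rw [mul_comm]; exact this.symm

/-- Möbius inversion over moduli and the Ramanujan sum each contribute a factor `μ(c)`, whence the
square. The Ramanujan sum also kills the factorisations with `(c, d) > 1`. -/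
theorem primitiveMeanSquare_eq (q : ℕ) [NeZero q] :
    primitiveMeanSquare q = ∑ x ∈ coprimePairs q,
      (ArithmeticFunction.moebius x.1 : ℝ) ^ 2 * x.2.totient / √q *
        twistedMoment q x.2 (Nat.gcdA x.1 x.2) := by
  classical
  apply Complex.ofReal_injective
  rw [primitiveMeanSquare, Complex.ofReal_sum, Finset.sum_congr rfl fun χ hχ =>
    IsPrimitive.norm_LFunction_half_sq (Finset.mem_filter.1 hχ).2]
  refine (Eq.trans ?_ (sum_isPrimitive fun χ => (((√q)⁻¹ : ℝ) : ℂ) *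
    ((∑ x : ZMod q, χ⁻¹ x * casMod x) * LFunction χ (1 / 2) ^ 2))).trans ?_
  · exact Finset.sum_congr (by ext; simp) fun _ _ => rfl
  rw [coprimePairs, Finset.sum_filter, Complex.ofReal_sum]
  refine Finset.sum_congr rfl fun x hx => ?_
  obtain ⟨hx1, hq0⟩ := Nat.mem_divisorsAntidiagonal.1 hx
  obtain ⟨c, d⟩ := x
  simp only at hx1 ⊢
  have hd0 : 0 < d := Nat.pos_of_ne_zero fun h => by rw [h, mul_zero] at hx1; exact hq0 hx1.symm
  have hc0 : 0 < c := Nat.pos_of_ne_zero fun h => by rw [h, zero_mul] at hx1; exact hq0 hx1.symm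
  have : NeZero d := ⟨hd0.ne'⟩
  have hdq : d ∣ q := ⟨c, by rw [← hx1, mul_comm]⟩
  rw [sum_factorsThrough hdq, ← Finset.mul_sum]
  have e : ∀ ψ : DirichletCharacter ℂ d, ∑ x : ZMod q, (changeLevel hdq ψ)⁻¹ x * (casMod x : ℂ) =
      ∑ x ∈ coprimeRange q, ψ⁻¹ (x : ZMod d) * ((casFun (2 * Real.pi * (x / q)) : ℝ) : ℂ) := fun ψ => by
    rw [← map_inv, sum_changeLevel hdq ψ⁻¹ fun x => (casMod x : ℂ)]
    refine Finset.sum_congr rfl fun x _ => ?_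
    have := casMod_intCast (m := q) x
    rw [Int.cast_natCast, Int.cast_natCast] at this
    rw [this]
  simp only [e]
  rw [sum_characters_sq hdq (fun x => ((casFun (2 * Real.pi * (x / q)) : ℝ) : ℂ)) _ (fun x => (x : ZMod d))]
  have ram : ∀ a ∈ coprimeRange q, ∀ b ∈ coprimeRange q, ∑ x ∈ coprimeRange q,
      (if (x : ZMod d) = a * b then ((casFun (2 * Real.pi * (x / q)) : ℝ) : ℂ) else 0) =
      ((if Nat.Coprime c d then ArithmeticFunction.moebius c *
        casFun (2 * Real.pi * (Nat.gcdA c d * a * b / d)) else 0 : ℝ) : ℂ) := by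
    intro a ha b hb
    have hn : Nat.Coprime (a * b) d := Nat.Coprime.mul_left
      (Nat.Coprime.coprime_dvd_right hdq (Finset.mem_filter.1 ha).2)
      (Nat.Coprime.coprime_dvd_right hdq (Finset.mem_filter.1 hb).2)
    have h := sum_coprimeRange_casFun hc0 hd0 hn
    rw [hx1] at h
    push_cast at h
    simp only [← mul_assoc] at h
    rw [← h, Complex.ofReal_sum]
    refine Finset.sum_congr rfl fun x _ => ?_
    split_ifs <;> simp
  rw [Finset.sum_congr rfl fun a ha => Finset.sum_congr rfl fun b hb => by rw [ram a ha b hb]]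
  split_ifs with hcop
  · rw [twistedMoment]
    push_cast
    simp only [Finset.mul_sum]
    refine Finset.sum_congr rfl fun a _ => Finset.sum_congr rfl fun b _ => ?_
    ring
  · simp

open scoped Classical in
theorem numPrimitive_eq (q : ℕ) [NeZero q] :
    (numPrimitive q : ℝ) = ∑ x ∈ q.divisorsAntidiagonal,
      (ArithmeticFunction.moebius x.1 : ℝ) * x.2.totient := by
  apply Complex.ofReal_injective
  have h := sum_isPrimitive (q := q) fun _ => 1
  rw [numPrimitive, Finset.card_eq_sum_ones]
  push_cast
  rw [h]
  refine Finset.sum_congr rfl fun x hx => ?_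
  obtain ⟨hx1, hq0⟩ := Nat.mem_divisorsAntidiagonal.1 hx
  have hd0 : x.2 ≠ 0 := fun h => by rw [h, mul_zero] at hx1; exact hq0 hx1.symm
  have : NeZero x.2 := ⟨hd0⟩
  rw [sum_factorsThrough ⟨x.1, by rw [← hx1, mul_comm]⟩]
  have := card_eq_totient_of_hasEnoughRootsOfUnity ℂ x.2
  rw [Nat.card_eq_fintype_card] at this
  simp [this]

lemma characterSum_of_lt {q c d m : ℕ} [NeZero q] [NeZero m] (hm : m = c) (hq : c * d = q)
    (hcop : Nat.Coprime c d) (hcd : c < d) :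
    characterSum q c d m = c.totient * (twistedMoment q c (-Nat.gcdA d c) : ℂ) := by
  subst hm
  have hk : (((-Nat.gcdA d m : ℤ)) : ZMod m) * (-(d : ZMod m)) = 1 := by
    push_cast; rw [neg_mul_neg, gcdA_mul_cast hcop.symm]
  rw [← sum_parityFactor_mul ⟨d, hq.symm⟩ hk, characterSum]
  simp [hcd, hcd.not_gt]

lemma characterSum_of_gt {q c d m : ℕ} [NeZero q] [NeZero m] (hm : m = d) (hq : c * d = q)
    (hcop : Nat.Coprime c d) (hcd : d < c) :
    characterSum q c d m = d.totient * (twistedMoment q d (Nat.gcdA c d) : ℂ) := by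
  subst hm
  rw [← sum_parityFactor_mul ⟨c, by rw [← hq, mul_comm]⟩ (gcdA_mul_cast hcop), characterSum]
  simp [hcd, hcd.not_gt]

/-- Orthogonality modulo `min c d` contributes `φ(min c d)`, and `φ(q)/φ(c) = φ(d)`, so the weights
become those of `primitiveMeanSquare_eq`. For `q > 1` a coprime factorisation never has `c = d`, so
the two-way distinction is exhaustive. -/
theorem secondaryTerms_eq {q : ℕ} (hq : 1 < q) :
    secondaryTerms q = ((∑ x ∈ coprimePairs q,
      (ArithmeticFunction.moebius x.1 : ℝ) ^ 2 * x.2.totient / √q *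
        (2 * if x.1 < x.2 then twistedMoment q x.1 (-Nat.gcdA x.2 x.1)
          else twistedMoment q x.2 (Nat.gcdA x.1 x.2)) : ℝ) : ℂ) := by
  have hqz : NeZero q := ⟨by omega⟩
  rw [secondaryTerms, Finset.mul_sum, Complex.ofReal_sum]
  refine Finset.sum_congr rfl fun x hx => ?_
  obtain ⟨hx0, hcop⟩ := Finset.mem_filter.1 hx
  obtain ⟨hx1, hq0⟩ := Nat.mem_divisorsAntidiagonal.1 hx0
  obtain ⟨c, d⟩ := x
  simp only at hx1 hcop ⊢
  have hd0 : 0 < d := Nat.pos_of_ne_zero fun h => by rw [h, mul_zero] at hx1; exact hq0 hx1.symm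
  have hc0 : 0 < c := Nat.pos_of_ne_zero fun h => by rw [h, zero_mul] at hx1; exact hq0 hx1.symm
  have hm0 : min c d ≠ 0 := by omega
  have hne : c ≠ d := by
    rintro rfl
    rw [Nat.coprime_self] at hcop
    subst hcop; omega
  have : NeZero (min c d) := ⟨hm0⟩
  rw [dif_pos hm0]
  have ht : (q.totient : ℂ) = c.totient * d.totient := by
    rw [← hx1, Nat.totient_mul hcop]; push_cast; ring
  have hct : (c.totient : ℂ) ≠ 0 := by exact_mod_cast (Nat.totient_pos.2 hc0).ne'
  have hdt : (d.totient : ℂ) ≠ 0 := by exact_mod_cast (Nat.totient_pos.2 hd0).ne'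
  have hsq : ((√q : ℝ) : ℂ) ≠ 0 := by
    rw [Complex.ofReal_ne_zero]; exact (Real.sqrt_pos.2 (by exact_mod_cast NeZero.pos q)).ne'
  rcases lt_or_gt_of_ne hne with h | h
  · rw [characterSum_of_lt (min_eq_left h.le) hx1 hcop h, if_pos h, ht, min_eq_left h.le]
    push_cast
    field_simp
  · rw [characterSum_of_gt (min_eq_right h.le) hx1 hcop h, if_neg h.not_gt, ht, min_eq_right h.le]
    push_cast
    field_simp

end Formulas

/-! ### From twisted moments to correlations -/

section MomentExpansion

/-- The contribution of the multiples of `u` and `v` to `twistedMoment`. -/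
noncomputable def momentTerm (q k : ℕ) (h : ℤ) (u v : ℕ) : ℝ :=
  (q : ℝ)⁻¹ * ∑ a ∈ Finset.range (q / u), ∑ b ∈ Finset.range (q / v),
    periodicZeta ((u * a : ℕ) / q) * periodicZeta ((v * b : ℕ) / q) *
      casFun (2 * Real.pi * (h * (u * a : ℕ) * (v * b : ℕ) / k))

lemma sum_coprimeRange {q : ℕ} (hq : 0 < q) (F : ℕ → ℝ) :
    ∑ a ∈ coprimeRange q, F a = ∑ u ∈ q.divisors, ArithmeticFunction.moebius u *
      ∑ a ∈ Finset.range (q / u), F (u * a) := by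
  have e : ∀ u ∈ q.divisors, (ArithmeticFunction.moebius u : ℝ) * ∑ a ∈ Finset.range (q / u), F (u * a) =
      ∑ a ∈ Finset.range q, (if u ∣ a then (ArithmeticFunction.moebius u : ℝ) else 0) * F a := by
    intro u hu
    have hu0 := Nat.pos_of_mem_divisors hu
    obtain ⟨k, hk⟩ := Nat.dvd_of_mem_divisors hu
    have hqk : q / u = k := by rw [hk, Nat.mul_div_cancel_left _ hu0]
    rw [hqk, hk, sum_range_mul_eq, Finset.sum_comm, Finset.mul_sum]
    refine Finset.sum_congr rfl fun t _ => ?_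
    rw [Finset.sum_eq_single_of_mem 0 (Finset.mem_range.2 hu0)]
    · simp
    · intro r hr hr0
      rw [if_neg, zero_mul]
      intro hdvd
      rw [Nat.dvd_add_left (dvd_mul_right _ _)] at hdvd
      exact hr0 (Nat.eq_zero_of_dvd_of_lt hdvd (Finset.mem_range.1 hr))
  rw [Finset.sum_congr rfl e, Finset.sum_comm, coprimeRange, Finset.sum_filter]
  refine Finset.sum_congr rfl fun a _ => ?_
  rw [← Finset.sum_mul, sum_divisors_moebius_ite hq]
  split_ifs <;> simp

lemma twistedMoment_eq_sum {q : ℕ} (hq : 0 < q) (k : ℕ) (h : ℤ) :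
    twistedMoment q k h = ∑ u ∈ q.divisors, ∑ v ∈ q.divisors,
      (ArithmeticFunction.moebius u : ℝ) * ArithmeticFunction.moebius v * momentTerm q k h u v := by
  rw [twistedMoment, sum_coprimeRange hq, Finset.mul_sum]
  refine Finset.sum_congr rfl fun u _ => ?_
  simp only [sum_coprimeRange hq]
  rw [Finset.sum_comm, Finset.mul_sum, Finset.mul_sum]
  refine Finset.sum_congr rfl fun v _ => ?_
  rw [momentTerm]
  simp only [Finset.mul_sum]
  refine Finset.sum_congr rfl fun a _ => Finset.sum_congr rfl fun b _ => ?_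
  ring

/-- The sum over `b` is a Hartley transform modulo `q/v` and self-duality evaluates it as a multiple
of `ζ(h'a/K)`, where `huv/k = h'/K`. This has period `K` in `a`, so the other factor can be summed
over `a` in each class modulo `K` by the distribution relation. -/
lemma momentTerm_eq {q k u v K : ℕ} {h h' : ℤ} (hq : 0 < q) (hk : k ∣ q) (hv : v ∣ q) (hKu : K * u ∣ q)
    (hh : h * u * v * K = h' * k) :
    momentTerm q k h u v = (√u)⁻¹ * (√v)⁻¹ * corr K 1 h' := by
  obtain ⟨l, hl⟩ := hk
  obtain ⟨N, hN⟩ := hv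
  obtain ⟨W, hW⟩ := hKu
  have pos : ∀ {a b : ℕ}, q = a * b → 0 < a ∧ 0 < b := fun hab =>
    ⟨Nat.pos_of_mul_pos_right (hab ▸ hq), Nat.pos_of_mul_pos_left (hab ▸ hq)⟩
  obtain ⟨hk0, hl0⟩ := pos hl
  obtain ⟨hv0, hN0⟩ := pos hN
  obtain ⟨hKu0, hW0⟩ := pos hW
  have hK0 : 0 < K := Nat.pos_of_mul_pos_right hKu0
  have hu0 : 0 < u := Nat.pos_of_mul_pos_left hKu0
  have cast : ∀ {a : ℕ}, 0 < a → (0 : ℝ) < a := fun h => by exact_mod_cast h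
  have hq' := cast hq
  have hk' := cast hk0
  have hl' := cast hl0
  have hv' := cast hv0
  have hN' := cast hN0
  have hK' := cast hK0
  have hu' := cast hu0
  have hW' := cast hW0
  have hqu : q / u = K * W := by
    rw [hW, show K * u * W = u * (K * W) by ring, Nat.mul_div_cancel_left _ hu0]
  have hqv : q / v = N := by rw [hN, Nat.mul_div_cancel_left _ hv0]
  have hlR : (q : ℝ) = k * l := by rw [hl]; push_cast; ring
  have hNR : (q : ℝ) = v * N := by rw [hN]; push_cast; ring
  have hWR : (q : ℝ) = K * u * W := by rw [hW]; push_cast; ring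
  have hhR : (h : ℝ) * u * v * K = h' * k := by exact_mod_cast hh
  have inner : ∀ a : ℕ, ∑ b ∈ Finset.range N, periodicZeta ((u * a : ℕ) / q) * periodicZeta ((v * b : ℕ) / q) *
      casFun (2 * Real.pi * (h * (u * a : ℕ) * (v * b : ℕ) / k)) =
      √N * (periodicZeta ((a : ℝ) / (K * W)) * periodicZeta (h' * a / K)) := fun a => by
    have hd := sum_periodicZeta_mul_casFun hN0 (h * u * a * l)
    have e0 : (((h * u * a * l : ℤ) : ℝ)) / N = h' * a / K := by
      push_cast
      rw [div_eq_div_iff hN'.ne' hK'.ne']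
      have : (k : ℝ) * l = v * N := by rw [← hlR, hNR]
      refine mul_right_cancel₀ (mul_pos hk' hv').ne' ?_
      linear_combination (a * l * k : ℝ) * hhR + h' * a * k * this
    have e1 : ((u * a : ℕ) : ℝ) / q = (a : ℝ) / (K * W) := by
      rw [hWR]; push_cast; field_simp
    rw [e0] at hd
    rw [mul_left_comm, ← hd, Finset.mul_sum]
    refine Finset.sum_congr rfl fun b _ => ?_
    rw [e1, mul_assoc]
    congr 2
    · rw [hNR]; push_cast; congr 1; field_simp
    · congr 2
      rw [div_eq_div_iff hk'.ne' hN'.ne']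
      push_cast
      have : (k : ℝ) * l = v * N := by rw [← hlR, hNR]
      linear_combination -(h * u * a * b : ℝ) * this
  have outer : ∑ a ∈ Finset.range (K * W), periodicZeta ((a : ℝ) / (K * W)) * periodicZeta (h' * a / K) =
      √W * ∑ r ∈ Finset.range K, periodicZeta ((r : ℝ) / K) * periodicZeta (h' * r / K) := by
    rw [sum_range_mul_eq, Finset.mul_sum]
    refine Finset.sum_congr rfl fun r _ => ?_
    have e : ∀ t : ℕ, periodicZeta (((r + K * t : ℕ) : ℝ) / (K * W)) * periodicZeta (h' * (r + K * t : ℕ) / K) =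
        periodicZeta ((r : ℝ) / (K * W) + t / W) * periodicZeta (h' * r / K) := fun t => by
      congr 1
      · congr 1; push_cast; field_simp
      · exact periodicZeta_eq_of_sub (h' * t) (by push_cast; field_simp; ring)
    rw [Finset.sum_congr rfl fun t _ => e t, ← Finset.sum_mul, periodicZeta_distribution _ hW0]
    have : (W : ℝ) * (r / (K * W)) = r / K := by field_simp
    rw [this]; ring
  rw [momentTerm, hqu, hqv, Finset.sum_congr rfl fun a _ => inner a, ← Finset.mul_sum, outer, corr]
  simp only [Int.cast_one, one_mul]
  have sK := Real.sqrt_pos.2 hK'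
  have sN := Real.sqrt_pos.2 hN'
  have sW := Real.sqrt_pos.2 hW'
  have su := Real.sqrt_pos.2 hu'
  have sv := Real.sqrt_pos.2 hv'
  have key : (q : ℝ)⁻¹ * (√N * √W) = (√u)⁻¹ * (√v)⁻¹ * (√K)⁻¹ := by
    have h1 : √(q : ℝ) = √v * √N := by rw [hNR, Real.sqrt_mul hv'.le]
    have h2 : √(q : ℝ) = √K * √u * √W := by
      rw [hWR, Real.sqrt_mul (by positivity), Real.sqrt_mul hK'.le]
    rw [← Real.mul_self_sqrt hq'.le]
    nth_rewrite 1 [h1]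
    rw [h2]
    field_simp
  linear_combination (∑ r ∈ Finset.range K, periodicZeta ((r : ℝ) / K) * periodicZeta (h' * r / K)) * key

lemma corr_one_eq {j : ℕ} (hj : 0 < j) {w h b : ℤ} (hw : IsCoprime w j) (hb : (j : ℤ) ∣ w * h - b) :
    corr j 1 h = corr j w b := by
  have hj' : (j : ℝ) ≠ 0 := by exact_mod_cast hj.ne'
  have h1 := sum_range_mul_of_periodic (N := j)
    (G := fun n : ℤ => periodicZeta ((1 : ℤ) * n / j) * periodicZeta (h * n / j)) (fun n => by
      rw [periodic_zmod_div hj 1 n, periodic_zmod_div hj h n]) hw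
  rw [corr, corr]
  congr 1
  refine h1.symm.trans (Finset.sum_congr rfl fun r _ => ?_)
  obtain ⟨c, hc⟩ := hb
  have hc' : (w : ℝ) * h - b = j * c := by exact_mod_cast hc
  congr 1
  · push_cast; congr 1; ring
  · refine periodicZeta_eq_of_sub (c * r) ?_
    push_cast
    field_simp
    linear_combination (r : ℝ) * hc'

end MomentExpansion

/-! ### Cancellation in the twisting fractions -/

section Factorisation

variable {q c d u v e f j g k : ℕ}

lemma gcdA_modEq (h : Nat.Coprime c d) : (d : ℤ) ∣ c * Nat.gcdA c d - 1 := by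
  have hb := Nat.gcd_eq_gcd_ab c d
  rw [h.gcd_eq_one] at hb
  push_cast at hb
  exact ⟨-Nat.gcdB c d, by linear_combination -hb⟩

/-- With `x̄` an inverse of `x` to the relevant modulus, the fraction `c̄uv/d = c̄fgk/(jk)` reduces
to `ēf/j` modulo 1, because `c̄g` inverts `e` modulo `j`. Replacing `r` by `er` clears the inverse.
-/
lemma momentTerm_gcdA (hq : 0 < q) (hcd : c * d = q) (hcop : Nat.Coprime c d) (hc : c = e * g) (hd : d = j * k)
    (huv : u * v = f * g * k) (hv : v ∣ q) (hju : j * u ∣ q) :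
    momentTerm q d (Nat.gcdA c d) u v = (√u)⁻¹ * (√v)⁻¹ * corr j e f := by
  have hd0 : 0 < d := Nat.pos_of_mul_pos_left (hcd ▸ hq)
  have hj0 : 0 < j := Nat.pos_of_mul_pos_right (hd ▸ hd0)
  have huvR : (u : ℤ) * v = f * g * k := by exact_mod_cast huv
  have hdR : (d : ℤ) = j * k := by exact_mod_cast hd
  have hcR : (c : ℤ) = e * g := by exact_mod_cast hc
  rw [momentTerm_eq (h' := Nat.gcdA c d * (f * g)) (K := j) hq ⟨c, by rw [← hcd, mul_comm]⟩ hv hju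
    (by rw [hdR]; linear_combination Nat.gcdA c d * j * huvR)]
  congr 1
  have hej : Nat.Coprime e j := by
    refine Nat.Coprime.coprime_dvd_left ⟨g, hc⟩ (Nat.Coprime.coprime_dvd_right ⟨k, hd⟩ hcop)
  refine corr_one_eq hj0 (Nat.isCoprime_iff_coprime.2 hej) ?_
  obtain ⟨t, ht⟩ := gcdA_modEq hcop
  refine ⟨f * k * t, ?_⟩
  rw [hdR, hcR] at ht
  linear_combination f * ht

/-- Likewise `-d̄uv/c` reduces to `-j̄f/e` modulo 1, and `r ↦ -jr` clears the inverse. The same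
triple `e, f, j` appears as for the other modulus, which lets reciprocity compare the two. -/
lemma momentTerm_neg_gcdA (hq : 0 < q) (hcd : c * d = q) (hcop : Nat.Coprime c d) (hc : c = e * g) (hd : d = j * k)
    (huv : u * v = f * g * k) (hv : v ∣ q) (heu : e * u ∣ q) :
    momentTerm q c (-Nat.gcdA d c) u v = (√u)⁻¹ * (√v)⁻¹ * corr e f (-j) := by
  have hc0 : 0 < c := Nat.pos_of_mul_pos_right (hcd ▸ hq)
  have he0 : 0 < e := Nat.pos_of_mul_pos_right (hc ▸ hc0)
  have huvR : (u : ℤ) * v = f * g * k := by exact_mod_cast huv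
  have hdR : (d : ℤ) = j * k := by exact_mod_cast hd
  have hcR : (c : ℤ) = e * g := by exact_mod_cast hc
  rw [momentTerm_eq (h' := -Nat.gcdA d c * (f * k)) (K := e) hq ⟨d, hcd.symm⟩ hv heu
    (by rw [hcR]; linear_combination -Nat.gcdA d c * e * huvR)]
  congr 1
  have hej : Nat.Coprime j e := by
    refine Nat.Coprime.coprime_dvd_left ⟨k, hd⟩ (Nat.Coprime.coprime_dvd_right ⟨g, hc⟩ hcop.symm)
  suffices H : (e : ℤ) ∣ -j * (-Nat.gcdA d c * (f * k)) - f by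
    rw [corr_one_eq he0 (w := -j) (b := f) ((Nat.isCoprime_iff_coprime.2 hej).neg_left) H, corr_comm]
  obtain ⟨t, ht⟩ := gcdA_modEq hcop.symm
  refine ⟨f * g * t, ?_⟩
  rw [hdR, hcR] at ht
  linear_combination f * ht

end Factorisation

/-! ### Divisors indexed by exponents at the primes of q -/

section PrimeProducts

/-- The number with exponent `n p` at each prime factor `p` of `q`. -/
def primeProd (q : ℕ) (n : q.primeFactors → ℕ) : ℕ := ∏ i : q.primeFactors, (i : ℕ) ^ n i

variable {q : ℕ}

lemma primeProd_add (n m : q.primeFactors → ℕ) :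
    primeProd q (fun i => n i + m i) = primeProd q n * primeProd q m := by
  simp only [primeProd, pow_add, Finset.prod_mul_distrib]

lemma prime_of_primeFactors (i : q.primeFactors) : (i : ℕ).Prime := Nat.prime_of_mem_primeFactors i.2

lemma primeProd_pos (n : q.primeFactors → ℕ) : 0 < primeProd q n :=
  Finset.prod_pos fun i _ => pow_pos (prime_of_primeFactors i).pos _

lemma primeProd_factorization (hq : 0 < q) {m : ℕ} (hm : m ∣ q) :
    primeProd q (fun i => m.factorization i) = m := by
  have hm0 : m ≠ 0 := ne_zero_of_dvd_ne_zero hq.ne' hm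
  conv_rhs => rw [← Nat.prod_factorization_pow_eq_self hm0]
  rw [Finsupp.prod_of_support_subset (s := q.primeFactors) _ (by
    rw [Nat.support_factorization]; exact Nat.primeFactors_mono hm hq.ne') _ (fun _ _ => pow_zero _)]
  exact Finset.prod_coe_sort q.primeFactors (fun p => p ^ m.factorization p)

lemma primeProd_dvd (hq : 0 < q) {n : q.primeFactors → ℕ} (h : ∀ i, n i ≤ q.factorization i) :
    primeProd q n ∣ q := by
  conv_rhs => rw [← primeProd_factorization hq dvd_rfl]
  exact Finset.prod_dvd_prod_of_dvd _ _ fun i _ => pow_dvd_pow _ (h i)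

lemma primeProd_coprime {n m : q.primeFactors → ℕ} (h : ∀ i, n i = 0 ∨ m i = 0) :
    Nat.Coprime (primeProd q n) (primeProd q m) := by
  refine Nat.Coprime.prod_left fun i _ => Nat.Coprime.prod_right fun k _ => ?_
  by_cases hik : i = k
  · subst hik
    rcases h i with h | h <;> simp [h]
  · refine Nat.Coprime.pow _ _ ((Nat.coprime_primes (prime_of_primeFactors i) (prime_of_primeFactors k)).2 ?_)
    exact fun h => hik (Subtype.ext h)

lemma prime_dvd_primeProd (n : q.primeFactors → ℕ) (i : q.primeFactors) :
    (i : ℕ) ∣ primeProd q n ↔ n i ≠ 0 := by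
  constructor
  · intro h hn
    obtain ⟨k, -, hk⟩ := ((prime_of_primeFactors i).prime.dvd_finsetProd_iff _).1 h
    have h2 := (Nat.prime_dvd_prime_iff_eq (prime_of_primeFactors i) (prime_of_primeFactors k)).1
      ((prime_of_primeFactors i).dvd_of_dvd_pow hk)
    have : i = k := Subtype.ext h2
    subst this
    rw [hn, pow_zero] at hk
    exact (prime_of_primeFactors i).one_lt.ne' (Nat.dvd_one.1 hk)
  · exact fun h => (dvd_pow_self _ h).trans (Finset.dvd_prod_of_mem _ (Finset.mem_univ i))

lemma multiplicative_prod {ι : Type*} (h : ℕ → ℝ) (h1 : h 1 = 1)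
    (hm : ∀ m n, Nat.Coprime m n → h (m * n) = h m * h n) (g : ι → ℕ) (s : Finset ι)
    (hg : (s : Set ι).Pairwise (Function.onFun Nat.Coprime g)) :
    h (∏ i ∈ s, g i) = ∏ i ∈ s, h (g i) := by
  classical
  induction s using Finset.induction_on with
  | empty => simpa using h1
  | insert a s ha ih =>
    rw [Finset.prod_insert ha, Finset.prod_insert ha, hm, ih]
    · exact hg.mono (by simp)
    · refine Nat.Coprime.prod_right fun i hi => hg (by simp) (by simp [hi]) ?_
      rintro rfl; exact ha hi

lemma multiplicative_primeProd (h : ℕ → ℝ) (h1 : h 1 = 1)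
    (hm : ∀ m n, Nat.Coprime m n → h (m * n) = h m * h n) (n : q.primeFactors → ℕ) :
    h (primeProd q n) = ∏ i : q.primeFactors, h ((i : ℕ) ^ n i) := by
  refine multiplicative_prod h h1 hm _ _ fun i _ k _ hik => Nat.Coprime.pow _ _ ?_
  exact (Nat.coprime_primes (prime_of_primeFactors i) (prime_of_primeFactors k)).2
    fun h => hik (Subtype.ext h)

lemma moebius_primeProd (n : q.primeFactors → ℕ) :
    (ArithmeticFunction.moebius (primeProd q n) : ℝ) = ∏ i : q.primeFactors, (ArithmeticFunction.moebius ((i : ℕ) ^ n i) : ℝ) :=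
  multiplicative_primeProd (fun m => (ArithmeticFunction.moebius m : ℝ)) (by simp)
    (fun m n h => by
      rw [ArithmeticFunction.isMultiplicative_moebius.map_mul_of_coprime h]; push_cast; rfl) n

lemma totient_primeProd (n : q.primeFactors → ℕ) :
    (Nat.totient (primeProd q n) : ℝ) = ∏ i : q.primeFactors, (Nat.totient ((i : ℕ) ^ n i) : ℝ) :=
  multiplicative_primeProd (fun m => (Nat.totient m : ℝ)) (by simp)
    (fun m n h => by rw [Nat.totient_mul h]; push_cast; rfl) n

lemma sqrt_primeProd (n : q.primeFactors → ℕ) :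
    √(primeProd q n : ℝ) = ∏ i : q.primeFactors, √(((i : ℕ) ^ n i : ℕ) : ℝ) :=
  multiplicative_primeProd (fun m => √(m : ℝ)) (by simp)
    (fun m n _ => by push_cast; exact Real.sqrt_mul (Nat.cast_nonneg _) _) n

lemma log_primeProd (n : q.primeFactors → ℕ) :
    Real.log (primeProd q n) = ∑ i : q.primeFactors, Real.log (((i : ℕ) ^ n i : ℕ) : ℝ) := by
  rw [primeProd, Nat.cast_prod, Real.log_prod]
  exact fun i _ => by exact_mod_cast (pow_pos (prime_of_primeFactors i).pos _).ne'

lemma factorization_pos (i : q.primeFactors) : 0 < q.factorization i :=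
  Nat.pos_of_ne_zero (Finsupp.mem_support_iff.1 (by rw [Nat.support_factorization]; exact i.2))

/-- Only squarefree divisors matter, and these correspond to subsets of the primes of `q`. -/
lemma sum_divisors_moebius_mul (hq : 0 < q) (F : ℕ → ℝ) :
    ∑ u ∈ q.divisors, (ArithmeticFunction.moebius u : ℝ) * F u =
      ∑ β : q.primeFactors → Bool, (ArithmeticFunction.moebius (primeProd q fun i => (β i).toNat) : ℝ) *
        F (primeProd q fun i => (β i).toNat) := by
  rw [← Finset.sum_filter_of_ne (p := Squarefree) (s := q.divisors) (fun u _ h => by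
    rw [← ArithmeticFunction.moebius_ne_zero_iff_squarefree]
    intro h0; rw [h0] at h; simp at h)]
  have le1 : ∀ b : Bool, b.toNat ≤ 1 := fun b => by cases b <;> simp
  have key : ∀ u ∈ q.divisors.filter Squarefree,
      primeProd q (fun i => (decide ((i : ℕ) ∣ u)).toNat) = u := by
    intro u hu
    rw [Finset.mem_filter, Nat.mem_divisors] at hu
    conv_rhs => rw [← primeProd_factorization hq hu.1.1]
    congr 1
    funext i
    by_cases h : (i : ℕ) ∣ u
    · have := hu.2.natFactorization_le_one (i : ℕ)
      have h2 := (prime_of_primeFactors i).factorization_pos_of_dvd hu.2.ne_zero h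
      simp only [h, decide_true, Bool.toNat_true]; omega
    · simp [h, Nat.factorization_eq_zero_of_not_dvd h]
  refine Finset.sum_bij' (fun u _ i => decide ((i : ℕ) ∣ u)) (fun β _ => primeProd q fun i => (β i).toNat)
    (fun _ _ => Finset.mem_univ _) (fun β _ => ?_) key (fun β _ => ?_) (fun u hu => ?_)
  · rw [Finset.mem_filter, Nat.mem_divisors]
    refine ⟨⟨primeProd_dvd hq fun i => (le1 _).trans (factorization_pos i), hq.ne'⟩, ?_⟩
    rw [primeProd]
    refine Finset.squarefree_prod_of_pairwise_isCoprime (fun i _ k _ hik => ?_) (fun i _ => ?_)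
    · refine Nat.coprime_iff_isRelPrime.1 (Nat.Coprime.pow _ _ ?_)
      exact (Nat.coprime_primes (prime_of_primeFactors i) (prime_of_primeFactors k)).2
        fun h => hik (Subtype.ext h)
    · cases β i
      · simp
      · simpa using (prime_of_primeFactors i).prime.squarefree
  · funext i
    rw [Bool.eq_iff_iff, decide_eq_true_iff, prime_dvd_primeProd]
    cases β i <;> simp
  · rw [key u hu]

lemma sum_coprimePairs (hq : 0 < q) (F : ℕ → ℕ → ℝ) :
    ∑ x ∈ coprimePairs q, F x.1 x.2 =
      ∑ γ : q.primeFactors → Bool, F (primeProd q fun i => if γ i then q.factorization i else 0)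
        (primeProd q fun i => if γ i then 0 else q.factorization i) := by
  have key : ∀ c d, c * d = q → Nat.Coprime c d →
      primeProd q (fun i => if decide ((i : ℕ) ∣ c) then q.factorization i else 0) = c := by
    intro c d hcd hcop
    conv_rhs => rw [← primeProd_factorization hq ⟨d, hcd.symm⟩]
    congr 1
    funext i
    by_cases h : (i : ℕ) ∣ c
    · simp only [h, decide_true, if_true]
      have hc0 : c ≠ 0 := by rintro rfl; simp at hcd; omega
      refine (congrArg (fun n => n.factorization i) hcd.symm).trans
        (Nat.factorization_eq_of_coprime_left hcop ?_)
      exact List.mem_toFinset.1 (Nat.mem_primeFactors.2 ⟨prime_of_primeFactors i, h, hc0⟩)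
    · simp [h, Nat.factorization_eq_zero_of_not_dvd h]
  have mul : ∀ γ : q.primeFactors → Bool, primeProd q (fun i => if γ i then q.factorization i else 0) *
        primeProd q (fun i => if γ i then 0 else q.factorization i) = q := by
    intro γ
    rw [← primeProd_add]
    conv_rhs => rw [← primeProd_factorization hq dvd_rfl]
    congr 1
    funext i
    cases γ i <;> simp
  have inv : ∀ x ∈ coprimePairs q, (primeProd q (fun i => if decide ((i : ℕ) ∣ x.1) then q.factorization i else 0),
      primeProd q (fun i => if decide ((i : ℕ) ∣ x.1) then 0 else q.factorization i)) = x := by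
    intro x hx
    rw [coprimePairs, Finset.mem_filter, Nat.mem_divisorsAntidiagonal] at hx
    have h1 := key x.1 x.2 hx.1.1 hx.2
    have h2 := mul fun i => decide ((i : ℕ) ∣ x.1)
    rw [h1] at h2
    have hc0 : 0 < x.1 := Nat.pos_of_mul_pos_right (hx.1.1 ▸ hq)
    exact Prod.ext h1 (Nat.eq_of_mul_eq_mul_left hc0 (h2.trans hx.1.1.symm))
  refine Finset.sum_bij' (fun x _ i => decide ((i : ℕ) ∣ x.1))
    (fun γ _ => (primeProd q fun i => if γ i then q.factorization i else 0,
      primeProd q fun i => if γ i then 0 else q.factorization i))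
    (fun _ _ => Finset.mem_univ _) (fun γ _ => ?_) inv (fun γ _ => ?_) (fun x hx => ?_)
  · rw [coprimePairs, Finset.mem_filter, Nat.mem_divisorsAntidiagonal]
    refine ⟨⟨mul γ, hq.ne'⟩, ?_⟩
    dsimp only
    exact primeProd_coprime fun i => by cases γ i <;> simp
  · funext i
    rw [Bool.eq_iff_iff, decide_eq_true_iff, prime_dvd_primeProd]
    have := (factorization_pos i).ne'
    cases γ i <;> simp [this]
  · have h := inv x hx
    conv_lhs => rw [← h]

lemma sum_prod_arrow {ι α β : Type*} [Fintype ι] [DecidableEq ι] [Fintype α] [Fintype β]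
    (H : (ι → α) → (ι → β) → ℝ) :
    ∑ x : ι → α × β, H (fun i => (x i).1) (fun i => (x i).2) = ∑ f : ι → α, ∑ g : ι → β, H f g := by
  rw [← Fintype.sum_prod_type' (f := H)]
  exact (Equiv.arrowProdEquivProdArrow ι (fun _ => α) (fun _ => β)).sum_comp (fun y => H y.1 y.2)

end PrimeProducts

/-! ### Local choices and the blocks they determine -/

section Blocks

/-- At each prime `p ∣ q`: whether `p` divides the first factor of a coprime factorization of `q`,
and whether it divides each of two squarefree divisors of `q`. -/
abbrev LocalChoice := Bool × Bool × Bool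

namespace LocalChoice

/-- The exponent of the first factor. -/
def fstExp (a : ℕ) (t : LocalChoice) : ℕ := if t.1 then a else 0
/-- The exponent of the second factor. -/
def sndExp (a : ℕ) (t : LocalChoice) : ℕ := if t.1 then 0 else a
/-- The exponent of the first squarefree divisor. -/
def uExp (_ : ℕ) (t : LocalChoice) : ℕ := t.2.1.toNat
/-- The exponent of the second squarefree divisor. -/
def vExp (_ : ℕ) (t : LocalChoice) : ℕ := t.2.2.toNat
/-- The exponent of the part of the first factor that survives cancellation. -/
def eExp (a : ℕ) (t : LocalChoice) : ℕ := if t.1 then a - (t.2.1.toNat + t.2.2.toNat) else 0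
/-- The exponent of the part of the second factor that survives cancellation. -/
def jExp (a : ℕ) (t : LocalChoice) : ℕ := if t.1 then 0 else a - (t.2.1.toNat + t.2.2.toNat)
/-- The exponent of the cancelled part of the first factor. -/
def gExp (a : ℕ) (t : LocalChoice) : ℕ := if t.1 then min a (t.2.1.toNat + t.2.2.toNat) else 0
/-- The exponent of the cancelled part of the second factor. -/
def kExp (a : ℕ) (t : LocalChoice) : ℕ := if t.1 then 0 else min a (t.2.1.toNat + t.2.2.toNat)
/-- The exponent of the excess of the squarefree divisors. -/
def fExp (a : ℕ) (t : LocalChoice) : ℕ := t.2.1.toNat + t.2.2.toNat - a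

end LocalChoice

open LocalChoice

/-- The product of the prime powers with local exponents `φ`. -/
def blockProd {q : ℕ} (φ : ℕ → LocalChoice → ℕ) (x : q.primeFactors → LocalChoice) : ℕ :=
  primeProd q fun i => φ (q.factorization i) (x i)

/-- The weight of a family of local choices. -/
noncomputable def blockWeight {q : ℕ} (x : q.primeFactors → LocalChoice) : ℝ :=
  (ArithmeticFunction.moebius (blockProd fstExp x) : ℝ) ^ 2 * (blockProd sndExp x).totient / √q *
    (ArithmeticFunction.moebius (blockProd uExp x) * ArithmeticFunction.moebius (blockProd vExp x) *
      ((√(blockProd uExp x))⁻¹ * (√(blockProd vExp x))⁻¹))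

variable {q : ℕ}

lemma blockProd_pos (φ : ℕ → LocalChoice → ℕ) (x : q.primeFactors → LocalChoice) : 0 < blockProd φ x :=
  primeProd_pos _

lemma blockProd_mul (φ ψ : ℕ → LocalChoice → ℕ) (x : q.primeFactors → LocalChoice) :
    blockProd φ x * blockProd ψ x = blockProd (fun a t => φ a t + ψ a t) x :=
  (primeProd_add _ _).symm

lemma blockProd_congr {φ ψ : ℕ → LocalChoice → ℕ} (h : ∀ a t, 0 < a → φ a t = ψ a t)
    (x : q.primeFactors → LocalChoice) : blockProd φ x = blockProd ψ x := by
  rw [blockProd, blockProd]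
  congr 1
  funext i
  exact h _ _ (factorization_pos i)

lemma blockProd_dvd (hq : 0 < q) {φ : ℕ → LocalChoice → ℕ} (h : ∀ a t, 0 < a → φ a t ≤ a)
    (x : q.primeFactors → LocalChoice) : blockProd φ x ∣ q :=
  primeProd_dvd hq fun i => h _ _ (factorization_pos i)

lemma blockProd_coprime {φ ψ : ℕ → LocalChoice → ℕ} (h : ∀ a t, φ a t = 0 ∨ ψ a t = 0)
    (x : q.primeFactors → LocalChoice) : Nat.Coprime (blockProd φ x) (blockProd ψ x) :=
  primeProd_coprime fun _ => h _ _

lemma toNat_le_one (b : Bool) : b.toNat ≤ 1 := by cases b <;> simp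

lemma fst_mul_snd (hq : 0 < q) (x : q.primeFactors → LocalChoice) :
    blockProd fstExp x * blockProd sndExp x = q := by
  rw [blockProd_mul]
  conv_rhs => rw [← primeProd_factorization hq dvd_rfl]
  rw [blockProd]
  congr 1
  funext i
  rw [fstExp, sndExp]; split_ifs <;> simp

lemma fst_coprime_snd (x : q.primeFactors → LocalChoice) :
    Nat.Coprime (blockProd fstExp x) (blockProd sndExp x) :=
  blockProd_coprime (fun a t => by rw [fstExp, sndExp]; split_ifs <;> simp) x

lemma fst_eq (x : q.primeFactors → LocalChoice) :
    blockProd fstExp x = blockProd eExp x * blockProd gExp x := by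
  rw [blockProd_mul]
  refine blockProd_congr (fun a t ha => ?_) x
  rw [fstExp, eExp, gExp]; split_ifs <;> omega

lemma snd_eq (x : q.primeFactors → LocalChoice) :
    blockProd sndExp x = blockProd jExp x * blockProd kExp x := by
  rw [blockProd_mul]
  refine blockProd_congr (fun a t ha => ?_) x
  rw [sndExp, jExp, kExp]; split_ifs <;> omega

/-- Locally `n = (n - a) + min a n` with truncated subtraction, `n` being the exponent in `uv`.
Since `n ≤ 2`, the excess block only involves primes dividing `q` exactly once and dividing both `u`
and `v`. -/
lemma u_mul_v (x : q.primeFactors → LocalChoice) :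
    blockProd uExp x * blockProd vExp x = blockProd fExp x * blockProd gExp x * blockProd kExp x := by
  rw [blockProd_mul, blockProd_mul, blockProd_mul]
  refine blockProd_congr (fun a t ha => ?_) x
  rw [uExp, vExp, fExp, gExp, kExp]; split_ifs <;> omega

lemma v_dvd (hq : 0 < q) (x : q.primeFactors → LocalChoice) : blockProd vExp x ∣ q :=
  blockProd_dvd hq (fun a t ha => by rw [vExp]; have := toNat_le_one t.2.2; omega) x

lemma u_dvd (hq : 0 < q) (x : q.primeFactors → LocalChoice) : blockProd uExp x ∣ q :=
  blockProd_dvd hq (fun a t ha => by rw [uExp]; have := toNat_le_one t.2.1; omega) x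

lemma j_mul_u_dvd (hq : 0 < q) (x : q.primeFactors → LocalChoice) :
    blockProd jExp x * blockProd uExp x ∣ q := by
  rw [blockProd_mul]
  refine blockProd_dvd hq (fun a t ha => ?_) x
  rw [jExp, uExp]; have := toNat_le_one t.2.1; split_ifs <;> omega

lemma e_mul_u_dvd (hq : 0 < q) (x : q.primeFactors → LocalChoice) :
    blockProd eExp x * blockProd uExp x ∣ q := by
  rw [blockProd_mul]
  refine blockProd_dvd hq (fun a t ha => ?_) x
  rw [eExp, uExp]; have := toNat_le_one t.2.1; split_ifs <;> omega

lemma e_coprime_f (x : q.primeFactors → LocalChoice) :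
    Nat.Coprime (blockProd eExp x) (blockProd fExp x) :=
  blockProd_coprime (fun a t => by rw [eExp, fExp]; split_ifs <;> omega) x

lemma j_coprime_f (x : q.primeFactors → LocalChoice) :
    Nat.Coprime (blockProd jExp x) (blockProd fExp x) :=
  blockProd_coprime (fun a t => by rw [jExp, fExp]; split_ifs <;> omega) x

lemma sum_choices (hq : 0 < q) (A : ℕ → ℕ → ℝ) (F : ℕ → ℕ → ℕ → ℕ → ℝ) :
    ∑ y ∈ coprimePairs q, A y.1 y.2 * ∑ u ∈ q.divisors, ∑ v ∈ q.divisors,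
        (ArithmeticFunction.moebius u : ℝ) * ArithmeticFunction.moebius v * F y.1 y.2 u v =
      ∑ x : q.primeFactors → LocalChoice, A (blockProd fstExp x) (blockProd sndExp x) *
        (ArithmeticFunction.moebius (blockProd uExp x) * ArithmeticFunction.moebius (blockProd vExp x) *
          F (blockProd fstExp x) (blockProd sndExp x) (blockProd uExp x) (blockProd vExp x)) := by
  let γ1 : (q.primeFactors → Bool) → ℕ := fun γ => primeProd q fun i => if γ i then q.factorization i else 0
  let γ2 : (q.primeFactors → Bool) → ℕ := fun γ => primeProd q fun i => if γ i then 0 else q.factorization i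
  let β : (q.primeFactors → Bool) → ℕ := fun β => primeProd q fun i => (β i).toNat
  have e : ∀ c d : ℕ, ∑ u ∈ q.divisors, ∑ v ∈ q.divisors,
      (ArithmeticFunction.moebius u : ℝ) * ArithmeticFunction.moebius v * F c d u v =
      ∑ b1 : q.primeFactors → Bool, ∑ b2 : q.primeFactors → Bool,
        ArithmeticFunction.moebius (β b1) * ArithmeticFunction.moebius (β b2) * F c d (β b1) (β b2) := by
    intro c d
    simp_rw [mul_assoc, ← Finset.mul_sum]
    rw [sum_divisors_moebius_mul hq fun u => ∑ v ∈ q.divisors, (ArithmeticFunction.moebius v : ℝ) * F c d u v]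
    refine Finset.sum_congr rfl fun b1 _ => ?_
    rw [sum_divisors_moebius_mul hq fun v => F c d _ v]
  simp_rw [e]
  rw [sum_coprimePairs hq fun c d => A c d * ∑ b1 : q.primeFactors → Bool, ∑ b2 : q.primeFactors → Bool,
        (ArithmeticFunction.moebius (β b1) : ℝ) * ArithmeticFunction.moebius (β b2) * F c d (β b1) (β b2)]
  have h1 := sum_prod_arrow (ι := q.primeFactors) (α := Bool) (β := Bool × Bool)
    fun g b => A (γ1 g) (γ2 g) * (ArithmeticFunction.moebius (β fun i => (b i).1) *
      ArithmeticFunction.moebius (β fun i => (b i).2) *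
        F (γ1 g) (γ2 g) (β fun i => (b i).1) (β fun i => (b i).2))
  refine Eq.trans ?_ h1.symm
  refine Finset.sum_congr rfl fun g _ => ?_
  rw [← Finset.mul_sum]
  congr 1
  exact (sum_prod_arrow (ι := q.primeFactors) (α := Bool) (β := Bool)
    fun b1 b2 => ArithmeticFunction.moebius (β b1) * ArithmeticFunction.moebius (β b2) *
      F (γ1 g) (γ2 g) (β b1) (β b2)).symm

lemma momentTerm_blockProd (hq : 0 < q) (x : q.primeFactors → LocalChoice) :
    momentTerm q (blockProd sndExp x) (Nat.gcdA (blockProd fstExp x) (blockProd sndExp x))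
      (blockProd uExp x) (blockProd vExp x) =
    (√(blockProd uExp x))⁻¹ * (√(blockProd vExp x))⁻¹ *
      corr (blockProd jExp x) (blockProd eExp x) (blockProd fExp x) :=
  momentTerm_gcdA hq (fst_mul_snd hq x) (fst_coprime_snd x) (fst_eq x) (snd_eq x) (u_mul_v x)
    (v_dvd hq x) (j_mul_u_dvd hq x)

lemma momentTerm_blockProd_neg (hq : 0 < q) (x : q.primeFactors → LocalChoice) :
    momentTerm q (blockProd fstExp x) (-Nat.gcdA (blockProd sndExp x) (blockProd fstExp x))
      (blockProd uExp x) (blockProd vExp x) =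
    (√(blockProd uExp x))⁻¹ * (√(blockProd vExp x))⁻¹ *
      corr (blockProd eExp x) (blockProd fExp x) (-(blockProd jExp x)) :=
  momentTerm_neg_gcdA hq (fst_mul_snd hq x) (fst_coprime_snd x) (fst_eq x) (snd_eq x) (u_mul_v x)
    (v_dvd hq x) (e_mul_u_dvd hq x)

theorem primitiveMeanSquare_eq_sum (q : ℕ) [NeZero q] :
    primitiveMeanSquare q = ∑ x : q.primeFactors → LocalChoice, blockWeight x *
      corr (blockProd jExp x) (blockProd eExp x) (blockProd fExp x) := by
  have hq : 0 < q := Nat.pos_of_neZero q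
  rw [primitiveMeanSquare_eq]
  simp_rw [twistedMoment_eq_sum hq]
  rw [sum_choices hq (fun c d => (ArithmeticFunction.moebius c : ℝ) ^ 2 * d.totient / √q)
    fun c d u v => momentTerm q d (Nat.gcdA c d) u v]
  refine Finset.sum_congr rfl fun x _ => ?_
  rw [momentTerm_blockProd hq, blockWeight]
  ring

theorem secondaryTerms_eq_sum (hq : 1 < q) :
    secondaryTerms q = ((∑ x : q.primeFactors → LocalChoice, blockWeight x * (2 *
      if blockProd fstExp x < blockProd sndExp x then
        corr (blockProd eExp x) (blockProd fExp x) (-(blockProd jExp x))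
      else corr (blockProd jExp x) (blockProd eExp x) (blockProd fExp x)) : ℝ) : ℂ) := by
  have hq0 : 0 < q := by omega
  rw [secondaryTerms_eq hq]
  congr 1
  have h := sum_choices hq0 (fun c d => (ArithmeticFunction.moebius c : ℝ) ^ 2 * d.totient / √q)
    fun c d u v => 2 * if c < d then momentTerm q c (-Nat.gcdA d c) u v else momentTerm q d (Nat.gcdA c d) u v
  refine Eq.trans (Finset.sum_congr rfl fun y _ => ?_) (h.trans (Finset.sum_congr rfl fun x _ => ?_))
  · congr 1
    split_ifs <;>
    · rw [twistedMoment_eq_sum hq0, Finset.mul_sum]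
      refine Finset.sum_congr rfl fun u _ => ?_
      rw [Finset.mul_sum]
      exact Finset.sum_congr rfl fun v _ => by ring
  · rw [momentTerm_blockProd hq0, momentTerm_blockProd_neg hq0, blockWeight]
    split_ifs <;> ring

end Blocks

/-! ### Sums of product weights over families -/

section SumsOverFamilies

variable {ι : Type*} [Fintype ι] [DecidableEq ι] {κ : Type*} [Fintype κ]

lemma sum_prod_family (w : ι → κ → ℝ) : ∑ x : ι → κ, ∏ i, w i (x i) = ∏ i, ∑ t, w i t := by
  rw [Finset.prod_univ_sum, Fintype.piFinset_univ]

/-- For each summand `ℓ i` only the factor at `i` changes, so the sum factors as in the Leibniz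
rule. -/
lemma sum_prod_family_mul_sum {w ℓ : ι → κ → ℝ} {M r : ι → ℝ} (hM : ∀ i, ∑ t, w i t = M i)
    (hr : ∀ i, ∑ t, w i t * ℓ i t = M i * r i) :
    ∑ x : ι → κ, (∏ i, w i (x i)) * ∑ i, ℓ i (x i) = (∏ i, M i) * ∑ i, r i := by
  simp_rw [Finset.mul_sum]
  rw [Finset.sum_comm]
  refine Finset.sum_congr rfl fun i _ => ?_
  have e : ∀ x : ι → κ, (∏ k, w k (x k)) * ℓ i (x i) =
      ∏ k, w k (x k) * (if k = i then ℓ k (x k) else 1) := fun x => by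
    rw [Finset.prod_mul_distrib, Finset.prod_ite_eq' Finset.univ i fun k => ℓ k (x k), if_pos (Finset.mem_univ i)]
  rw [Finset.sum_congr rfl fun x _ => e x,
    sum_prod_family fun k t => w k t * (if k = i then ℓ k t else 1)]
  have e2 : ∀ k, ∑ t, w k t * (if k = i then ℓ k t else 1) = M k * (if k = i then r k else 1) := by
    intro k
    split_ifs with h
    · exact hr k
    · simp only [mul_one]; exact hM k
  rw [Finset.prod_congr rfl fun k _ => e2 k, Finset.prod_mul_distrib, Finset.prod_ite_eq' Finset.univ i r,
    if_pos (Finset.mem_univ i)]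

lemma sum_prod_family_comp {T : Type*} [DecidableEq T] (w : ι → κ → ℝ) (τ : ι → κ → T) (G : (ι → T) → ℝ)
    (S : ι → Finset T) (hS : ∀ i t, τ i t ∈ S i) :
    ∑ x : ι → κ, (∏ i, w i (x i)) * G (fun i => τ i (x i)) =
      ∑ y ∈ Fintype.piFinset S, (∏ i, ∑ t, w i t * (if τ i t = y i then 1 else 0)) * G y := by
  simp_rw [← sum_prod_family fun i t => w i t * (if τ i t = _ then 1 else 0), Finset.sum_mul]
  rw [Finset.sum_comm]
  refine Finset.sum_congr rfl fun x _ => ?_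
  have hmem : (fun i => τ i (x i)) ∈ Fintype.piFinset S := Fintype.mem_piFinset.2 fun i => hS i _
  rw [Finset.sum_eq_single_of_mem _ hmem]
  · simp
  · intro y _ hy
    obtain ⟨i, hi⟩ := Function.ne_iff.1 hy
    rw [Finset.prod_eq_zero (Finset.mem_univ i), zero_mul]
    rw [if_neg (Ne.symm hi), mul_zero]

/-- If at every index the signed weight has equal pushforwards under `τ` and `σ`, so has the product
weight; `G` itself need not factor. -/
lemma sum_prod_family_comp_eq {T : Type*} (w : ι → κ → ℝ) (τ σ : ι → κ → T) (G : (ι → T) → ℝ)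
    (h : ∀ i (g : T → ℝ), ∑ t, w i t * g (τ i t) = ∑ t, w i t * g (σ i t)) :
    ∑ x : ι → κ, (∏ i, w i (x i)) * G (fun i => τ i (x i)) =
      ∑ x : ι → κ, (∏ i, w i (x i)) * G (fun i => σ i (x i)) := by
  classical
  let S : ι → Finset T := fun i => Finset.univ.image (τ i) ∪ Finset.univ.image (σ i)
  rw [sum_prod_family_comp w τ G S fun i t => Finset.mem_union_left _ (Finset.mem_image_of_mem _ (Finset.mem_univ _)),
    sum_prod_family_comp w σ G S fun i t => Finset.mem_union_right _ (Finset.mem_image_of_mem _ (Finset.mem_univ _))]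
  refine Finset.sum_congr rfl fun y _ => ?_
  congr 1
  exact Finset.prod_congr rfl fun i _ => h i fun t => if t = y i then 1 else 0

end SumsOverFamilies

/-! ### The identities at one prime -/

section LocalSums

open LocalChoice

/-- The contribution of one prime to `blockWeight`. -/
noncomputable def localWeight (p a : ℕ) (t : LocalChoice) : ℝ :=
  (ArithmeticFunction.moebius (p ^ fstExp a t) : ℝ) ^ 2 * (p ^ sndExp a t).totient / √((p ^ a : ℕ) : ℝ) *
    (ArithmeticFunction.moebius (p ^ uExp a t) * ArithmeticFunction.moebius (p ^ vExp a t) *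
      ((√((p ^ uExp a t : ℕ) : ℝ))⁻¹ * (√((p ^ vExp a t : ℕ) : ℝ))⁻¹))

lemma blockWeight_eq_prod {q : ℕ} (hq : 0 < q) (x : q.primeFactors → LocalChoice) :
    blockWeight x = ∏ i : q.primeFactors, localWeight i (q.factorization i) (x i) := by
  have hs : √(q : ℝ) = ∏ i : q.primeFactors, √(((i : ℕ) ^ q.factorization i : ℕ) : ℝ) := by
    rw [← sqrt_primeProd, primeProd_factorization hq dvd_rfl]
  simp only [blockWeight, blockProd, moebius_primeProd, totient_primeProd, sqrt_primeProd, hs, localWeight,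
    ← Finset.prod_pow, ← Finset.prod_mul_distrib, ← Finset.prod_div_distrib, ← Finset.prod_inv_distrib]

lemma sum_localChoice (f : LocalChoice → ℝ) : ∑ t, f t =
    f (true, true, true) + f (true, true, false) + f (true, false, true) + f (true, false, false) +
    (f (false, true, true) + f (false, true, false) + f (false, false, true) + f (false, false, false)) := by
  simp only [Fintype.sum_prod_type, Fintype.sum_bool]
  ring

variable {p a : ℕ}

lemma localWeight_true_one (hp : p.Prime) (b1 b2 : Bool) :
    localWeight p 1 (true, b1, b2) = (√p)⁻¹ * ((-(√p)⁻¹) ^ b1.toNat * (-(√p)⁻¹) ^ b2.toNat) := by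
  have hμ := ArithmeticFunction.moebius_apply_prime hp
  cases b1 <;> cases b2 <;> simp [localWeight, fstExp, sndExp, uExp, vExp, hμ]

lemma localWeight_true (hp : p.Prime) (ha : 2 ≤ a) (b : Bool × Bool) : localWeight p a (true, b) = 0 := by
  have hμ := ArithmeticFunction.moebius_apply_prime_pow hp (k := a) (by omega)
  rw [if_neg (by omega)] at hμ
  simp [localWeight, fstExp, hμ]

lemma sqrt_pow_cast (p n : ℕ) : √((p : ℝ) ^ n) = √p ^ n :=
  (Real.sqrt_eq_iff_mul_self_eq (by positivity) (by positivity)).2 (by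
    rw [← mul_pow, Real.mul_self_sqrt (by positivity)])

lemma localWeight_false (hp : p.Prime) (b1 b2 : Bool) :
    localWeight p a (false, b1, b2) = (p ^ a).totient * (√p ^ a)⁻¹ *
      ((-(√p)⁻¹) ^ b1.toNat * (-(√p)⁻¹) ^ b2.toNat) := by
  have hμ := ArithmeticFunction.moebius_apply_prime hp
  cases b1 <;> cases b2 <;> simp [localWeight, fstExp, sndExp, uExp, vExp, hμ, sqrt_pow_cast] <;> (try left) <;> ring

lemma totient_prime_pow_cast (hp : p.Prime) (ha : 0 < a) :
    ((p ^ a).totient : ℝ) = (p : ℝ) ^ a * (1 - (p : ℝ)⁻¹) := by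
  have hp0 : (p : ℝ) ≠ 0 := by exact_mod_cast hp.ne_zero
  obtain ⟨n, rfl⟩ := Nat.exists_eq_succ_of_ne_zero ha.ne'
  rw [Nat.totient_prime_pow_succ hp, Nat.cast_mul, Nat.cast_pred hp.pos, Nat.succ_eq_add_one, pow_succ]
  push_cast
  field_simp

/-- For `a ≥ 2` both exponents vanish wherever the weight does not. For `a = 1`, the triple `(1, 0,
0)` has weight `p^{-1/2}`, and `(0, 1, 0)` has total weight `p^{-3/2} + (p - 1) p^{-3/2}`, one part
from each side of the factorisation. These agree. -/
lemma sum_localWeight_swap (hp : p.Prime) (ha : 0 < a) (g : ℕ × ℕ × ℕ → ℝ) :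
    ∑ t, localWeight p a t * g (eExp a t, fExp a t, jExp a t) =
      ∑ t, localWeight p a t * g (fExp a t, eExp a t, jExp a t) := by
  rw [sum_localChoice, sum_localChoice]
  rcases (by omega : a = 1 ∨ 2 ≤ a) with rfl | ha
  · simp only [localWeight_true_one hp, localWeight_false hp, totient_prime_pow_cast hp one_pos]
    have hp0 : (0 : ℝ) < p := by exact_mod_cast hp.pos
    have hs := Real.sqrt_pos.2 hp0
    have h2 : (p : ℝ) = √p ^ 2 := (Real.sq_sqrt hp0.le).symm
    simp only [eExp, fExp, jExp, Bool.toNat_true, Bool.toNat_false]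
    norm_num
    set s := √(p : ℝ)
    rw [h2]
    field_simp
    ring
  · simp only [localWeight_true hp ha, zero_mul, zero_add]
    simp [eExp, fExp, jExp, Nat.sub_eq_zero_of_le ha, Nat.sub_eq_zero_of_le (one_le_two.trans ha)]

/-- The local factor of the main term. -/
noncomputable def localMass (p a : ℕ) : ℝ :=
  ((p ^ a).totient - (p ^ (a - 1)).totient) * ((p ^ a).totient / (p : ℝ) ^ a)

/-- The ratio `j / (e f)` of the surviving blocks at one prime. -/
noncomputable def localRatio (p a : ℕ) (t : LocalChoice) : ℝ :=
  ((p ^ jExp a t : ℕ) : ℝ) / ((p ^ eExp a t : ℕ) * (p ^ fExp a t : ℕ))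

lemma sqrt_localRatio (t : LocalChoice) :
    √(localRatio p a t) = √p ^ jExp a t / (√p ^ eExp a t * √p ^ fExp a t) := by
  rw [localRatio, Real.sqrt_div (by positivity), Real.sqrt_mul (by positivity)]
  push_cast
  simp only [sqrt_pow_cast]

lemma log_localRatio (hp : p.Prime) (t : LocalChoice) :
    Real.log (localRatio p a t) = ((jExp a t : ℝ) - (eExp a t + fExp a t)) * Real.log p := by
  have hp0 : (p : ℝ) ≠ 0 := by exact_mod_cast hp.ne_zero
  rw [localRatio]
  push_cast
  rw [Real.log_div (pow_ne_zero _ hp0) (by positivity), Real.log_mul (pow_ne_zero _ hp0) (pow_ne_zero _ hp0),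
    Real.log_pow, Real.log_pow, Real.log_pow]
  ring

lemma sum_localWeight_sqrt (hp : p.Prime) (ha : 0 < a) :
    ∑ t, localWeight p a t * √(localRatio p a t) = localMass p a := by
  have hp0 : (0 : ℝ) < p := by exact_mod_cast hp.pos
  have hs := Real.sqrt_pos.2 hp0
  have h2 : (p : ℝ) = √p ^ 2 := (Real.sq_sqrt hp0.le).symm
  rw [sum_localChoice, localMass]
  simp only [sqrt_localRatio]
  rcases (by omega : a = 1 ∨ 2 ≤ a) with rfl | ha2
  · simp only [localWeight_true_one hp, localWeight_false hp, totient_prime_pow_cast hp one_pos]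
    simp only [eExp, fExp, jExp, Bool.toNat_true, Bool.toNat_false]
    norm_num
    set s := √(p : ℝ)
    rw [h2]
    field_simp
    ring
  · obtain ⟨n, rfl⟩ := Nat.exists_eq_add_of_le' ha2
    simp only [localWeight_true hp ha2, zero_mul, zero_add, localWeight_false hp]
    rw [totient_prime_pow_cast hp ha, totient_prime_pow_cast hp (by omega)]
    simp only [eExp, fExp, jExp, Bool.toNat_true, Bool.toNat_false]
    norm_num
    set s := √(p : ℝ)
    rw [h2]
    simp only [pow_add]
    field_simp
    ring

/-- Over all primes the terms `a log p` build up `log q`, and the others give the sum of `log p / (p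
- 1)` in `mainTerm`. -/
lemma sum_localWeight_sqrt_log (hp : p.Prime) (ha : 0 < a) :
    ∑ t, localWeight p a t * √(localRatio p a t) * Real.log (localRatio p a t) =
      localMass p a * (a * Real.log p + 2 * (Real.log p / ((p : ℝ) - 1))) := by
  have hp0 : (0 : ℝ) < p := by exact_mod_cast hp.pos
  have hp1 : (p : ℝ) - 1 ≠ 0 := sub_ne_zero.2 (by exact_mod_cast hp.one_lt.ne')
  have hs := Real.sqrt_pos.2 hp0
  have h2 : (p : ℝ) = √p ^ 2 := (Real.sq_sqrt hp0.le).symm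
  rw [sum_localChoice, localMass]
  simp only [sqrt_localRatio, log_localRatio hp]
  rcases (by omega : a = 1 ∨ 2 ≤ a) with rfl | ha2
  · simp only [localWeight_true_one hp, localWeight_false hp, totient_prime_pow_cast hp one_pos]
    simp only [eExp, fExp, jExp, Bool.toNat_true, Bool.toNat_false]
    norm_num
    generalize Real.log p = L
    set s := √(p : ℝ)
    rw [h2] at hp1 ⊢
    field_simp
    ring
  · obtain ⟨n, rfl⟩ := Nat.exists_eq_add_of_le' ha2
    simp only [localWeight_true hp ha2, zero_mul, zero_add, localWeight_false hp]
    rw [totient_prime_pow_cast hp ha, totient_prime_pow_cast hp (by omega)]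
    simp only [eExp, fExp, jExp, Bool.toNat_true, Bool.toNat_false]
    norm_num
    generalize Real.log p = L
    set s := √(p : ℝ)
    rw [h2] at hp1 ⊢
    simp only [pow_add]
    field_simp
    ring

end LocalSums

/-! ### Assembling the main term and the global symmetry -/

section MainTerm

open LocalChoice

variable {q : ℕ}

/-- The ratio `j / (e f)` of the surviving blocks. -/
noncomputable def blockRatio (x : q.primeFactors → LocalChoice) : ℝ :=
  (blockProd jExp x : ℝ) / (blockProd eExp x * blockProd fExp x)

lemma blockRatio_eq_prod (x : q.primeFactors → LocalChoice) :
    blockRatio x = ∏ i : q.primeFactors, localRatio i (q.factorization i) (x i) := by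
  simp only [blockRatio, blockProd, primeProd, localRatio, Finset.prod_div_distrib, Finset.prod_mul_distrib,
    Nat.cast_prod]

lemma localRatio_pos {p : ℕ} (hp : p.Prime) (a : ℕ) (t : LocalChoice) : 0 < localRatio p a t := by
  have : (0 : ℝ) < p := by exact_mod_cast hp.pos
  rw [localRatio]; push_cast; positivity

lemma weight_mul_sqrt_eq_prod (hq : 0 < q) (x : q.primeFactors → LocalChoice) :
    blockWeight x * √(blockRatio x) = ∏ i : q.primeFactors,
      localWeight i (q.factorization i) (x i) * √(localRatio i (q.factorization i) (x i)) := by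
  rw [blockWeight_eq_prod hq, blockRatio_eq_prod, Real.sqrt_prod, Finset.prod_mul_distrib]
  exact fun i _ => (localRatio_pos (prime_of_primeFactors i) _ _).le

lemma log_blockRatio (x : q.primeFactors → LocalChoice) :
    Real.log (blockRatio x) = ∑ i : q.primeFactors, Real.log (localRatio i (q.factorization i) (x i)) := by
  rw [blockRatio_eq_prod, Real.log_prod]
  exact fun i _ => (localRatio_pos (prime_of_primeFactors i) _ _).ne'

lemma sum_weight_main (hq : 0 < q) (A : ℝ) :
    ∑ x : q.primeFactors → LocalChoice, blockWeight x * (√(blockRatio x) * (Real.log (blockRatio x) + A)) =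
      (∏ i : q.primeFactors, localMass i (q.factorization i)) *
        (Real.log q + A + 2 * ∑ p ∈ q.primeFactors, Real.log p / ((p : ℝ) - 1)) := by
  have hM := fun i : q.primeFactors => sum_localWeight_sqrt (prime_of_primeFactors i) (factorization_pos i)
  have h1 := sum_prod_family_mul_sum
    (w := fun (i : q.primeFactors) t => localWeight i (q.factorization i) t * √(localRatio i (q.factorization i) t))
    (ℓ := fun (i : q.primeFactors) t => Real.log (localRatio i (q.factorization i) t)) hM
    (fun i => sum_localWeight_sqrt_log (prime_of_primeFactors i) (factorization_pos i))
  have h2 := sum_prod_family fun (i : q.primeFactors) t =>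
    localWeight i (q.factorization i) t * √(localRatio i (q.factorization i) t)
  have e : ∀ x : q.primeFactors → LocalChoice,
      blockWeight x * (√(blockRatio x) * (Real.log (blockRatio x) + A)) =
      (blockWeight x * √(blockRatio x)) * Real.log (blockRatio x) + (blockWeight x * √(blockRatio x)) * A :=
    fun x => by ring
  simp_rw [e, weight_mul_sqrt_eq_prod hq, log_blockRatio]
  rw [Finset.sum_add_distrib, h1, ← Finset.sum_mul, h2, Finset.prod_congr rfl fun i _ => hM i]
  have hlog : Real.log q = ∑ i : q.primeFactors, (q.factorization i : ℝ) * Real.log (i : ℕ) := by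
    have h := log_primeProd (q := q) fun i => q.factorization i
    rw [primeProd_factorization hq dvd_rfl] at h
    rw [h]
    exact Finset.sum_congr rfl fun i _ => by rw [Nat.cast_pow, Real.log_pow]
  rw [Finset.sum_add_distrib, ← Finset.mul_sum, ← hlog,
    Finset.sum_coe_sort q.primeFactors fun p => Real.log p / ((p : ℝ) - 1)]
  ring

lemma numPrimitive_eq_prod (q : ℕ) [NeZero q] : (numPrimitive q : ℝ) = ∏ i : q.primeFactors,
    (((i : ℕ) ^ q.factorization i).totient - ((i : ℕ) ^ (q.factorization i - 1)).totient : ℝ) := by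
  have hq : 0 < q := Nat.pos_of_neZero q
  rw [numPrimitive_eq, Nat.sum_divisorsAntidiagonal fun c d => (ArithmeticFunction.moebius c : ℝ) * d.totient,
    sum_divisors_moebius_mul hq fun u => ((q / u).totient : ℝ)]
  have hdiv : ∀ β : q.primeFactors → Bool, q / primeProd q (fun i => (β i).toNat) =
      primeProd q (fun i => q.factorization i - (β i).toNat) := by
    intro β
    refine Nat.div_eq_of_eq_mul_right (primeProd_pos _) ?_
    rw [← primeProd_add]
    conv_lhs => rw [← primeProd_factorization hq dvd_rfl]
    congr 1
    funext i
    have := toNat_le_one (β i)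
    have := factorization_pos i
    omega
  simp_rw [hdiv, moebius_primeProd, totient_primeProd, ← Finset.prod_mul_distrib]
  rw [sum_prod_family fun (i : q.primeFactors) (b : Bool) =>
    (ArithmeticFunction.moebius ((i : ℕ) ^ b.toNat) : ℝ) *
      (((i : ℕ) ^ (q.factorization i - b.toNat)).totient : ℝ)]
  refine Finset.prod_congr rfl fun i _ => ?_
  rw [Fintype.sum_bool]
  simp [ArithmeticFunction.moebius_apply_prime (prime_of_primeFactors i)]
  ring

theorem mainTerm_eq_sum (q : ℕ) [NeZero q] : mainTerm q =
    ∑ x : q.primeFactors → LocalChoice, blockWeight x *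
      (√(blockRatio x) * (Real.log (blockRatio x) + diagConst)) := by
  have hq : 0 < q := Nat.pos_of_neZero q
  have hq' : (0 : ℝ) < q := by exact_mod_cast hq
  have htot : (q.totient : ℝ) / q = ∏ i : q.primeFactors,
      (((i : ℕ) ^ q.factorization i).totient / ((i : ℕ) : ℝ) ^ q.factorization i : ℝ) := by
    have h1 := totient_primeProd (q := q) fun i => q.factorization i
    have h2 : (q : ℝ) = ∏ i : q.primeFactors, ((i : ℕ) : ℝ) ^ q.factorization i := by
      conv_lhs => rw [← primeProd_factorization hq dvd_rfl]
      rw [primeProd]; push_cast; rfl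
    rw [primeProd_factorization hq dvd_rfl] at h1
    rw [Finset.prod_div_distrib, ← h1, ← h2]
  rw [sum_weight_main hq, mainTerm, numPrimitive_eq_prod, htot, ← Finset.prod_mul_distrib, diagConst_eq,
    Real.log_div hq'.ne' (by positivity)]
  simp only [localMass]
  ring

/-- The correlations do not factor over primes, but they depend on the choices only through the
three blocks, so the local symmetry suffices. -/
theorem sum_weight_corr_swap (hq : 0 < q) :
    ∑ x : q.primeFactors → LocalChoice, blockWeight x *
      corr (blockProd eExp x) (blockProd fExp x) (-(blockProd jExp x)) =
    ∑ x : q.primeFactors → LocalChoice, blockWeight x *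
      corr (blockProd fExp x) (blockProd eExp x) (-(blockProd jExp x)) := by
  simp_rw [blockWeight_eq_prod hq]
  exact sum_prod_family_comp_eq (fun (i : q.primeFactors) t => localWeight i (q.factorization i) t)
    (fun i t => (eExp (q.factorization i) t, fExp (q.factorization i) t, jExp (q.factorization i) t))
    (fun i t => (fExp (q.factorization i) t, eExp (q.factorization i) t, jExp (q.factorization i) t))
    (fun y => corr (primeProd q fun i => (y i).1) (primeProd q fun i => (y i).2.1)
      (-(primeProd q fun i => (y i).2.2)))
    (fun i g => sum_localWeight_swap (prime_of_primeFactors i) (factorization_pos i) g)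

end MainTerm

/-! ### Size of the weights -/

section Bounds

open LocalChoice

variable {q : ℕ}

lemma abs_moebius_le_one_real (n : ℕ) : |(ArithmeticFunction.moebius n : ℝ)| ≤ 1 := by
  exact_mod_cast ArithmeticFunction.abs_moebius_le_one (n := n)

/-- Bound the Möbius factors by 1 and `φ(d)` by `d = jk`. With `q = egjk` and `uv = fgk`, the
quotient `jk/√(q u v)` is exactly `√(j/(ef))/g`. -/
lemma abs_blockWeight_le (hq : 0 < q) (x : q.primeFactors → LocalChoice) :
    |blockWeight x| ≤ √(blockRatio x) / blockProd gExp x := by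
  have hcd := fst_mul_snd hq x
  have huv := u_mul_v x
  have hc := fst_eq x
  have hd := snd_eq x
  rw [blockWeight, blockRatio]
  have hU := blockProd_pos uExp x
  have hV := blockProd_pos vExp x
  have hE := blockProd_pos eExp x
  have hF := blockProd_pos fExp x
  have hJ := blockProd_pos jExp x
  have hG := blockProd_pos gExp x
  have hK := blockProd_pos kExp x
  set c := blockProd fstExp x
  set d := blockProd sndExp x
  set U := blockProd uExp x
  set V := blockProd vExp x
  set e := blockProd eExp x
  set f := blockProd fExp x
  set j := blockProd jExp x
  set g := blockProd gExp x
  set k := blockProd kExp x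
  have hU' : (0 : ℝ) < U := by exact_mod_cast hU
  have hV' : (0 : ℝ) < V := by exact_mod_cast hV
  have hE' : (0 : ℝ) < e := by exact_mod_cast hE
  have hF' : (0 : ℝ) < f := by exact_mod_cast hF
  have hJ' : (0 : ℝ) < j := by exact_mod_cast hJ
  have hG' : (0 : ℝ) < g := by exact_mod_cast hG
  have hK' : (0 : ℝ) < k := by exact_mod_cast hK
  have hq' : (q : ℝ) = e * g * (j * k) := by rw [← hcd, hc, hd]; push_cast; ring
  have huv' : (U : ℝ) * V = f * g * k := by exact_mod_cast huv
  have htot : (d.totient : ℝ) ≤ j * k := by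
    have : (d.totient : ℝ) ≤ d := by exact_mod_cast Nat.totient_le d
    rwa [hd, Nat.cast_mul, ← hd] at this
  have h1 : |(ArithmeticFunction.moebius c : ℝ) ^ 2| ≤ 1 := by
    rw [abs_pow]; exact pow_le_one₀ (abs_nonneg _) (abs_moebius_le_one_real c)
  have h2 : |(ArithmeticFunction.moebius U : ℝ) * ArithmeticFunction.moebius V| ≤ 1 := by
    rw [abs_mul]
    exact mul_le_one₀ (abs_moebius_le_one_real _) (abs_nonneg _) (abs_moebius_le_one_real _)
  have key : (j * k : ℝ) / √q * ((√U)⁻¹ * (√V)⁻¹) = √(j / (e * f)) / g := by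
    rw [← mul_inv, ← Real.sqrt_mul hU'.le, huv', hq', Real.sqrt_div hJ'.le, Real.sqrt_mul (by positivity),
      Real.sqrt_mul (by positivity) (g : ℝ), Real.sqrt_mul (by positivity) (k : ℝ),
      Real.sqrt_mul (by positivity) (k : ℝ), Real.sqrt_mul (by positivity) (g : ℝ), Real.sqrt_mul hE'.le f]
    have a1 := Real.mul_self_sqrt hJ'.le
    have a2 := Real.mul_self_sqrt hK'.le
    have a3 := Real.mul_self_sqrt hG'.le
    have p1 := Real.sqrt_pos.2 hJ'
    have p2 := Real.sqrt_pos.2 hK'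
    have p3 := Real.sqrt_pos.2 hG'
    have p4 := Real.sqrt_pos.2 hE'
    have p5 := Real.sqrt_pos.2 hF'
    rw [div_mul_eq_mul_div, div_eq_div_iff (by positivity) (by positivity)]
    rw [← a1, ← a2, ← a3]
    simp only [Real.sqrt_mul_self p1.le, Real.sqrt_mul_self p2.le, Real.sqrt_mul_self p3.le]
    field_simp
  rw [← key, abs_mul, abs_div, abs_mul, abs_mul, abs_of_nonneg (Real.sqrt_nonneg _),
    abs_of_nonneg (by positivity : (0 : ℝ) ≤ (d.totient : ℝ)),
    abs_of_nonneg (by positivity : (0 : ℝ) ≤ (√(U : ℝ))⁻¹ * (√(V : ℝ))⁻¹)]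
  have b1 : |(ArithmeticFunction.moebius c : ℝ) ^ 2| * d.totient / √q ≤ (j * k : ℝ) / √q := by
    refine div_le_div_of_nonneg_right ?_ (Real.sqrt_nonneg _)
    exact (mul_le_of_le_one_left (Nat.cast_nonneg _) h1).trans htot
  have b2 : |(ArithmeticFunction.moebius U : ℝ) * ArithmeticFunction.moebius V| *
      ((√(U : ℝ))⁻¹ * (√(V : ℝ))⁻¹) ≤ (√(U : ℝ))⁻¹ * (√(V : ℝ))⁻¹ :=
    mul_le_of_le_one_left (by positivity) h2
  exact mul_le_mul b1 b2 (by positivity) (by positivity)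

end Bounds

/-! ### The total error -/

section ErrorBound

open LocalChoice

variable {q : ℕ}

lemma log_natCast_nonneg (n : ℕ) : 0 ≤ Real.log n := Real.log_natCast_nonneg n

lemma log_le_of_dvd {m n : ℕ} (hn : 0 < n) (h : m ∣ n) : Real.log m ≤ Real.log n := by
  have hm : 0 < m := Nat.pos_of_dvd_of_pos h hn
  exact Real.log_le_log (by exact_mod_cast hm) (by exact_mod_cast Nat.le_of_dvd hn h)

lemma log_blockProd_e_le (hq : 0 < q) (x : q.primeFactors → LocalChoice) :
    Real.log (blockProd eExp x) ≤ Real.log q :=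
  log_le_of_dvd hq ((dvd_mul_right _ _).trans (e_mul_u_dvd hq x))

lemma log_blockProd_j_le (hq : 0 < q) (x : q.primeFactors → LocalChoice) :
    Real.log (blockProd jExp x) ≤ Real.log q :=
  log_le_of_dvd hq ((dvd_mul_right _ _).trans (j_mul_u_dvd hq x))

lemma log_blockProd_f_le (hq : 0 < q) (x : q.primeFactors → LocalChoice) :
    Real.log (blockProd fExp x) ≤ 2 * Real.log q := by
  have h : blockProd fExp x ∣ q ^ 2 := by
    rw [sq]
    refine dvd_trans ?_ (mul_dvd_mul (u_dvd hq x) (v_dvd hq x))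
    rw [u_mul_v, mul_assoc]
    exact dvd_mul_right _ _
  have := log_le_of_dvd (pow_pos hq 2) h
  rwa [Nat.cast_pow, Real.log_pow, Nat.cast_ofNat] at this

/-- The last two correlations cancel after summation, by `sum_weight_corr_swap`. They are inserted
so that for `c < d` the bracket is precisely the reciprocity error, whose size `√(ef/j)` is
compensated by the weight. -/
theorem exists_weight_bracket_le : ∃ K : ℝ, 0 ≤ K ∧ ∀ (q : ℕ), 0 < q → ∀ x : q.primeFactors → LocalChoice,
    |blockWeight x * (corr (blockProd jExp x) (blockProd eExp x) (blockProd fExp x)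
      - √(blockRatio x) * (Real.log (blockRatio x) + diagConst)
      - 2 * (if blockProd fstExp x < blockProd sndExp x then
        corr (blockProd eExp x) (blockProd fExp x) (-(blockProd jExp x))
      else corr (blockProd jExp x) (blockProd eExp x) (blockProd fExp x))
      + corr (blockProd eExp x) (blockProd fExp x) (-(blockProd jExp x))
      - corr (blockProd fExp x) (blockProd eExp x) (-(blockProd jExp x)))| ≤ K * (1 + Real.log q) := by
  obtain ⟨C1, hC1, H1⟩ := exists_abs_corr_sub_le
  obtain ⟨C2, hC2, H2⟩ := exists_abs_corr_le
  refine ⟨3 * C1 + 2 * (4 + |diagConst|) + 4 * C2, by positivity, fun q hq x => ?_⟩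
  have hW := abs_blockWeight_le hq x
  have hle := log_blockProd_e_le hq x
  have hlj := log_blockProd_j_le hq x
  have hlf := log_blockProd_f_le hq x
  have hef := e_coprime_f x
  have hjf := j_coprime_f x
  have hcd := fst_mul_snd hq x
  have hc := fst_eq x
  have hd := snd_eq x
  rw [blockRatio] at *
  have hE := blockProd_pos eExp x
  have hF := blockProd_pos fExp x
  have hJ := blockProd_pos jExp x
  have hG := blockProd_pos gExp x
  have hK := blockProd_pos kExp x
  set c := blockProd fstExp x
  set d := blockProd sndExp x
  set e := blockProd eExp x
  set f := blockProd fExp x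
  set j := blockProd jExp x
  set g := blockProd gExp x
  set k := blockProd kExp x
  set W := blockWeight x
  have hE' : (0 : ℝ) < e := by exact_mod_cast hE
  have hF' : (0 : ℝ) < f := by exact_mod_cast hF
  have hJ' : (0 : ℝ) < j := by exact_mod_cast hJ
  have hG' : (1 : ℝ) ≤ g := by exact_mod_cast hG
  have hG0 : (0 : ℝ) < g := by linarith
  have hF1 : (1 : ℝ) ≤ f := by exact_mod_cast hF
  have lE := log_natCast_nonneg e
  have lF := log_natCast_nonneg f
  have lJ := log_natCast_nonneg j
  have lQ := log_natCast_nonneg q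
  have hR : (0 : ℝ) < j / (e * f) := by positivity
  set R : ℝ := j / (e * f) with hRdef
  have hlR : Real.log R = Real.log j - (Real.log e + Real.log f) := by
    rw [hRdef, Real.log_div hJ'.ne' (by positivity), Real.log_mul hE'.ne' hF'.ne']
  have hlef : Real.log ((e : ℝ) * f) = Real.log e + Real.log f := Real.log_mul hE'.ne' hF'.ne'
  have hΔ := H1 e f j hE hF hJ hef
  rw [hlef] at hΔ
  set Δ := corr j e f - √R * (Real.log R + diagConst) - corr e f (-j) - corr f e (-j) with hΔdef
  have hWΔ : |W * Δ| ≤ 3 * C1 * (1 + Real.log q) := by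
    rw [abs_mul]
    have h1 : √R / g ≤ √R := div_le_self (Real.sqrt_nonneg _) hG'
    have h2 : √R * √((e : ℝ) * f / j) = 1 := by
      rw [← Real.sqrt_mul hR.le, hRdef, div_mul_div_cancel₀' (by positivity), div_self (by positivity), Real.sqrt_one]
    calc |W| * |Δ| ≤ √R * (C1 * √((e : ℝ) * f / j) * (1 + (Real.log e + Real.log f))) :=
          mul_le_mul (hW.trans h1) hΔ (abs_nonneg _) (Real.sqrt_nonneg _)
      _ = (√R * √((e : ℝ) * f / j)) * (C1 * (1 + (Real.log e + Real.log f))) := by ring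
      _ = C1 * (1 + (Real.log e + Real.log f)) := by rw [h2, one_mul]
      _ ≤ C1 * (3 * (1 + Real.log q)) := by gcongr; linarith
      _ = _ := by ring
  by_cases hlt : c < d
  · rw [if_pos hlt]
    have : corr j e f - √R * (Real.log R + diagConst) - 2 * corr e f (-j) + corr e f (-j) - corr f e (-j) = Δ := by
      rw [hΔdef]; ring
    rw [this]
    refine hWΔ.trans ?_
    have : 0 ≤ (2 * (4 + |diagConst|) + 4 * C2) * (1 + Real.log q) := by positivity
    linarith
  -- For `d ≤ c`, twice the original correlation is subtracted. Modulo the reciprocity error this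
  -- leaves the main term and one dual correlation, both negligible because `j ≤ d ≤ c = eg` makes
  -- the weight small.
  · rw [if_neg hlt]
    have hjg : (j : ℝ) ≤ e * g := by
      have : j ≤ e * g := by
        rw [← hc]
        refine le_trans ?_ (not_lt.1 hlt)
        rw [hd]
        exact Nat.le_mul_of_pos_right _ hK
      exact_mod_cast this
    have hWm : |W * (√R * (Real.log R + diagConst))| ≤ (4 + |diagConst|) * (1 + Real.log q) := by
      have h1 : √R / g * √R ≤ 1 := by
        rw [div_mul_eq_mul_div, Real.mul_self_sqrt hR.le, hRdef, div_div, div_le_one (by positivity)]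
        refine hjg.trans ?_
        have : (e : ℝ) * g * 1 ≤ e * g * f := by gcongr
        linarith
      have h2 : |Real.log R + diagConst| ≤ (4 + |diagConst|) * (1 + Real.log q) := by
        have h3 : |Real.log R| ≤ 4 * Real.log q := by rw [hlR, abs_le]; constructor <;> linarith
        have h4 := abs_add_le (Real.log R) diagConst
        have h5 : 0 ≤ |diagConst| * Real.log q := by positivity
        linarith
      rw [abs_mul, abs_mul, abs_of_nonneg (Real.sqrt_nonneg _), ← mul_assoc]
      have h6 : |W| * √R ≤ 1 := (mul_le_mul_of_nonneg_right hW (Real.sqrt_nonneg _)).trans h1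
      exact (mul_le_of_le_one_left (abs_nonneg _) h6).trans h2
    have hWc : |W * corr f e (-j)| ≤ 2 * C2 * (1 + Real.log q) := by
      have h1 := H2 f e (-j) hF (Nat.isCoprime_iff_coprime.2 hef) (Nat.isCoprime_iff_coprime.2 hjf).neg_left
      -- Here `Rf = j/e ≤ g ≤ g²`.
      have h2 : √R / g * √f ≤ 1 := by
        rw [div_mul_eq_mul_div, ← Real.sqrt_mul hR.le, div_le_one hG0, hRdef]
        rw [Real.sqrt_le_left hG0.le, div_mul_eq_mul_div, div_le_iff₀ (by positivity)]
        have : (e : ℝ) * g * f * 1 ≤ e * g * f * g := by gcongr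
        have h7 := mul_le_mul_of_nonneg_right hjg hF'.le
        linarith
      have h3 : |W| * √f ≤ 1 := (mul_le_mul_of_nonneg_right hW (Real.sqrt_nonneg _)).trans h2
      rw [abs_mul]
      calc |W| * |corr f e (-j)| ≤ |W| * (C2 * √f * (1 + Real.log f)) := by gcongr
        _ = |W| * √f * (C2 * (1 + Real.log f)) := by ring
        _ ≤ C2 * (1 + Real.log f) := mul_le_of_le_one_left (by positivity) h3
        _ ≤ C2 * (2 * (1 + Real.log q)) := by gcongr; linarith
        _ = _ := by ring
    have : W * (corr j e f - √R * (Real.log R + diagConst) - 2 * corr j e f + corr e f (-j) - corr f e (-j)) =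
        -(W * Δ) - 2 * (W * (√R * (Real.log R + diagConst))) - 2 * (W * corr f e (-j)) := by
      rw [hΔdef]; ring
    rw [this]
    have t1 := abs_le.1 hWΔ
    have t2 := abs_le.1 hWm
    have t3 := abs_le.1 hWc
    rw [abs_le]
    constructor <;> nlinarith [t1.1, t1.2, t2.1, t2.2, t3.1, t3.2]

/-- Primes with `p^δ ≥ B` pay for their own factor `B`; the finitely many smaller ones go into the
constant. -/
lemma exists_pow_card_primeFactors_le {δ : ℝ} (hδ : 0 < δ) (B : ℕ) (hB : 1 ≤ B) :
    ∃ C : ℝ, 0 ≤ C ∧ ∀ q : ℕ, 0 < q → (B : ℝ) ^ q.primeFactors.card ≤ C * (q : ℝ) ^ δ := by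
  obtain ⟨N, hN⟩ := ((tendsto_rpow_atTop hδ).comp tendsto_natCast_atTop_atTop).eventually_ge_atTop
    (B : ℝ) |>.exists_forall_of_atTop
  have hB' : (1 : ℝ) ≤ B := by exact_mod_cast hB
  refine ⟨(B : ℝ) ^ N, by positivity, fun q hq => ?_⟩
  have hp1 : ∀ p ∈ q.primeFactors, (1 : ℝ) ≤ (p : ℝ) ^ δ := fun p hp =>
    Real.one_le_rpow (by exact_mod_cast (Nat.prime_of_mem_primeFactors hp).one_le) hδ.le
  calc (B : ℝ) ^ q.primeFactors.card = ∏ p ∈ q.primeFactors, (B : ℝ) := by rw [Finset.prod_const]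
    _ ≤ ∏ p ∈ q.primeFactors, (if p < N then (B : ℝ) else 1) * (p : ℝ) ^ δ := by
        refine Finset.prod_le_prod (fun _ _ => by positivity) fun p hp => ?_
        split_ifs with h
        · exact le_mul_of_one_le_right (by positivity) (hp1 p hp)
        · rw [one_mul]; exact hN p (not_lt.1 h)
    _ = (B : ℝ) ^ (q.primeFactors.filter (· < N)).card * (∏ p ∈ q.primeFactors, (p : ℝ)) ^ δ := by
        rw [Finset.prod_mul_distrib, ← Finset.prod_filter, Finset.prod_const,
          Real.finsetProd_rpow _ _ fun _ _ => by positivity]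
    _ ≤ (B : ℝ) ^ N * (q : ℝ) ^ δ := by
        gcongr
        · calc (q.primeFactors.filter (· < N)).card ≤ (Finset.range N).card :=
              Finset.card_le_card fun p hp => Finset.mem_range.2 (Finset.mem_filter.1 hp).2
            _ = N := Finset.card_range N
        · rw [← Nat.cast_prod]
          exact_mod_cast Nat.le_of_dvd hq (Nat.prod_primeFactors_dvd q)

theorem exists_error_le_rpow {ε : ℝ} (hε : 0 < ε) : ∃ C : ℝ, 0 ≤ C ∧ ∀ (q : ℕ) [NeZero q], 1 < q →
    ‖(primitiveMeanSquare q : ℂ) - ((mainTerm q : ℂ) + secondaryTerms q)‖ ≤ C * (q : ℝ) ^ ε := by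
  obtain ⟨K, hK, HK⟩ := exists_weight_bracket_le
  -- Half of `ε` absorbs the number `8^ω(q)` of choices, the other half the logarithm.
  obtain ⟨C, hC, HC⟩ := exists_pow_card_primeFactors_le (half_pos hε) 8 (by norm_num)
  refine ⟨C * (K * (1 + 1 / (ε / 2))), by positivity, fun q _ hq1 => ?_⟩
  have hq : 0 < q := by omega
  have hqR : (1 : ℝ) ≤ q := by exact_mod_cast hq
  rw [secondaryTerms_eq_sum hq1, ← Complex.ofReal_add, ← Complex.ofReal_sub, Complex.norm_real, Real.norm_eq_abs,
    primitiveMeanSquare_eq_sum, mainTerm_eq_sum]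
  have hswap := sum_weight_corr_swap hq
  rw [← sub_eq_zero, ← Finset.sum_sub_distrib] at hswap
  rw [← Finset.sum_add_distrib, ← Finset.sum_sub_distrib, ← add_zero (Finset.sum _ _), ← hswap,
    ← Finset.sum_add_distrib]
  have hcard : ((Finset.univ : Finset (q.primeFactors → LocalChoice)).card : ℝ) = (8 : ℕ) ^ q.primeFactors.card := by
    rw [Finset.card_univ, Fintype.card_fun]
    simp
  have hpow : (1 : ℝ) ≤ (q : ℝ) ^ (ε / 2) := Real.one_le_rpow hqR (by positivity)
  have hlog := Real.log_le_rpow_div (Nat.cast_nonneg q) (half_pos hε)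
  calc _ ≤ ∑ x : q.primeFactors → LocalChoice, K * (1 + Real.log q) := by
        refine (Finset.abs_sum_le_sum_abs _ _).trans (Finset.sum_le_sum fun x _ => ?_)
        refine le_trans (le_of_eq ?_) (HK q hq x)
        congr 1
        ring
    _ = (8 : ℕ) ^ q.primeFactors.card * (K * (1 + Real.log q)) := by
        rw [Finset.sum_const, nsmul_eq_mul, hcard]
    _ ≤ (C * (q : ℝ) ^ (ε / 2)) * (K * ((1 + 1 / (ε / 2)) * (q : ℝ) ^ (ε / 2))) := by
        have h0 := log_natCast_nonneg q
        refine mul_le_mul (HC q hq) (mul_le_mul_of_nonneg_left ?_ hK) (by positivity) (by positivity)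
        rw [div_eq_mul_one_div] at hlog
        linarith
    _ = C * (K * (1 + 1 / (ε / 2))) * ((q : ℝ) ^ (ε / 2) * (q : ℝ) ^ (ε / 2)) := by ring
    _ = _ := by rw [← Real.rpow_add (by linarith), add_halves]

lemma rpow_le_errorSize (q : ℕ) (D ε : ℝ) : (q : ℝ) ^ ε ≤ errorSize q D ε := by
  have h1 : 0 ≤ 1 / (q : ℝ) * ∑ d ∈ q.divisors.filter (fun d : ℕ => (d : ℝ) ≤ D),
      (Nat.totient d : ℝ) * (d : ℝ) ^ (3 / 2 : ℝ) :=
    mul_nonneg (by positivity) (Finset.sum_nonneg fun d _ => by positivity)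
  have h2 : 0 ≤ √q * ∑ d ∈ q.divisors.filter (fun d : ℕ => D < (d : ℝ)),
      (Nat.totient d : ℝ) / (d : ℝ) ^ (3 / 2 : ℝ) :=
    mul_nonneg (by positivity) (Finset.sum_nonneg fun d _ => by positivity)
  have h3 : 0 ≤ (q : ℝ) ^ (ε - 1) * D ^ 2 := by positivity
  rw [errorSize]
  linarith

end ErrorBound

theorem corollary8 (ε : ℝ) (hε : 0 < ε) :
    ∃ C : ℝ, ∀ (q : ℕ) [NeZero q] (D : ℝ), D ≤ Real.sqrt q →
      ‖(primitiveMeanSquare q : ℂ) - ((mainTerm q : ℂ) + secondaryTerms q)‖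
        ≤ C * errorSize q D ε := by
  obtain ⟨C, hC, H⟩ := exists_error_le_rpow hε
  -- The case `q = 1`, where `c = d = 1`, is outside `secondaryTerms_eq`; its fixed error is put
  -- into the constant, as `errorSize` is at least `1^ε = 1` there.
  refine ⟨max C ‖(primitiveMeanSquare 1 : ℂ) - ((mainTerm 1 : ℂ) + secondaryTerms 1)‖, fun q inst D _ => ?_⟩
  refine le_trans ?_ (mul_le_mul_of_nonneg_left (rpow_le_errorSize q D ε) (le_max_of_le_left hC))
  have hq : 0 < q := Nat.pos_of_neZero q
  rcases (by omega : q = 1 ∨ 1 < q) with rfl | h1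
  · rw [Nat.cast_one, Real.one_rpow, mul_one]
    exact le_max_right _ _
  · exact (H q h1).trans (mul_le_mul_of_nonneg_right (le_max_left _ _) (by positivity))
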